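/- **Setting.** Let $d\in\{1,2,3\}$, let $\mathbb T^d=([-1,1]|_{\{-1,1\}})^d$ be the flat torus, $p(\varrho)=a\varrho^\gamma$ with $a>0$, $1<\gamma<2$, $P(\varrho)=\frac{a}{\gamma-1}\varrho^\gamma$, and $T>0$. Fix $\lambda\in(0,1)$, $c>0$, $\kappa>0$. *Mesh.* $\mathcal T$ is a face-to-face grid of $\mathbb T^d$ consisting of translates $K$ of one box $\prod_{i=1}^d[0,h_i]$ with $\lambda h\le h_i\le h$, where $h>0$ is the mesh size; $\mathcal E$ is the set of faces and $\mathcal E(K)$ the set of faces of $K$. $\mathcal Q_h$ is the space of functions constant on each $K\in\mathcal T$, and $\Pi_{\mathcal T}v|_K=\frac1{|K|}\int_K v\,dx$. On a face $\sigma$ with normal $\mathbf n$ put $\overline v=\frac12(v^{\rm in}+v^{\rm out})$, $[\![v]\!]=v^{\rm out}-v^{\rm in}$, where $v^{\rm out},v^{\rm in}$ are the traces from the side to which $\mathbf n$ points and from the opposite side; on $\sigma\in\mathcal E(K)$, $\mathbf n$ is the outer normal of $K$. With $[f]^\pm=\frac12(f\pm|f|)$, the numerical flux is $$F_h(r,\mathbf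 v)=r^{\rm in}[\overline{\mathbf v}\cdot\mathbf n]^++r^{\rm out}[\overline{\mathbf v}\cdot\mathbf n]^--\kappa h^\alpha[\![r]\!],$$ applied componentwise (and then denoted $\mathbf F_h$) if $r$ is a vector. *Scheme.* Let $\Delta t=T/N_T$ with $N_T\in\mathbb N$, $N_T\ge1$, and $h/c\le\Delta t\le ch$. Given initial data $\varrho_0\in L^1(\mathbb T^d)$, $\varrho_0>0$ a.e., and $\mathbf u_0\in L^1(\mathbb T^d;\mathbb R^d)$, a numerical solution is a family $(\varrho_h^k,\mathbf u_h^k)\in\mathcal Q_h\times\mathcal Q_h^d$, $k=0,\dots,N_T$, with $(\varrho_h^0,\mathbf u_h^0)=(\Pi_{\mathcal T}\varrho_0,\Pi_{\mathcal T}\mathbf u_0)$ and, for all $k=1,\dots,N_T$, $K\in\mathcal T$, $$\frac{\varrho^k_K-\varrho^{k-1}_K}{\Delta t}+\sum_{\sigma\in\mathcal E(K)}\frac{|\sigma|}{|K|}F_h(\varrho_h^k,\mathbf u_h^k)=0,$$ $$\frac{(\varrho\mathbf u)^k_K-(\varrho\mathbf u)^{k-1}_K}{\Delta t}+\sum_{\sigma\in\mathcal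 E(K)}\frac{|\sigma|}{|K|}\Big(\mathbf F_h(\varrho_h^k\mathbf u_h^k,\mathbf u_h^k)+\overline{p(\varrho_h^k)}\,\mathbf n-h^\beta[\![\mathbf u_h^k]\!]\Big)=0.$$ It is extended in time by $v_h(t)=v_h^0$ for $t<\Delta t$ and $v_h(t)=v_h^k$ for $t\in[k\Delta t,(k+1)\Delta t)$. For $\boldsymbol\varphi:[0,T)\times\mathbb T^d\to\mathbb R^d$ put $$d(h,\boldsymbol\varphi)=-h^\beta\int_0^T\sum_{\sigma\in\mathcal E}\int_\sigma[\![\mathbf u_h]\!]\cdot[\![\Pi_{\mathcal T}\boldsymbol\varphi]\!]\,dS\,dt.$$ **Proposition.** Let $0<\alpha<1$ and $-1<\beta<\left(1-\frac2\gamma\right)-\frac\alpha\gamma$. Then there is $\delta>0$, depending only on $d,\gamma,\alpha,\beta$, such that the following holds. For all $a,T,\lambda,c,\kappa,\varrho_0,\mathbf u_0$ as above and every $E_0\in\mathbb R$ there is a constant $C>0$ such that for every mesh and time step as above and every numerical solution whose initial discrete energy satisfies $\int_{\mathbb T^d}\big[\frac12\varrho_h^0|\mathbf u_h^0|^2+P(\varrho_h^0)\big]dx\le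 E_0$: 1. for every $\varphi\in C^3_c([0,T)\times\mathbb T^d)$ there is an integrable $e_1=e_1(t,h,\varphi)$ on $(0,T)\times\mathbb T^d$ with $$-\int_{\mathbb T^d}\varrho_h^0\varphi(0,\cdot)\,dx=\int_0^T\!\!\int_{\mathbb T^d}\big[\varrho_h\partial_t\varphi+\varrho_h\mathbf u_h\cdot\nabla_x\varphi\big]dx\,dt+\int_0^T\!\!\int_{\mathbb T^d}e_1\,dx\,dt,\qquad \Big|\int_0^T\!\!\int_{\mathbb T^d}e_1\,dx\,dt\Big|\le C h^\delta\|\varphi\|_{C^3};$$ 2. for every $\boldsymbol\varphi\in C^3_c([0,T)\times\mathbb T^d;\mathbb R^d)$ there is an integrable $e_2=e_2(t,h,\boldsymbol\varphi)$ on $(0,T)\times\mathbb T^d$ with $$-\int_{\mathbb T^d}\varrho_h^0\mathbf u_h^0\cdot\boldsymbol\varphi(0,\cdot)\,dx=\int_0^T\!\!\int_{\mathbb T^d}\big[\varrho_h\mathbf u_h\cdot\partial_t\boldsymbol\varphi+\varrho_h\mathbf u_h\otimes\mathbf u_h:\nabla_x\boldsymbol\varphi+p(\varrho_h)\,{\rm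 div}_x\boldsymbol\varphi\big]dx\,dt+d(h,\boldsymbol\varphi)+\int_0^T\!\!\int_{\mathbb T^d}e_2\,dx\,dt,$$ $$\Big|\int_0^T\!\!\int_{\mathbb T^d}e_2\,dx\,dt\Big|\le C h^\delta\|\boldsymbol\varphi\|_{C^3},\qquad |d(h,\boldsymbol\varphi)|\le C h^{\frac{\beta+1}2}\|\boldsymbol\varphi\|_{C^3}.$$ -/

import Mathlib

open MeasureTheory Set

noncomputable section

namespace EulerFV

/-! The flat torus `𝕋ᵈ = ([-1,1]|_{-1,1})ᵈ`. Functions on it are functions on `Fin d → ℝ` that are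
`2`-periodic in each variable; integrals over it are integrals over the cube `[-1,1]ᵈ`. -/

/-- The fundamental cube `[-1,1]ᵈ`. -/
def torus (d : ℕ) : Set (Fin d → ℝ) := Icc (fun _ => -1) (fun _ => 1)

/-- `f` is `2`-periodic in each coordinate. -/
def TorusPeriodic {d : ℕ} {F : Type*} (f : (Fin d → ℝ) → F) : Prop :=
  ∀ (x : Fin d → ℝ) (i : Fin d), f (x + Pi.single i 2) = f x

/-! ### Mesh and discrete functions -/

/-- A grid of the torus with mesh size `h`: all elements are translates of one box
`∏ᵢ [0, hᵢ]` with `hᵢ = 2 / Nᵢ`, placed side by side (face to face) starting from an arbitrary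
corner `x₀`. -/
structure Mesh (d : ℕ) where
  h : ℝ
  h_pos : 0 < h
  /-- number of elements in each coordinate direction -/
  N : Fin d → ℕ+
  x₀ : Fin d → ℝ

namespace Mesh

variable {d : ℕ} (M : Mesh d)

/-- The edge lengths `hᵢ` of the elements. -/
def edge (i : Fin d) : ℝ := 2 / (M.N i : ℝ)

/-- Mesh regularity: `λ h ≤ hᵢ ≤ h`. -/
def Regular (lam : ℝ) : Prop := ∀ i, lam * M.h ≤ M.edge i ∧ M.edge i ≤ M.h

/-- The elements of the grid; the index in each direction is cyclic. -/
abbrev Cell : Type := (i : Fin d) → ZMod (M.N i)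

/-- A representative in `ℝᵈ` of the closed box occupied by the element `K`. -/
def cellSet (K : M.Cell) : Set (Fin d → ℝ) :=
  Icc (fun i => M.x₀ i + ((K i).val : ℝ) * M.edge i)
    (fun i => M.x₀ i + (((K i).val : ℝ) + 1) * M.edge i)

/-- The element containing the point `x` (points on faces are given to one of the neighbours). -/
def cellIndex (x : Fin d → ℝ) : M.Cell :=
  fun i => ((⌊(x i - M.x₀ i) / M.edge i⌋ : ℤ) : ZMod (M.N i))

/-- The piecewise constant (periodic) function of `𝒬_h` with the value `v K` on the element `K`. -/
def eval {F : Type*} (v : M.Cell → F) (x : Fin d → ℝ) : F := v (M.cellIndex x)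

/-- The volume `|K|` of an element. -/
def cellVol : ℝ := ∏ j, M.edge j

/-- The area `|σ|` of a face orthogonal to the `i`-th direction. -/
def faceArea (i : Fin d) : ℝ := ∏ j ∈ Finset.univ.erase i, M.edge j

/-- The projection `Π_𝒯`: averages over the elements. -/
def proj {F : Type*} [NormedAddCommGroup F] [NormedSpace ℝ F] (f : (Fin d → ℝ) → F)
    (K : M.Cell) : F :=
  (M.cellVol)⁻¹ • ∫ x in M.cellSet K, f x

/-- The neighbour of `K` across its face with outer normal `s eᵢ`, `s = ±1`. -/
def nbr (K : M.Cell) (i : Fin d) (s : ℤ) : M.Cell := K + Pi.single i (s : ZMod (M.N i))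

/-- The average of `v` on the face of `K` with outer normal `s eᵢ`. -/
def faceAvg (v : M.Cell → ℝ) (K : M.Cell) (i : Fin d) (s : ℤ) : ℝ :=
  (v K + v (M.nbr K i s)) / 2

/-- The jump (outer value minus inner value) of `v` on the face of `K` with outer
normal `s eᵢ`. -/
def faceJump (v : M.Cell → ℝ) (K : M.Cell) (i : Fin d) (s : ℤ) : ℝ :=
  v (M.nbr K i s) - v K

/-- The normal component of the averaged velocity on the face of `K` with outer normal `s eᵢ`. -/
def normalVel (v : M.Cell → Fin d → ℝ) (K : M.Cell) (i : Fin d) (s : ℤ) : ℝ :=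
  M.faceAvg (fun L => v L i) K i s * (s : ℝ)

/-- The upwind flux `r^in [v·n]⁺ + r^out [v·n]⁻`, `[f]^± = (f ± |f|)/2`. -/
def upwind (r : M.Cell → ℝ) (v : M.Cell → Fin d → ℝ) (K : M.Cell) (i : Fin d) (s : ℤ) : ℝ :=
  r K * ((M.normalVel v K i s + |M.normalVel v K i s|) / 2)
    + r (M.nbr K i s) * ((M.normalVel v K i s - |M.normalVel v K i s|) / 2)

/-- The numerical flux `Up[r, v] - κ h^α ⟦r⟧`. -/
def flux (κ α : ℝ) (r : M.Cell → ℝ) (v : M.Cell → Fin d → ℝ) (K : M.Cell) (i : Fin d)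
    (s : ℤ) : ℝ :=
  M.upwind r v K i s - κ * M.h ^ α * M.faceJump r K i s

/-- The sum over the faces `σ` of `K` of `(|σ|/|K|) G_σ`. -/
def faceSum (G : Fin d → ℤ → ℝ) : ℝ :=
  ∑ i, ∑ s ∈ ({1, -1} : Finset ℤ), M.faceArea i / M.cellVol * G i s

end Mesh

/-- The isentropic pressure `p(ϱ) = a ϱ^γ`. -/
def pressure (a γ r : ℝ) : ℝ := a * r ^ γ

/-- The energy `∫ [½ ϱ_h |u_h|² + P(ϱ_h)] dx` of a discrete state, `P(ϱ) = a/(γ-1) ϱ^γ`. -/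
def Mesh.energy {d : ℕ} (M : Mesh d) (a γ : ℝ) (ρ : M.Cell → ℝ) (u : M.Cell → Fin d → ℝ) : ℝ :=
  ∫ x in torus d, ((1 / 2) * M.eval ρ x * (∑ i, M.eval u x i ^ 2)
    + a / (γ - 1) * M.eval ρ x ^ γ)

/-! ### The implicit finite volume scheme -/

/-- `(ρ k, u k)`, `k = 0, …, n`, solve the finite volume scheme with time step `Δt`
for the initial data `ρ₀, u₀`. -/
structure IsNumericalSolution {d : ℕ} (M : Mesh d) (a γ κ α β Δt : ℝ) (n : ℕ)
    (ρ₀ : (Fin d → ℝ) → ℝ) (u₀ : (Fin d → ℝ) → Fin d → ℝ)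
    (ρ : ℕ → M.Cell → ℝ) (u : ℕ → M.Cell → Fin d → ℝ) : Prop where
  init_density : ρ 0 = M.proj ρ₀
  init_velocity : u 0 = M.proj u₀
  density : ∀ k ∈ Finset.Icc 1 n, ∀ K : M.Cell,
    (ρ k K - ρ (k - 1) K) / Δt + M.faceSum (fun i s => M.flux κ α (ρ k) (u k) K i s) = 0
  momentum : ∀ k ∈ Finset.Icc 1 n, ∀ (K : M.Cell) (j : Fin d),
    (ρ k K * u k K j - ρ (k - 1) K * u (k - 1) K j) / Δt
      + M.faceSum (fun i s =>
          M.flux κ α (fun L => ρ k L * u k L j) (u k) K i s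
          + M.faceAvg (fun L => pressure a γ (ρ k L)) K i s * (if i = j then (s : ℝ) else 0)
          - M.h ^ β * M.faceJump (fun L => u k L j) K i s) = 0

/-- The extension in time: the value `v 0` for `t < Δt` and `v k` for
`t ∈ [k Δt, (k+1) Δt)`. -/
def inTime {V : Type*} (Δt : ℝ) (v : ℕ → V) (t : ℝ) : V := v ⌊t / Δt⌋₊

/-! ### Test functions -/

/-- The space-time domain `[0,∞) × ℝᵈ` on which test functions live. -/
def slab (d : ℕ) : Set (ℝ × (Fin d → ℝ)) := Ici 0 ×ˢ univ

/-- `φ ∈ C³_c([0,T) × 𝕋ᵈ; F)`, extended by zero to times beyond `T`. -/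
structure IsTestFunction {d : ℕ} {F : Type*} [NormedAddCommGroup F] [NormedSpace ℝ F]
    (T : ℝ) (φ : ℝ × (Fin d → ℝ) → F) : Prop where
  contDiffOn : ContDiffOn ℝ 3 φ (slab d)
  periodic : ∀ t, 0 ≤ t → TorusPeriodic (fun x => φ (t, x))
  support : ∃ T' < T, ∀ t, 0 ≤ t → T' ≤ t → ∀ x, φ (t, x) = 0

/-- The `C³` norm: the supremum over `[0,∞) × ℝᵈ` of the derivatives of order `0, …, 3`
(a finite supremum for every test function). -/
def c3Norm {d : ℕ} {F : Type*} [NormedAddCommGroup F] [NormedSpace ℝ F]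
    (φ : ℝ × (Fin d → ℝ) → F) : ℝ :=
  sSup {r | ∃ j : ℕ, j ≤ 3 ∧ ∃ z ∈ slab d, r = ‖iteratedFDerivWithin ℝ j φ (slab d) z‖}

/-- The time derivative `∂ₜ φ (t,x)`, used for `t > 0`. -/
def dt {d : ℕ} {F : Type*} [NormedAddCommGroup F] [NormedSpace ℝ F]
    (φ : ℝ × (Fin d → ℝ) → F) (t : ℝ) (x : Fin d → ℝ) : F :=
  fderiv ℝ φ (t, x) (1, 0)

/-- The space derivative `∂ᵢ φ (t,x)`, used for `t > 0`. -/
def dx {d : ℕ} {F : Type*} [NormedAddCommGroup F] [NormedSpace ℝ F]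
    (i : Fin d) (φ : ℝ × (Fin d → ℝ) → F) (t : ℝ) (x : Fin d → ℝ) : F :=
  fderiv ℝ φ (t, x) (0, Pi.single i 1)

/-! ### The terms of the consistency formulation -/

/-- `∫₀ᵀ ∫ [ϱ_h ∂ₜφ + ϱ_h u_h · ∇ₓφ] dx dt`. -/
def densityForm {d : ℕ} (M : Mesh d) (T Δt : ℝ)
    (ρ : ℕ → M.Cell → ℝ) (u : ℕ → M.Cell → Fin d → ℝ) (φ : ℝ × (Fin d → ℝ) → ℝ) : ℝ :=
  ∫ t in (0 : ℝ)..T, ∫ x in torus d,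
    (M.eval (inTime Δt ρ t) x * dt φ t x
      + ∑ i, M.eval (inTime Δt ρ t) x * M.eval (inTime Δt u t) x i * dx i φ t x)

/-- `∫₀ᵀ ∫ [ϱ_h u_h · ∂ₜφ + ϱ_h u_h ⊗ u_h : ∇ₓφ + p(ϱ_h) divₓ φ] dx dt`. -/
def momentumForm {d : ℕ} (M : Mesh d) (a γ T Δt : ℝ)
    (ρ : ℕ → M.Cell → ℝ) (u : ℕ → M.Cell → Fin d → ℝ) (φ : ℝ × (Fin d → ℝ) → Fin d → ℝ) : ℝ :=
  ∫ t in (0 : ℝ)..T, ∫ x in torus d,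
    ((∑ i, M.eval (inTime Δt ρ t) x * M.eval (inTime Δt u t) x i * dt φ t x i)
      + (∑ i, ∑ j, M.eval (inTime Δt ρ t) x * M.eval (inTime Δt u t) x i
          * M.eval (inTime Δt u t) x j * dx j φ t x i)
      + pressure a γ (M.eval (inTime Δt ρ t) x) * ∑ i, dx i φ t x i)

/-- The numerical diffusion
`d(h,φ) = -h^β ∫₀ᵀ ∑_σ ∫_σ ⟦u_h⟧ · ⟦Π_𝒯 φ⟧ dS dt`; every face is listed exactly once, as the face
with outer normal `eᵢ` of exactly one element. -/
def diffusionTerm {d : ℕ} (M : Mesh d) (β T Δt : ℝ)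
    (u : ℕ → M.Cell → Fin d → ℝ) (φ : ℝ × (Fin d → ℝ) → Fin d → ℝ) : ℝ :=
  -M.h ^ β * ∫ t in (0 : ℝ)..T, ∑ K : M.Cell, ∑ i, M.faceArea i *
    ∑ j, M.faceJump (fun L => inTime Δt u t L j) K i 1
      * M.faceJump (fun L => M.proj (fun x => φ (t, x)) L j) K i 1

end EulerFV

end

/-!
Consistency of the scheme with the compressible Euler equations.

The scheme is tested with the averages of a test function `φ` over the space-time elements
`[k Δt, (k+1) Δt] × K`, and every flux term is summed by parts until no difference acts on the
transported quantity any more (`Mesh.MomentBounds.consistency`). This concerns also the upwind part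
`|ū·n| ⟦r⟧` and the diffusion `κ h^α ⟦r⟧`: what remains at an element is the value of `r = ϱ` or
`r = ϱ uⱼ` there, multiplied by a discrete derivative of `φ` and a jump of the velocity on an
adjacent face, or by a second difference of `φ`. The jumps of the density never have to be
estimated, and the only delicate term is `∫∫ ϱ |g| |⟦u⟧|` with `g = 1` or `g = uⱼ`. Averaging `φ` in
time makes the viscous term agree exactly with the numerical diffusion `d(h, φ)`, except on the
first time slab, where the extension in time carries the initial data and the scheme does not hold;
there the integrability of `u₀` gives an error of order `h^(β+1)`.

The discrete energy inequality (`Mesh.energy_step`, preceded by the nonnegativity of the density,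
`Mesh.density_step_nonneg`) provides the bounds: `∫ (ϱ + ϱ|u|² + p(ϱ))` is bounded at each time, and
the dissipation bounds `κ h^α ∑ ∫_σ ϱ ⟦u⟧²` and `h^β ∑ ∫_σ ⟦u⟧²`. The first of these and Young's
inequality make the delicate term `O(h^((1-α)/2))`; the second one makes the numerical diffusion
`O(h^((β+1)/2))`. All other errors are `O(h)` or smaller, so `δ = min ((1-α)/2) (β+1)` is admissible.

The link between the integrals and the discrete sums is that the half-open box spanned by the grid
and the cube `[-1,1]ᵈ` are both fundamental domains of the lattice `2ℤᵈ` of periods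
(`isAddFundamentalDomain_box`, `Mesh.integral_torus`), and that the `C³` norm of a test function is a
finite supremum (`IsTestFunction.bddAbove`), so that it bounds its Taylor remainders.
-/

/-! ### Discrete calculus on the mesh -/

namespace EulerFV

namespace Mesh

variable {d : ℕ} (M : Mesh d)

theorem edge_pos (i : Fin d) : 0 < M.edge i :=
  div_pos two_pos (Nat.cast_pos.2 (M.N i).pos)

theorem edge_le_two (i : Fin d) : M.edge i ≤ 2 :=
  div_le_self zero_le_two (Nat.one_le_cast.2 (M.N i).pos)

theorem natCast_mul_edge (i : Fin d) : (M.N i : ℝ) * M.edge i = 2 := by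
  have : (M.N i : ℝ) ≠ 0 := Nat.cast_ne_zero.2 (M.N i).ne_zero
  unfold edge; field_simp

theorem cellVol_pos : 0 < M.cellVol := Finset.prod_pos fun i _ => M.edge_pos i

theorem faceArea_pos (i : Fin d) : 0 < M.faceArea i := Finset.prod_pos fun j _ => M.edge_pos j

theorem faceArea_mul_edge (i : Fin d) : M.faceArea i * M.edge i = M.cellVol :=
  Finset.prod_erase_mul _ _ (Finset.mem_univ i)

theorem nbr_one_neg (K : M.Cell) (i : Fin d) : M.nbr (M.nbr K i 1) i (-1) = K := by
  simp [nbr, add_assoc, ← Pi.single_add]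

theorem nbr_neg_one (K : M.Cell) (i : Fin d) : M.nbr (M.nbr K i (-1)) i 1 = K := by
  simp [nbr, add_assoc, ← Pi.single_add]

theorem sum_nbr (g : M.Cell → ℝ) (i : Fin d) (s : ℤ) : ∑ K, g (M.nbr K i s) = ∑ K, g K :=
  Equiv.sum_comp (Equiv.addRight (Pi.single i (s : ZMod (M.N i)) : M.Cell)) g

theorem faceSum_eq (G : Fin d → ℤ → ℝ) :
    M.cellVol * M.faceSum G = ∑ i, M.faceArea i * (G i 1 + G i (-1)) := by
  have hV := M.cellVol_pos.ne'
  rw [faceSum, Finset.mul_sum]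
  refine Finset.sum_congr rfl fun i _ => ?_
  rw [Finset.sum_pair (by decide)]
  field_simp

/-- Summation by parts for a conservative numerical flux `G`: the flux out of `K` through a face is
the flux into the neighbour. -/
theorem sum_mul_faceSum (g : M.Cell → ℝ) (G : M.Cell → Fin d → ℤ → ℝ)
    (hG : ∀ K i, G K i (-1) = -G (M.nbr K i (-1)) i 1) :
    ∑ K, M.cellVol * (g K * M.faceSum (G K))
      = -∑ K, ∑ i, M.faceArea i * (G K i 1 * (g (M.nbr K i 1) - g K)) := by
  have h1 : ∀ K, M.cellVol * (g K * M.faceSum (G K))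
      = ∑ i, M.faceArea i * (g K * G K i 1 - g K * G (M.nbr K i (-1)) i 1) := fun K => by
    rw [mul_left_comm, faceSum_eq, Finset.mul_sum]
    exact Finset.sum_congr rfl fun i _ => by rw [hG]; ring
  simp_rw [h1]
  rw [Finset.sum_comm, Finset.sum_comm (s := Finset.univ (α := M.Cell)), ← Finset.sum_neg_distrib]
  refine Finset.sum_congr rfl fun i _ => ?_
  rw [← Finset.mul_sum, ← Finset.mul_sum, Finset.sum_sub_distrib,
    ← M.sum_nbr (fun K => g K * G (M.nbr K i (-1)) i 1) i 1]
  simp_rw [nbr_one_neg]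
  rw [← Finset.sum_sub_distrib, ← mul_neg, ← Finset.sum_neg_distrib]
  congr 1
  exact Finset.sum_congr rfl fun K _ => by ring

/-- The average of the `i`-th velocity component on the face between `K` and its neighbour in the
direction `eᵢ`. -/
noncomputable def faceVel (v : M.Cell → Fin d → ℝ) (K : M.Cell) (i : Fin d) : ℝ :=
  (v K i + v (M.nbr K i 1) i) / 2

theorem flux_neg_one (κ α : ℝ) (r : M.Cell → ℝ) (v : M.Cell → Fin d → ℝ) (K : M.Cell)
    (i : Fin d) : M.flux κ α r v K i (-1) = -M.flux κ α r v (M.nbr K i (-1)) i 1 := by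
  simp only [flux, upwind, normalVel, faceAvg, faceJump, nbr_neg_one, Int.cast_neg, Int.cast_one,
    mul_neg, mul_one, abs_neg]
  rw [add_comm (v (M.nbr K i (-1)) i)]
  ring

theorem flux_one (κ α : ℝ) (r : M.Cell → ℝ) (v : M.Cell → Fin d → ℝ) (K : M.Cell) (i : Fin d) :
    M.flux κ α r v K i 1
      = r K * ((M.faceVel v K i + |M.faceVel v K i|) / 2 + κ * M.h ^ α)
        + r (M.nbr K i 1) * ((M.faceVel v K i - |M.faceVel v K i|) / 2 - κ * M.h ^ α) := by
  simp only [flux, upwind, normalVel, faceAvg, faceJump, faceVel, Int.cast_one, mul_one]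
  ring

theorem faceAvg_neg_one (p : M.Cell → ℝ) (K : M.Cell) (i : Fin d) :
    M.faceAvg p K i (-1) = M.faceAvg p (M.nbr K i (-1)) i 1 := by
  simp only [faceAvg, nbr_neg_one, add_comm]

theorem faceJump_neg_one (m : M.Cell → ℝ) (K : M.Cell) (i : Fin d) :
    M.faceJump m K i (-1) = -M.faceJump m (M.nbr K i (-1)) i 1 := by
  simp only [faceJump, nbr_neg_one, neg_sub]

/-- The fluxes of the momentum equation are conservative; `p` is the pressure, `m` the transported
velocity component. With `p = m = 0` this is the flux of the continuity equation. -/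
theorem fullFlux_neg_one (κ α b : ℝ) (r p m : M.Cell → ℝ) (v : M.Cell → Fin d → ℝ) (j : Fin d)
    (K : M.Cell) (i : Fin d) :
    M.flux κ α r v K i (-1) + M.faceAvg p K i (-1) * (if i = j then ((-1 : ℤ) : ℝ) else 0)
        - b * M.faceJump m K i (-1)
      = -(M.flux κ α r v (M.nbr K i (-1)) i 1
          + M.faceAvg p (M.nbr K i (-1)) i 1 * (if i = j then ((1 : ℤ) : ℝ) else 0)
          - b * M.faceJump m (M.nbr K i (-1)) i 1) := by
  rw [flux_neg_one, faceAvg_neg_one, faceJump_neg_one]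
  split_ifs <;> push_cast <;> ring

end Mesh

/-! ### Nonnegativity of the density and the energy inequality -/

namespace Mesh

variable {d : ℕ} (M : Mesh d)

/-- The upwind scheme with diffusion preserves nonnegativity. The set of elements with negative
density cannot lose mass through its boundary, so its mass is at least the previous one, which is
nonnegative; hence the set is empty. -/
theorem density_step_nonneg {κ α Δt : ℝ} (hκ : 0 < κ) (hΔt : 0 < Δt)
    {ρ ρ' : M.Cell → ℝ} {v : M.Cell → Fin d → ℝ}
    (h : ∀ K, (ρ K - ρ' K) / Δt + M.faceSum (fun i s => M.flux κ α ρ v K i s) = 0)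
    (hρ' : ∀ K, 0 ≤ ρ' K) (K : M.Cell) : 0 ≤ ρ K := by
  classical
  by_contra hK
  have hκh : 0 < κ * M.h ^ α := mul_pos hκ (Real.rpow_pos_of_pos M.h_pos _)
  -- the equations are tested with the indicator function of the negative elements
  let g : M.Cell → ℝ := fun L => if ρ L < 0 then 1 else 0
  have hsum := M.sum_mul_faceSum g (fun L i s => M.flux κ α ρ v L i s) (M.flux_neg_one κ α ρ v)
  have hflux : 0 ≤ ∑ L, ∑ i, M.faceArea i *
      (M.flux κ α ρ v L i 1 * (g (M.nbr L i 1) - g L)) := by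
    refine Finset.sum_nonneg fun L _ => Finset.sum_nonneg fun i _ =>
      mul_nonneg (M.faceArea_pos i).le ?_
    rw [flux_one]
    set w := M.faceVel v L i
    have ha : 0 ≤ (w + |w|) / 2 + κ * M.h ^ α := by linarith [neg_abs_le w]
    have hb : (w - |w|) / 2 - κ * M.h ^ α ≤ 0 := by linarith [le_abs_self w]
    simp only [g]
    split_ifs with h1 h2 h2
    · simp
    · nlinarith [mul_nonneg (not_lt.1 h2) ha, mul_nonneg_of_nonpos_of_nonpos h1.le hb]
    · nlinarith [mul_nonpos_of_nonneg_of_nonpos (not_lt.1 h1) hb,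
        mul_nonpos_of_nonpos_of_nonneg h2.le ha]
    · simp
  have hneg : ∑ L, M.cellVol * (g L * ((ρ L - ρ' L) / Δt)) < 0 := by
    refine Finset.sum_neg' (fun L _ => ?_) ⟨K, Finset.mem_univ K, ?_⟩
    · refine mul_nonpos_of_nonneg_of_nonpos M.cellVol_pos.le ?_
      simp only [g]
      split_ifs with h1
      · rw [one_mul]; exact div_nonpos_of_nonpos_of_nonneg (by linarith [hρ' L]) hΔt.le
      · simp
    · refine mul_neg_of_pos_of_neg M.cellVol_pos ?_
      simp only [g, if_pos (not_le.1 hK), one_mul]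
      exact div_neg_of_neg_of_pos (by linarith [hρ' K, not_le.1 hK]) hΔt
  have : ∑ L, M.cellVol * (g L * ((ρ L - ρ' L) / Δt))
      + ∑ L, M.cellVol * (g L * M.faceSum (fun i s => M.flux κ α ρ v L i s)) = 0 := by
    rw [← Finset.sum_add_distrib]
    refine Finset.sum_eq_zero fun L _ => ?_
    rw [← mul_add, ← mul_add, h L]; ring
  linarith

end Mesh

/-- The tangent line inequality of the convex function `r ↦ r ^ γ`. -/
theorem rpow_tangent_le {γ x y : ℝ} (hγ : 1 < γ) (hx : 0 ≤ x) (hy : 0 ≤ y) :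
    γ * x ^ (γ - 1) * (y - x) ≤ y ^ γ - x ^ γ := by
  rcases hx.eq_or_lt with rfl | hx
  · simp [Real.zero_rpow (by linarith : γ - 1 ≠ 0), Real.zero_rpow (by linarith : γ ≠ 0),
      Real.rpow_nonneg hy]
  have hb := one_add_mul_self_le_rpow_one_add (s := y / x - 1) (p := γ)
    (by linarith [div_nonneg hy hx.le]) hγ.le
  rw [add_sub_cancel, Real.div_rpow hy hx.le, le_div_iff₀ (Real.rpow_pos_of_pos hx _)] at hb
  have h1 : x ^ γ = x ^ (γ - 1) * x := by
    rw [← Real.rpow_add_one hx.ne', sub_add_cancel]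
  have h2 : (1 + γ * (y / x - 1)) * x ^ γ = x ^ γ + γ * x ^ (γ - 1) * (y - x) := by
    rw [h1]; field_simp
  linarith

/-- The energy of the discrete state on one element, per unit volume. -/
noncomputable def energyDensity {d : ℕ} (a γ r : ℝ) (v : Fin d → ℝ) : ℝ :=
  1 / 2 * r * (∑ j, v j ^ 2) + a / (γ - 1) * r ^ γ

/-- Upwinding is compatible with the pressure potential `P`: the discrete transport of `P'`
is dominated by the pressure work on each face. -/
theorem upwind_potential_le {γ x y w c : ℝ} (hγ : 1 < γ) (hx : 0 ≤ x) (hy : 0 ≤ y) (hc : 0 ≤ c) :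
    (x * ((w + |w|) / 2 + c) + y * ((w - |w|) / 2 - c))
        * (γ * y ^ (γ - 1) - γ * x ^ (γ - 1))
      ≤ w * ((γ - 1) * (y ^ γ - x ^ γ)) := by
  have hpow : ∀ z : ℝ, 0 ≤ z → z ^ γ = z ^ (γ - 1) * z := fun z hz => by
    rcases hz.eq_or_lt with rfl | hz
    · simp [Real.zero_rpow (by linarith : γ ≠ 0)]
    · rw [← Real.rpow_add_one hz.ne', sub_add_cancel]
  have t1 := rpow_tangent_le hγ hx hy
  have t2 := rpow_tangent_le hγ hy hx
  rw [hpow x hx, hpow y hy] at t1 t2 ⊢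
  set X := x ^ (γ - 1)
  set Y := y ^ (γ - 1)
  have t3 : 0 ≤ c * ((y - x) * (γ * Y - γ * X)) := mul_nonneg hc (by linarith)
  rcases le_total 0 w with hw | hw
  · rw [abs_of_nonneg hw]
    nlinarith [mul_le_mul_of_nonneg_left t2 hw]
  · rw [abs_of_nonpos hw]
    nlinarith [mul_le_mul_of_nonpos_left t1 hw]

end EulerFV

namespace EulerFV

/-- The discrete momentum transport releases kinetic energy: `(x, U)` and `(y, W)` are density and
velocity on the two sides of a face, `w` is the normal velocity and `c` the diffusion. -/
theorem kinetic_flux_le {x y U W w c : ℝ} (hx : 0 ≤ x) (hy : 0 ≤ y) :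
    c / 2 * (x + y) * (W - U) ^ 2
      ≤ -((x * U * ((w + |w|) / 2 + c) + y * W * ((w - |w|) / 2 - c)) * (W - U))
        + (x * ((w + |w|) / 2 + c) + y * ((w - |w|) / 2 - c)) * (1 / 2 * (W ^ 2 - U ^ 2)) := by
  have h1 : 0 ≤ x * (w + |w|) * (W - U) ^ 2 :=
    mul_nonneg (mul_nonneg hx (by linarith [neg_abs_le w])) (sq_nonneg _)
  have h2 : 0 ≤ y * (|w| - w) * (W - U) ^ 2 :=
    mul_nonneg (mul_nonneg hy (by linarith [le_abs_self w])) (sq_nonneg _)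
  nlinarith

/-- Convexity of the energy in time. The multipliers are the velocity `v` for the momentum and
`P'(x) - |v|²/2` for the density. -/
theorem energyDensity_sub_le {d : ℕ} {a γ x y : ℝ} (v w : Fin d → ℝ) (ha : 0 < a) (hγ : 1 < γ)
    (hx : 0 ≤ x) (hy : 0 ≤ y) :
    energyDensity a γ x v - energyDensity a γ y w
      ≤ ∑ j, v j * (x * v j - y * w j)
        + (a / (γ - 1) * (γ * x ^ (γ - 1)) - 1 / 2 * ∑ j, v j ^ 2) * (x - y) := by
  have t := mul_le_mul_of_nonneg_left (rpow_tangent_le hγ hx hy)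
    (div_pos ha (sub_pos.2 hγ)).le
  have hk : 1 / 2 * x * (∑ j, v j ^ 2) - 1 / 2 * y * (∑ j, w j ^ 2)
      ≤ ∑ j, v j * (x * v j - y * w j) - 1 / 2 * (∑ j, v j ^ 2) * (x - y) := by
    simp only [Finset.mul_sum, Finset.sum_mul, ← Finset.sum_sub_distrib]
    refine Finset.sum_le_sum fun j _ => ?_
    nlinarith [mul_nonneg hy (sq_nonneg (v j - w j))]
  unfold energyDensity
  nlinarith

namespace Mesh

variable {d : ℕ} (M : Mesh d)

/-- The numerical dissipation of one time step, per unit time: the part of it controlling the jumps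
of the velocity. -/
noncomputable def dissipation (κ α β : ℝ) (ρ : M.Cell → ℝ) (u : M.Cell → Fin d → ℝ) : ℝ :=
  ∑ K, ∑ i, M.faceArea i *
    ((κ * M.h ^ α / 2 * (ρ K + ρ (M.nbr K i 1)) + M.h ^ β)
      * ∑ j, (u (M.nbr K i 1) j - u K j) ^ 2)

/-- The energy inequality for one time step of the scheme. -/
theorem energy_step {a γ κ α β Δt : ℝ} (ha : 0 < a) (hγ : 1 < γ) (hκ : 0 < κ) (hΔt : 0 < Δt)
    {ρ ρ' : M.Cell → ℝ} {u u' : M.Cell → Fin d → ℝ}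
    (hρ : ∀ K, 0 ≤ ρ K) (hρ' : ∀ K, 0 ≤ ρ' K)
    (hd : ∀ K, (ρ K - ρ' K) / Δt + M.faceSum (fun i s => M.flux κ α ρ u K i s) = 0)
    (hm : ∀ (K : M.Cell) (j : Fin d), (ρ K * u K j - ρ' K * u' K j) / Δt
      + M.faceSum (fun i s => M.flux κ α (fun L => ρ L * u L j) u K i s
          + M.faceAvg (fun L => pressure a γ (ρ L)) K i s * (if i = j then (s : ℝ) else 0)
          - M.h ^ β * M.faceJump (fun L => u L j) K i s) = 0) :
    ∑ K, M.cellVol * energyDensity a γ (ρ K) (u K) + Δt * M.dissipation κ α β ρ u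
      ≤ ∑ K, M.cellVol * energyDensity a γ (ρ' K) (u' K) := by
  set c := κ * M.h ^ α with hc
  have hc0 : 0 < c := mul_pos hκ (Real.rpow_pos_of_pos M.h_pos _)
  set P : ℝ → ℝ := fun r => a / (γ - 1) * (γ * r ^ (γ - 1)) with hP
  set q : M.Cell → ℝ := fun K => P (ρ K) - 1 / 2 * ∑ j, u K j ^ 2 with hq
  set f : M.Cell → Fin d → ℤ → ℝ := fun K i s => M.flux κ α ρ u K i s with hf
  set F : Fin d → M.Cell → Fin d → ℤ → ℝ := fun j K i s =>
    M.flux κ α (fun L => ρ L * u L j) u K i s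
          + M.faceAvg (fun L => pressure a γ (ρ L)) K i s * (if i = j then (s : ℝ) else 0)
          - M.h ^ β * M.faceJump (fun L => u L j) K i s with hF
  have sumf := M.sum_mul_faceSum q f (M.flux_neg_one κ α ρ u)
  have sumF : ∀ j, _ := fun j => M.sum_mul_faceSum (fun K => u K j) (F j)
    (M.fullFlux_neg_one κ α (M.h ^ β) _ _ _ u j)
  -- the equations, tested with the multipliers
  have key : ∑ K, M.cellVol * (∑ j, u K j * ((ρ K * u K j - ρ' K * u' K j))
        + q K * (ρ K - ρ' K))
      = Δt * (∑ K, ∑ i, M.faceArea i * (∑ j, F j K i 1 * (u (M.nbr K i 1) j - u K j)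
        + f K i 1 * (q (M.nbr K i 1) - q K))) := by
    have e1 : ∀ K, M.cellVol * (∑ j, u K j * ((ρ K * u K j - ρ' K * u' K j))
        + q K * (ρ K - ρ' K))
        = -Δt * (∑ j, M.cellVol * (u K j * M.faceSum (F j K))
          + M.cellVol * (q K * M.faceSum (f K))) := fun K => by
      have m : ∀ j, ρ K * u K j - ρ' K * u' K j = -Δt * M.faceSum (F j K) := fun j => by
        have := hm K j
        field_simp at this ⊢
        linarith
      have m' : ρ K - ρ' K = -Δt * M.faceSum (f K) := by
        have := hd K
        field_simp at this ⊢
        linarith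
      rw [m', mul_add, Finset.mul_sum, mul_add, Finset.mul_sum]
      congr 1
      · exact Finset.sum_congr rfl fun j _ => by rw [m]; ring
      · ring
    simp_rw [e1]
    rw [← Finset.mul_sum, Finset.sum_add_distrib, Finset.sum_comm, sumf]
    simp_rw [sumF]
    rw [Finset.sum_neg_distrib, ← neg_add, neg_mul_neg]
    congr 1
    rw [Finset.sum_comm, ← Finset.sum_add_distrib]
    refine Finset.sum_congr rfl fun K _ => ?_
    rw [Finset.sum_comm, ← Finset.sum_add_distrib]
    refine Finset.sum_congr rfl fun i _ => ?_
    rw [mul_add, Finset.mul_sum]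
  have face : ∀ K i, ∑ j, F j K i 1 * (u (M.nbr K i 1) j - u K j)
        + f K i 1 * (q (M.nbr K i 1) - q K)
      ≤ -((c / 2 * (ρ K + ρ (M.nbr K i 1)) + M.h ^ β)
          * ∑ j, (u (M.nbr K i 1) j - u K j) ^ 2)
        + (pressure a γ (ρ (M.nbr K i 1)) * u (M.nbr K i 1) i - pressure a γ (ρ K) * u K i) := by
    intro K i
    set L := M.nbr K i 1
    have hpot := mul_le_mul_of_nonneg_left
      (upwind_potential_le (w := M.faceVel u K i) hγ (hρ K) (hρ L) hc0.le)
      (div_pos ha (sub_pos.2 hγ)).le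
    have hpot' : f K i 1 * (P (ρ L) - P (ρ K))
        ≤ M.faceVel u K i * (pressure a γ (ρ L) - pressure a γ (ρ K)) := by
      have hg : γ - 1 ≠ 0 := (sub_pos.2 hγ).ne'
      have r1 : a / (γ - 1) * (M.faceVel u K i * ((γ - 1) * (ρ L ^ γ - ρ K ^ γ)))
          = M.faceVel u K i * (pressure a γ (ρ L) - pressure a γ (ρ K)) := by
        unfold pressure; field_simp
      rw [r1] at hpot
      refine le_trans (le_of_eq ?_) hpot
      simp only [hf, flux_one, hP]; ring
    have hkin : ∑ j, (F j K i 1 * (u L j - u K j)) + f K i 1 * (-(1 / 2) * ∑ j, u L j ^ 2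
          - -(1 / 2) * ∑ j, u K j ^ 2)
        ≤ -((c / 2 * (ρ K + ρ L) + M.h ^ β) * ∑ j, (u L j - u K j) ^ 2)
          + (pressure a γ (ρ K) + pressure a γ (ρ L)) / 2 * (u L i - u K i) := by
      have r1 : (pressure a γ (ρ K) + pressure a γ (ρ L)) / 2 * (u L i - u K i)
          = ∑ j, if i = j then
            (pressure a γ (ρ K) + pressure a γ (ρ L)) / 2 * (u L j - u K j) else 0 := by
        simp
      rw [r1, Finset.mul_sum, Finset.mul_sum, Finset.mul_sum, ← Finset.sum_sub_distrib,
        Finset.mul_sum, ← Finset.sum_add_distrib, ← Finset.sum_neg_distrib,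
        ← Finset.sum_add_distrib]
      refine Finset.sum_le_sum fun j _ => ?_
      have hk := kinetic_flux_le (U := u K j) (W := u L j) (w := M.faceVel u K i) (c := c)
        (hρ K) (hρ L)
      simp only [hF, hf, flux_one, faceAvg, faceJump]
      split_ifs <;> push_cast <;> linarith
    have : f K i 1 * (q L - q K) = f K i 1 * (P (ρ L) - P (ρ K))
        + f K i 1 * (-(1 / 2) * ∑ j, u L j ^ 2 - -(1 / 2) * ∑ j, u K j ^ 2) := by
      simp only [hq]; ring
    rw [this]
    have : M.faceVel u K i = (u K i + u L i) / 2 := rfl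
    rw [this] at hpot'
    linarith
  have hsum : ∑ K, ∑ i, M.faceArea i * (∑ j, F j K i 1 * (u (M.nbr K i 1) j - u K j)
        + f K i 1 * (q (M.nbr K i 1) - q K)) ≤ -M.dissipation κ α β ρ u := by
    have z : ∑ K, ∑ i, M.faceArea i * (pressure a γ (ρ (M.nbr K i 1)) * u (M.nbr K i 1) i
        - pressure a γ (ρ K) * u K i) = 0 := by
      rw [Finset.sum_comm]
      refine Finset.sum_eq_zero fun i _ => ?_
      rw [← Finset.mul_sum, Finset.sum_sub_distrib,
        M.sum_nbr (fun K => pressure a γ (ρ K) * u K i), sub_self, mul_zero]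
    rw [← add_zero (-M.dissipation κ α β ρ u), ← z, dissipation, ← Finset.sum_neg_distrib,
      ← Finset.sum_add_distrib]
    refine Finset.sum_le_sum fun K _ => ?_
    rw [← Finset.sum_neg_distrib, ← Finset.sum_add_distrib]
    refine Finset.sum_le_sum fun i _ => ?_
    rw [← mul_neg, ← mul_add]
    exact mul_le_mul_of_nonneg_left (face K i) (M.faceArea_pos i).le
  have htime : ∑ K, M.cellVol * energyDensity a γ (ρ K) (u K)
        - ∑ K, M.cellVol * energyDensity a γ (ρ' K) (u' K)
      ≤ ∑ K, M.cellVol * (∑ j, u K j * ((ρ K * u K j - ρ' K * u' K j)) + q K * (ρ K - ρ' K)) := by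
    rw [← Finset.sum_sub_distrib]
    refine Finset.sum_le_sum fun K _ => ?_
    rw [← mul_sub]
    exact mul_le_mul_of_nonneg_left
      (energyDensity_sub_le _ _ ha hγ (hρ K) (hρ' K)) M.cellVol_pos.le
  have := mul_le_mul_of_nonneg_left hsum hΔt.le
  linarith

end Mesh

end EulerFV

/-! ### Consistency of the fluxes -/

namespace EulerFV

/-- Consistency of the upwind flux after summation by parts: what remains at an element with
velocity `U` and neighbours with velocities `Up`, `Um`. Here `x`, `y` are the two one-sided
difference quotients of the test function and `I` its derivative; the error is first order in `η`
up to the jumps of the velocity. -/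
theorem upwind_consistency {U Up Um c x y I B η : ℝ} (hc : 0 ≤ c) (hη : 0 ≤ η)
    (hη2 : η ≤ 2) (hx : |x| ≤ B) (hxy : |x - y| ≤ 2 * B * η)
    (hI : |(x + y) / 2 - I| ≤ B * η) :
    |(((U + Up) / 2 + |(U + Up) / 2|) / 2 + c) * x + (((Um + U) / 2 - |(Um + U) / 2|) / 2 - c) * y
        - U * I| ≤ 3 * B * (η * |U| + |Up - U| + |U - Um| + c * η) := by
  have hB : 0 ≤ B := (abs_nonneg _).trans hx
  set w := (U + Up) / 2 with hw
  set w' := (Um + U) / 2 with hw'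
  have hww : |(|w| - |w'|)| ≤ (|Up - U| + |U - Um|) / 2 := by
    refine (abs_abs_sub_abs_le_abs_sub _ _).trans ?_
    have : w - w' = ((Up - U) + (U - Um)) / 2 := by rw [hw, hw']; ring
    rw [this, abs_div, abs_two]
    gcongr
    exact abs_add_le _ _
  have hw'U : |w'| ≤ |U| + |U - Um| / 2 := by
    have : w' = U + -((U - Um) / 2) := by rw [hw']; ring
    rw [this]
    refine (abs_add_le _ _).trans ?_
    rw [abs_neg, abs_div, abs_two]
  have hy : |y| ≤ B + 2 * B * η := by
    have := abs_sub_abs_le_abs_sub y x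
    rw [abs_sub_comm] at this
    linarith
  have key : ((w + |w|) / 2 + c) * x + ((w' - |w'|) / 2 - c) * y - U * I
      = U * ((x + y) / 2 - I) + (1 / 4 * (Up - U) * x - 1 / 4 * (U - Um) * x)
        + 1 / 4 * (U - Um) * (x - y)
        + (1 / 2 * (|w| - |w'|) * x + 1 / 2 * |w'| * (x - y)) + c * (x - y) := by
    rw [hw, hw']; ring
  rw [key]
  have b1 : |U * ((x + y) / 2 - I)| ≤ |U| * (B * η) := by
    rw [abs_mul]; gcongr
  have b2 : |1 / 4 * (Up - U) * x| ≤ 1 / 4 * |Up - U| * B := by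
    rw [abs_mul, abs_mul, abs_of_pos (by norm_num : (0 : ℝ) < 1 / 4)]; gcongr
  have b3 : |1 / 4 * (U - Um) * x| ≤ 1 / 4 * |U - Um| * B := by
    rw [abs_mul, abs_mul, abs_of_pos (by norm_num : (0 : ℝ) < 1 / 4)]; gcongr
  have b4 : |1 / 4 * (U - Um) * (x - y)| ≤ 1 / 4 * |U - Um| * (2 * B * η) := by
    rw [abs_mul, abs_mul, abs_of_pos (by norm_num : (0 : ℝ) < 1 / 4)]; gcongr
  have b5 : |1 / 2 * (|w| - |w'|) * x| ≤ 1 / 2 * ((|Up - U| + |U - Um|) / 2) * B := by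
    rw [abs_mul, abs_mul, abs_of_pos (by norm_num : (0 : ℝ) < 1 / 2)]; gcongr
  have b6 : |1 / 2 * |w'| * (x - y)| ≤ 1 / 2 * (|U| + |U - Um| / 2) * (2 * B * η) := by
    rw [abs_mul, abs_mul, abs_abs, abs_of_pos (by norm_num : (0 : ℝ) < 1 / 2)]; gcongr
  have b7 : |c * (x - y)| ≤ c * (2 * B * η) := by
    rw [abs_mul, abs_of_nonneg hc]; gcongr
  have h8 : B * |U - Um| * η ≤ B * |U - Um| * 2 := by gcongr
  have h9 : 0 ≤ B * |Up - U| := by positivity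
  have h10 : 0 ≤ B * |U - Um| := by positivity
  have h11 : 0 ≤ B * (η * |U|) := by positivity
  have h12 : 0 ≤ B * (c * η) := by positivity
  calc _ ≤ |U * ((x + y) / 2 - I)| + (|1 / 4 * (Up - U) * x| + |1 / 4 * (U - Um) * x|)
        + |1 / 4 * (U - Um) * (x - y)|
        + (|1 / 2 * (|w| - |w'|) * x| + |1 / 2 * |w'| * (x - y)|) + |c * (x - y)| := by
        refine (abs_add_le _ _).trans (add_le_add ?_ le_rfl)
        refine (abs_add_le _ _).trans (add_le_add ?_ (abs_add_le _ _))
        refine (abs_add_le _ _).trans (add_le_add ?_ le_rfl)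
        exact (abs_add_le _ _).trans (add_le_add le_rfl (abs_sub _ _))
    _ ≤ _ := by linarith

namespace Mesh

variable {d : ℕ} (M : Mesh d)

/-- Estimates on the moments of a test function over the space-time elements
`[k Δt, (k+1) Δt] × K`: `A` are the integrals of the function, `B` those of its initial value, `It`
and `Ix` those of its time and space derivatives; `N` is a norm of the function. -/
structure MomentBounds (Δt N : ℝ) (n : ℕ) (A : ℕ → M.Cell → ℝ) (B : M.Cell → ℝ)
    (It : ℕ → M.Cell → ℝ) (Ix : ℕ → Fin d → M.Cell → ℝ) : Prop where
  initial : ∀ K, |A 0 K / Δt - B K| ≤ M.cellVol * N * Δt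
  time : ∀ k K, |It k K - (A (k + 1) K - A k K) / Δt| ≤ M.cellVol * N * Δt ^ 2
  jump : ∀ k K i, |A k (M.nbr K i 1) - A k K| ≤ M.cellVol * N * Δt * M.edge i
  second : ∀ k K i, |A k (M.nbr K i 1) - A k K - (A k K - A k (M.nbr K i (-1)))|
    ≤ 2 * (M.cellVol * N * Δt) * M.edge i ^ 2
  space : ∀ k K i, |(A k (M.nbr K i 1) - A k (M.nbr K i (-1))) / 2 - M.edge i * Ix k i K|
    ≤ M.cellVol * N * Δt * M.edge i ^ 2
  grad : ∀ k i K, |Ix k i K| ≤ M.cellVol * N * Δt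
  final : ∀ K, A n K = 0

/-- The consistency error of the convective flux of `r` by the velocity `v` in one time step, per
unit of time and of the norm of the test function. -/
noncomputable def fluxError (κ α : ℝ) (r : M.Cell → ℝ) (v : M.Cell → Fin d → ℝ) : ℝ :=
  ∑ K, ∑ i, M.cellVol * (3 * |r K| * (M.h * |v K i| + |v (M.nbr K i 1) i - v K i|
    + |v K i - v (M.nbr K i (-1)) i| + κ * M.h ^ α * M.h))

variable {M}

/-- Consistency of all fluxes in one time step. The viscous term, with coefficient `b`, is kept as
it stands and contributes no error. -/
theorem MomentBounds.flux_step {Δt N : ℝ} {n : ℕ} {A : ℕ → M.Cell → ℝ} {B : M.Cell → ℝ}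
    {It : ℕ → M.Cell → ℝ} {Ix : ℕ → Fin d → M.Cell → ℝ} (H : M.MomentBounds Δt N n A B It Ix)
    (hedge : ∀ i, M.edge i ≤ M.h) {κ α b : ℝ} (hκ : 0 < κ) (hN : 0 ≤ N) (hΔt : 0 < Δt)
    (r p m : M.Cell → ℝ) (v : M.Cell → Fin d → ℝ) (j : Fin d) (k : ℕ) :
    |∑ K, ∑ i, M.faceArea i * ((M.flux κ α r v K i 1
            + M.faceAvg p K i 1 * (if i = j then ((1 : ℤ) : ℝ) else 0)
            - b * M.faceJump m K i 1) * (A k (M.nbr K i 1) / M.cellVol - A k K / M.cellVol))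
        - (∑ K, (∑ i, r K * v K i * Ix k i K + p K * Ix k j K)
          - b * ∑ K, ∑ i, M.faceArea i * (M.faceJump m K i 1
            * (A k (M.nbr K i 1) / M.cellVol - A k K / M.cellVol)))|
      ≤ N * Δt * (M.fluxError κ α r v + M.h * ∑ K, M.cellVol * |p K|) := by
  have hV := M.cellVol_pos
  set c := κ * M.h ^ α with hc
  have hc0 : 0 < c := mul_pos hκ (Real.rpow_pos_of_pos M.h_pos _)
  let x : M.Cell → Fin d → ℝ := fun K i => (A k (M.nbr K i 1) - A k K) / M.edge i
  let y : M.Cell → Fin d → ℝ := fun K i => (A k K - A k (M.nbr K i (-1))) / M.edge i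
  let a₁ : M.Cell → Fin d → ℝ := fun K i =>
    ((v K i + v (M.nbr K i 1) i) / 2 + |(v K i + v (M.nbr K i 1) i) / 2|) / 2 + c
  let a₂ : M.Cell → Fin d → ℝ := fun K i =>
    ((v (M.nbr K i (-1)) i + v K i) / 2 - |(v (M.nbr K i (-1)) i + v K i) / 2|) / 2 - c
  have hface : ∀ i, M.faceArea i / M.cellVol = 1 / M.edge i := fun i => by
    rw [← M.faceArea_mul_edge i]
    field_simp [(M.faceArea_pos i).ne', (M.edge_pos i).ne']
  -- every term is moved onto the value of `r` or `p` at one element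
  have hid : ∑ K, ∑ i, M.faceArea i * ((M.flux κ α r v K i 1
            + M.faceAvg p K i 1 * (if i = j then ((1 : ℤ) : ℝ) else 0)
            - b * M.faceJump m K i 1) * (A k (M.nbr K i 1) / M.cellVol - A k K / M.cellVol))
        - (∑ K, (∑ i, r K * v K i * Ix k i K + p K * Ix k j K)
          - b * ∑ K, ∑ i, M.faceArea i * (M.faceJump m K i 1
            * (A k (M.nbr K i 1) / M.cellVol - A k K / M.cellVol)))
      = ∑ K, ∑ i, r K * (a₁ K i * x K i + a₂ K i * y K i - v K i * Ix k i K)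
        + ∑ K, p K * ((x K j + y K j) / 2 - Ix k j K) := by
    have e1 : ∀ K i, M.faceArea i * ((M.flux κ α r v K i 1
            + M.faceAvg p K i 1 * (if i = j then ((1 : ℤ) : ℝ) else 0)
            - b * M.faceJump m K i 1) * (A k (M.nbr K i 1) / M.cellVol - A k K / M.cellVol))
        = r K * a₁ K i * x K i + r (M.nbr K i 1) * a₂ (M.nbr K i 1) i * y (M.nbr K i 1) i
          + (if i = j then (p K * x K i + p (M.nbr K i 1) * y (M.nbr K i 1) i) / 2 else 0)
          - b * (M.faceArea i * (M.faceJump m K i 1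
            * (A k (M.nbr K i 1) / M.cellVol - A k K / M.cellVol))) := fun K i => by
      have hy : y (M.nbr K i 1) i = x K i := by simp only [x, y, nbr_one_neg]
      have ha₂ : a₂ (M.nbr K i 1) i
          = (M.faceVel v K i - |M.faceVel v K i|) / 2 - c := by
        simp only [a₂, nbr_one_neg, faceVel]
      have ha₁ : a₁ K i = (M.faceVel v K i + |M.faceVel v K i|) / 2 + c := rfl
      have hx : M.faceArea i * (A k (M.nbr K i 1) / M.cellVol - A k K / M.cellVol) = x K i := by
        rw [← sub_div, mul_div_assoc', mul_div_right_comm, hface]; simp only [x]; ring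
      rw [hy, ha₂, ha₁, flux_one, faceAvg, ← hx]
      split_ifs <;> push_cast <;> ring
    simp_rw [e1]
    have s1 : ∀ g : M.Cell → Fin d → ℝ, ∑ K, ∑ i, g (M.nbr K i 1) i = ∑ K, ∑ i, g K i := fun g => by
      rw [Finset.sum_comm, Finset.sum_comm (s := Finset.univ (α := M.Cell))]
      exact Finset.sum_congr rfl fun i _ => M.sum_nbr (fun K => g K i) i 1
    have s2 := s1 (fun K i => r K * a₂ K i * y K i)
    have s3 := s1 (fun K i => if i = j then p K * y K i / 2 else 0)
    simp only [add_div, ite_add_zero, Finset.sum_add_distrib, Finset.sum_sub_distrib] at s2 s3 ⊢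
    rw [s2, s3]
    simp only [mul_sub, mul_add, Finset.sum_add_distrib, Finset.sum_sub_distrib,
      Finset.sum_ite_eq', Finset.mem_univ, if_true, Finset.mul_sum, mul_assoc,
      mul_div_assoc]
    ring
  rw [hid]
  refine (abs_add_le _ _).trans ?_
  rw [mul_add]
  refine add_le_add ?_ ?_
  · refine (Finset.abs_sum_le_sum_abs _ _).trans ?_
    rw [fluxError, Finset.mul_sum]
    refine Finset.sum_le_sum fun K _ => (Finset.abs_sum_le_sum_abs _ _).trans ?_
    rw [Finset.mul_sum]
    refine Finset.sum_le_sum fun i _ => ?_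
    have he := M.edge_pos i
    have hxB : |x K i| ≤ M.cellVol * N * Δt := by
      rw [abs_div, abs_of_pos he, div_le_iff₀ he]; exact H.jump k K i
    have hxy : |x K i - y K i| ≤ 2 * (M.cellVol * N * Δt) * M.edge i := by
      rw [← sub_div, abs_div, abs_of_pos he, div_le_iff₀ he]
      exact (H.second k K i).trans (le_of_eq (by ring))
    have hI : |(x K i + y K i) / 2 - Ix k i K| ≤ M.cellVol * N * Δt * M.edge i := by
      have : (x K i + y K i) / 2 - Ix k i K
          = ((A k (M.nbr K i 1) - A k (M.nbr K i (-1))) / 2 - M.edge i * Ix k i K)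
            / M.edge i := by
        simp only [x, y]; field_simp; ring
      rw [this, abs_div, abs_of_pos he, div_le_iff₀ he]
      exact (H.space k K i).trans (le_of_eq (by ring))
    have := upwind_consistency (U := v K i) (Up := v (M.nbr K i 1) i)
      (Um := v (M.nbr K i (-1)) i) hc0.le he.le (M.edge_le_two i) hxB hxy hI
    rw [abs_mul]
    calc _ ≤ |r K| * (3 * (M.cellVol * N * Δt) * (M.h * |v K i| + |v (M.nbr K i 1) i - v K i|
            + |v K i - v (M.nbr K i (-1)) i| + c * M.h)) := by
          refine mul_le_mul_of_nonneg_left (this.trans ?_) (abs_nonneg _)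
          have := hedge i
          gcongr
      _ = _ := by ring
  · refine (Finset.abs_sum_le_sum_abs _ _).trans ?_
    rw [Finset.mul_sum, Finset.mul_sum]
    refine Finset.sum_le_sum fun K _ => ?_
    have he := M.edge_pos j
    have : (x K j + y K j) / 2 - Ix k j K
          = ((A k (M.nbr K j 1) - A k (M.nbr K j (-1))) / 2 - M.edge j * Ix k j K)
            / M.edge j := by
        simp only [x, y]; field_simp; ring
    have hI : |(x K j + y K j) / 2 - Ix k j K| ≤ M.cellVol * N * Δt * M.h := by
      rw [this, abs_div, abs_of_pos he, div_le_iff₀ he]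
      refine (H.space k K j).trans ?_
      rw [pow_two, ← mul_assoc]
      have := hedge j
      gcongr
    rw [abs_mul]
    calc _ ≤ |p K| * (M.cellVol * N * Δt * M.h) := by gcongr
      _ = _ := by ring

/-- The discrete consistency formulation. For a quantity `r` solving the scheme with pressure `p`
in the direction `j` and with the viscosity `b` acting on `m`, testing the scheme with the moments
of a test function leaves only the errors on the right; those with index `0` come from the first
time slab, on which the extension in time does not satisfy the scheme. -/
theorem MomentBounds.consistency {Δt N : ℝ} {n : ℕ} {A : ℕ → M.Cell → ℝ} {B : M.Cell → ℝ}
    {It : ℕ → M.Cell → ℝ} {Ix : ℕ → Fin d → M.Cell → ℝ}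
    (H : M.MomentBounds Δt N (n + 1) A B It Ix)
    (hedge : ∀ i, M.edge i ≤ M.h) {κ α b : ℝ} (hκ : 0 < κ) (hb : 0 ≤ b) (hN : 0 ≤ N)
    (hΔt : 0 < Δt) (r p m : ℕ → M.Cell → ℝ) (v : ℕ → M.Cell → Fin d → ℝ) (j : Fin d)
    (hr : ∀ k < n, ∀ K, (r (k + 1) K - r k K) / Δt + M.faceSum (fun i s =>
      M.flux κ α (r (k + 1)) (v (k + 1)) K i s
        + M.faceAvg (p (k + 1)) K i s * (if i = j then (s : ℝ) else 0)
        - b * M.faceJump (m (k + 1)) K i s) = 0) :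
    |∑ K, r 0 K * B K
        + ∑ k ∈ Finset.range (n + 1),
          ∑ K, (r k K * It k K + (∑ i, r k K * v k K i * Ix k i K + p k K * Ix k j K))
        - b * ∑ k ∈ Finset.range (n + 1), ∑ K, ∑ i, M.faceArea i * (M.faceJump (m k) K i 1
            * (A k (M.nbr K i 1) / M.cellVol - A k K / M.cellVol))|
      ≤ N * Δt * (∑ K, M.cellVol * |r 0 K|
          + Δt * ∑ k ∈ Finset.range (n + 1), ∑ K, M.cellVol * |r k K|
          + ∑ K, M.cellVol * (∑ i, |r 0 K * v 0 K i| + |p 0 K|)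
          + b * ∑ K, ∑ i, M.cellVol * |M.faceJump (m 0) K i 1|
          + ∑ k ∈ Finset.range n, (M.fluxError κ α (r (k + 1)) (v (k + 1))
            + M.h * ∑ K, M.cellVol * |p (k + 1) K|)) := by
  have hV := M.cellVol_pos
  let X : ℕ → ℝ := fun k => ∑ K, (∑ i, r k K * v k K i * Ix k i K + p k K * Ix k j K)
  let Y : ℕ → ℝ := fun k => ∑ K, ∑ i, M.faceArea i * (M.faceJump (m k) K i 1
            * (A k (M.nbr K i 1) / M.cellVol - A k K / M.cellVol))
  let Z : ℕ → ℝ := fun k => ∑ K, ∑ i, M.faceArea i * ((M.flux κ α (r k) (v k) K i 1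
            + M.faceAvg (p k) K i 1 * (if i = j then ((1 : ℤ) : ℝ) else 0)
            - b * M.faceJump (m k) K i 1) * (A k (M.nbr K i 1) / M.cellVol - A k K / M.cellVol))
  have hscheme : ∀ k < n, ∑ K, (r (k + 1) K - r k K) * (A (k + 1) K / Δt) = Z (k + 1) := by
    intro k hk
    have := M.sum_mul_faceSum (fun K => A (k + 1) K / M.cellVol)
      (fun K i s => M.flux κ α (r (k + 1)) (v (k + 1)) K i s
        + M.faceAvg (p (k + 1)) K i s * (if i = j then (s : ℝ) else 0)
        - b * M.faceJump (m (k + 1)) K i s)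
      (M.fullFlux_neg_one κ α b (r (k + 1)) (p (k + 1)) (m (k + 1)) (v (k + 1)) j)
    have hz : Z (k + 1) = -∑ K, M.cellVol * (A (k + 1) K / M.cellVol * M.faceSum (fun i s =>
      M.flux κ α (r (k + 1)) (v (k + 1)) K i s
        + M.faceAvg (p (k + 1)) K i s * (if i = j then (s : ℝ) else 0)
        - b * M.faceJump (m (k + 1)) K i s)) := by rw [this, neg_neg]
    rw [hz, ← Finset.sum_neg_distrib]
    refine Finset.sum_congr rfl fun K _ => ?_
    have hK := hr k hk K
    rw [← eq_neg_iff_add_eq_zero] at hK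
    rw [← neg_eq_iff_eq_neg.2 hK]
    field_simp
  -- summation by parts in time
  have habel : ∀ N, ∑ k ∈ Finset.range N, ∑ K, (r (k + 1) K - r k K) * (A (k + 1) K / Δt)
      = ∑ K, r N K * (A (N + 1) K / Δt) - ∑ K, r 0 K * (A 0 K / Δt)
        - ∑ k ∈ Finset.range (N + 1), ∑ K, r k K * ((A (k + 1) K - A k K) / Δt) := by
    intro N
    induction N with
    | zero =>
      simp only [Finset.range_zero, Finset.sum_empty, zero_add, Finset.range_one,
        Finset.sum_singleton, ← Finset.sum_sub_distrib]
      exact (Finset.sum_eq_zero fun K _ => by ring).symm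
    | succ N ih =>
      rw [Finset.sum_range_succ, ih, Finset.sum_range_succ _ (N + 1)]
      have : ∑ K, (r (N + 1) K - r N K) * (A (N + 1) K / Δt)
          = ∑ K, r (N + 1) K * (A (N + 1 + 1) K / Δt) - ∑ K, r N K * (A (N + 1) K / Δt)
            - ∑ K, r (N + 1) K * ((A (N + 1 + 1) K - A (N + 1) K) / Δt) := by
        simp only [← Finset.sum_sub_distrib]
        exact Finset.sum_congr rfl fun K _ => by ring
      rw [this]; ring
  have hfin : ∑ K, r n K * (A (n + 1) K / Δt) = 0 :=
    Finset.sum_eq_zero fun K _ => by rw [H.final]; simp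
  have hA : ∑ k ∈ Finset.range n, Z (k + 1) = -∑ K, r 0 K * (A 0 K / Δt)
        - ∑ k ∈ Finset.range (n + 1), ∑ K, r k K * ((A (k + 1) K - A k K) / Δt) := by
    rw [← Finset.sum_congr rfl fun k hk => hscheme k (Finset.mem_range.1 hk), habel, hfin, zero_sub]
  have hsplit : ∑ K, r 0 K * B K
        + ∑ k ∈ Finset.range (n + 1),
          ∑ K, (r k K * It k K + (∑ i, r k K * v k K i * Ix k i K + p k K * Ix k j K))
        - b * ∑ k ∈ Finset.range (n + 1), Y k
      = -∑ K, r 0 K * (A 0 K / Δt - B K)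
        + ∑ k ∈ Finset.range (n + 1), ∑ K, r k K * (It k K - (A (k + 1) K - A k K) / Δt)
        + X 0 - b * Y 0 - ∑ k ∈ Finset.range n, (Z (k + 1) - (X (k + 1) - b * Y (k + 1))) := by
    have e1 : ∑ k ∈ Finset.range (n + 1),
          ∑ K, (r k K * It k K + (∑ i, r k K * v k K i * Ix k i K + p k K * Ix k j K))
        = ∑ k ∈ Finset.range (n + 1), ∑ K, r k K * It k K
          + (∑ k ∈ Finset.range n, X (k + 1) + X 0) := by
      rw [← Finset.sum_range_succ' X n, ← Finset.sum_add_distrib]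
      exact Finset.sum_congr rfl fun k _ => Finset.sum_add_distrib
    rw [e1, Finset.sum_range_succ' Y n, Finset.sum_sub_distrib, hA, Finset.sum_sub_distrib,
      ← Finset.mul_sum]
    simp only [mul_sub, Finset.sum_sub_distrib]
    ring
  have b1 : |∑ K, r 0 K * (A 0 K / Δt - B K)| ≤ N * Δt * ∑ K, M.cellVol * |r 0 K| := by
    refine (Finset.abs_sum_le_sum_abs _ _).trans ?_
    rw [Finset.mul_sum]
    refine Finset.sum_le_sum fun K _ => ?_
    rw [abs_mul]
    exact (mul_le_mul_of_nonneg_left (H.initial K) (abs_nonneg _)).trans (le_of_eq (by ring))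
  have b2 : |∑ k ∈ Finset.range (n + 1), ∑ K, r k K * (It k K - (A (k + 1) K - A k K) / Δt)|
      ≤ N * Δt * (Δt * ∑ k ∈ Finset.range (n + 1), ∑ K, M.cellVol * |r k K|) := by
    refine (Finset.abs_sum_le_sum_abs _ _).trans ?_
    rw [Finset.mul_sum, Finset.mul_sum]
    refine Finset.sum_le_sum fun k _ => (Finset.abs_sum_le_sum_abs _ _).trans ?_
    rw [Finset.mul_sum, Finset.mul_sum]
    refine Finset.sum_le_sum fun K _ => ?_
    rw [abs_mul]
    exact (mul_le_mul_of_nonneg_left (H.time k K) (abs_nonneg _)).trans (le_of_eq (by ring))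
  have b3 : |X 0| ≤ N * Δt * ∑ K, M.cellVol * (∑ i, |r 0 K * v 0 K i| + |p 0 K|) := by
    refine (Finset.abs_sum_le_sum_abs _ _).trans ?_
    rw [Finset.mul_sum]
    refine Finset.sum_le_sum fun K _ => (abs_add_le _ _).trans ?_
    rw [mul_add, mul_add]
    refine add_le_add ?_ ?_
    · refine (Finset.abs_sum_le_sum_abs _ _).trans ?_
      rw [Finset.mul_sum, Finset.mul_sum]
      refine Finset.sum_le_sum fun i _ => ?_
      rw [abs_mul]
      exact (mul_le_mul_of_nonneg_left (H.grad 0 i K) (abs_nonneg _)).trans (le_of_eq (by ring))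
    · rw [abs_mul]
      exact (mul_le_mul_of_nonneg_left (H.grad 0 j K) (abs_nonneg _)).trans (le_of_eq (by ring))
  have b4 : |b * Y 0| ≤ N * Δt * (b * ∑ K, ∑ i, M.cellVol * |M.faceJump (m 0) K i 1|) := by
    rw [abs_mul, abs_of_nonneg hb, mul_left_comm]
    refine mul_le_mul_of_nonneg_left ((Finset.abs_sum_le_sum_abs _ _).trans ?_) hb
    rw [Finset.mul_sum]
    refine Finset.sum_le_sum fun K _ => (Finset.abs_sum_le_sum_abs _ _).trans ?_
    rw [Finset.mul_sum]
    refine Finset.sum_le_sum fun i _ => ?_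
    rw [abs_mul, abs_mul, abs_of_pos (M.faceArea_pos i), ← sub_div, abs_div, abs_of_pos hV]
    have := H.jump 0 K i
    have h2 : |A 0 (M.nbr K i 1) - A 0 K| / M.cellVol ≤ N * Δt * M.edge i := by
      rw [div_le_iff₀ hV]; exact this.trans (le_of_eq (by ring))
    calc _ ≤ M.faceArea i * (|M.faceJump (m 0) K i 1| * (N * Δt * M.edge i)) := by
          have := (M.faceArea_pos i).le
          gcongr
      _ = _ := by rw [← M.faceArea_mul_edge i]; ring
  have b5 : |∑ k ∈ Finset.range n, (Z (k + 1) - (X (k + 1) - b * Y (k + 1)))|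
      ≤ N * Δt * ∑ k ∈ Finset.range n, (M.fluxError κ α (r (k + 1)) (v (k + 1))
            + M.h * ∑ K, M.cellVol * |p (k + 1) K|) := by
    refine (Finset.abs_sum_le_sum_abs _ _).trans ?_
    rw [Finset.mul_sum]
    exact Finset.sum_le_sum fun k _ => H.flux_step hedge hκ hN hΔt _ _ _ _ j (k + 1)
  rw [hsplit]
  refine (abs_sub _ _).trans ?_
  rw [mul_add _ _ (∑ k ∈ Finset.range n, _)]
  refine add_le_add ((abs_sub _ _).trans ?_) b5
  rw [mul_add _ _ (b * _)]
  refine add_le_add ((abs_add_le _ _).trans ?_) b4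
  rw [mul_add _ _ (∑ K, M.cellVol * (_ + _))]
  refine add_le_add ((abs_add_le _ _).trans ?_) b3
  rw [mul_add, abs_neg]
  exact add_le_add b1 b2

end Mesh

end EulerFV

/-! ### Integrals over the torus and over the elements -/

namespace EulerFV

variable {d : ℕ} {E : Type*} [NormedAddCommGroup E]

theorem TorusPeriodic.add_int {F : Type*} {f : (Fin d → ℝ) → F} (hf : TorusPeriodic f)
    (m : Fin d → ℤ) (x : Fin d → ℝ) : f (x + fun i => 2 * (m i : ℝ)) = f x := by
  let H : AddSubgroup (Fin d → ℝ) :=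
    { carrier := {g | ∀ x, f (x + g) = f x}
      add_mem' := fun {a b} ha hb x => by rw [← add_assoc, hb, ha]
      zero_mem' := fun x => by rw [add_zero]
      neg_mem' := fun {a} ha x => by rw [← ha (x + -a), neg_add_cancel_right] }
  have : (fun i => 2 * (m i : ℝ)) ∈ H := by
    have e : (fun i => 2 * (m i : ℝ)) = ∑ i, m i • (Pi.single i 2 : Fin d → ℝ) := by
      ext j
      simp [Finset.sum_apply, Pi.single_apply, mul_comm]
    rw [e]
    exact H.sum_mem fun i _ => H.zsmul_mem (fun x => hf x i) _
  exact this x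

/-- The lattice `2ℤᵈ` of periods. -/
def periodLattice (d : ℕ) : AddSubgroup (Fin d → ℝ) :=
  AddMonoidHom.range
    ({ toFun := fun m i => 2 * (m i : ℝ)
       map_zero' := by ext; simp
       map_add' := fun a b => by ext; simp [mul_add] } : (Fin d → ℤ) →+ (Fin d → ℝ))

instance : Countable (periodLattice d) :=
  (Set.countable_range (fun (m : Fin d → ℤ) (i : Fin d) => 2 * (m i : ℝ))).to_subtype

theorem TorusPeriodic.vadd {F : Type*} {f : (Fin d → ℝ) → F} (hf : TorusPeriodic f)
    (g : periodLattice d) (x : Fin d → ℝ) : f (g +ᵥ x) = f x := by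
  obtain ⟨_, m, rfl⟩ := g
  rw [← hf.add_int m x, add_comm x]
  rfl

theorem isAddFundamentalDomain_box (c : Fin d → ℝ) :
    IsAddFundamentalDomain (periodLattice d) (univ.pi fun i => Ico (c i) (c i + 2)) := by
  refine .mk' (MeasurableSet.univ_pi fun i => measurableSet_Ico).nullMeasurableSet fun x => ?_
  have h1 : ∀ i, ∃! m : ℤ, 2 * (m : ℝ) + x i ∈ Ico (c i) (c i + 2) := fun i => by
    have h := existsUnique_add_zsmul_mem_Ico (two_pos (α := ℝ)) (x i) (c i)
    simp only [zsmul_eq_mul] at h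
    convert h using 3
    ring
  choose m hm hu using h1
  refine ⟨⟨_, m, rfl⟩, fun i _ => hm i, ?_⟩
  rintro ⟨_, k, rfl⟩ hk
  have : k = m := funext fun i => hu i _ (hk i (mem_univ i))
  rw [this]

theorem torus_ae_eq : (torus d : Set (Fin d → ℝ)) =ᵐ[volume]
    univ.pi fun i : Fin d => Ico ((fun _ => -1 : Fin d → ℝ) i) ((fun _ => -1 : Fin d → ℝ) i + 2) := by
  have h := (Measure.univ_pi_Ico_ae_eq_Icc (μ := fun _ : Fin d => (volume : Measure ℝ))
    (f := fun _ => -1) (g := fun _ => 1)).symm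
  rw [volume_pi, torus]
  convert h using 4
  norm_num

theorem TorusPeriodic.integrableOn_box_iff {f : (Fin d → ℝ) → E} (hf : TorusPeriodic f)
    (c : Fin d → ℝ) :
    IntegrableOn f (univ.pi fun i => Ico (c i) (c i + 2)) ↔ IntegrableOn f (torus d) := by
  rw [integrableOn_congr_set_ae torus_ae_eq]
  exact (isAddFundamentalDomain_box c).integrableOn_iff (isAddFundamentalDomain_box _) hf.vadd

theorem TorusPeriodic.setIntegral_box [NormedSpace ℝ E] {f : (Fin d → ℝ) → E}
    (hf : TorusPeriodic f) (c : Fin d → ℝ) :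
    ∫ x in univ.pi fun i => Ico (c i) (c i + 2), f x = ∫ x in torus d, f x := by
  rw [setIntegral_congr_set torus_ae_eq]
  exact (isAddFundamentalDomain_box c).setIntegral_eq (isAddFundamentalDomain_box _) hf.vadd

namespace Mesh

variable (M : Mesh d)

/-- The element `K` without its upper faces; these sets are disjoint. -/
def halfOpenCell (K : M.Cell) : Set (Fin d → ℝ) :=
  univ.pi fun i => Ico (M.x₀ i + ((K i).val : ℝ) * M.edge i)
    (M.x₀ i + (((K i).val : ℝ) + 1) * M.edge i)

theorem cellSet_ae_eq (K : M.Cell) : M.cellSet K =ᵐ[volume] M.halfOpenCell K :=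
  Measure.univ_pi_Ico_ae_eq_Icc.symm

theorem measurableSet_halfOpenCell (K : M.Cell) : MeasurableSet (M.halfOpenCell K) :=
  MeasurableSet.univ_pi fun _ => measurableSet_Ico

theorem mem_halfOpenCell_iff {K : M.Cell} {x : Fin d → ℝ} :
    x ∈ M.halfOpenCell K ↔ ∀ i, ⌊(x i - M.x₀ i) / M.edge i⌋ = ((K i).val : ℤ) := by
  simp only [halfOpenCell, mem_univ_pi, mem_Ico, Int.floor_eq_iff, le_div_iff₀ (M.edge_pos _),
    div_lt_iff₀ (M.edge_pos _), Int.cast_natCast]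
  refine forall_congr' fun i => and_congr ?_ ?_ <;> constructor <;> intro h <;> linarith

theorem cellIndex_eq {K : M.Cell} {x : Fin d → ℝ} (hx : x ∈ M.halfOpenCell K) :
    M.cellIndex x = K := by
  ext1 i
  rw [cellIndex, M.mem_halfOpenCell_iff.1 hx i, Int.cast_natCast, ZMod.natCast_zmod_val]

theorem iUnion_halfOpenCell :
    ⋃ K, M.halfOpenCell K = univ.pi fun i => Ico (M.x₀ i) (M.x₀ i + 2) := by
  ext x
  simp only [mem_iUnion, mem_halfOpenCell_iff, mem_univ_pi, mem_Ico]
  have key : ∀ i, (M.x₀ i ≤ x i ∧ x i < M.x₀ i + 2) ↔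
      0 ≤ ⌊(x i - M.x₀ i) / M.edge i⌋ ∧ ⌊(x i - M.x₀ i) / M.edge i⌋ < (M.N i : ℕ) := fun i => by
    rw [Int.floor_nonneg, Int.floor_lt, Int.cast_natCast, div_lt_iff₀ (M.edge_pos i),
      M.natCast_mul_edge, le_div_iff₀ (M.edge_pos i), zero_mul]
    constructor <;> rintro ⟨h1, h2⟩ <;> constructor <;> linarith
  simp only [key]
  constructor
  · rintro ⟨K, hK⟩ i
    rw [hK i]
    exact ⟨Int.natCast_nonneg _, by exact_mod_cast ZMod.val_lt (K i)⟩
  · intro h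
    refine ⟨M.cellIndex x, fun i => ?_⟩
    rw [cellIndex, ZMod.val_intCast, Int.emod_eq_of_lt (h i).1 (h i).2]

theorem pairwise_disjoint_halfOpenCell : Pairwise (Function.onFun Disjoint M.halfOpenCell) :=
  fun _ _ hKL => disjoint_left.2 fun _ hx hx' =>
    hKL ((M.cellIndex_eq hx).symm.trans (M.cellIndex_eq hx'))

theorem cellIndex_periodic : TorusPeriodic M.cellIndex := by
  intro x i
  ext1 j
  by_cases hj : j = i
  · subst hj
    have : (x j + 2 - M.x₀ j) / M.edge j
        = (x j - M.x₀ j) / M.edge j + ((M.N j : ℕ) : ℤ) := by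
      rw [← M.natCast_mul_edge j]
      have := (M.edge_pos j).ne'
      push_cast
      field_simp
      ring
    simp only [cellIndex, Pi.add_apply, Pi.single_eq_same, this, Int.floor_add_intCast]
    simp
  · simp [cellIndex, hj]

/-- A periodic function given elementwise is integrated elementwise. -/
theorem integrableOn_torus {F : (Fin d → ℝ) → E} {g : M.Cell → (Fin d → ℝ) → E}
    (hF : TorusPeriodic F) (hFg : ∀ x, F x = g (M.cellIndex x) x)
    (hg : ∀ K, IntegrableOn (g K) (M.cellSet K)) : IntegrableOn F (torus d) := by
  rw [← hF.integrableOn_box_iff M.x₀, ← iUnion_halfOpenCell, integrableOn_finite_iUnion]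
  intro K
  refine ((integrableOn_congr_set_ae (M.cellSet_ae_eq K)).1 (hg K)).congr_fun
    (fun x hx => ?_) (M.measurableSet_halfOpenCell K)
  rw [hFg, M.cellIndex_eq hx]

theorem integral_torus [NormedSpace ℝ E] {F : (Fin d → ℝ) → E} {g : M.Cell → (Fin d → ℝ) → E}
    (hF : TorusPeriodic F) (hFg : ∀ x, F x = g (M.cellIndex x) x)
    (hg : ∀ K, IntegrableOn (g K) (M.cellSet K)) :
    ∫ x in torus d, F x = ∑ K, ∫ x in M.cellSet K, g K x := by
  have hint := M.integrableOn_torus hF hFg hg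
  rw [← hF.integrableOn_box_iff M.x₀, ← iUnion_halfOpenCell, integrableOn_finite_iUnion] at hint
  rw [← hF.setIntegral_box M.x₀, ← iUnion_halfOpenCell,
    integral_iUnion_fintype M.measurableSet_halfOpenCell M.pairwise_disjoint_halfOpenCell hint]
  refine Finset.sum_congr rfl fun K _ => ?_
  rw [setIntegral_congr_set (M.cellSet_ae_eq K)]
  exact setIntegral_congr_fun (M.measurableSet_halfOpenCell K) fun x hx => by
    rw [hFg, M.cellIndex_eq hx]

theorem integrableOn_cellSet {F : (Fin d → ℝ) → E} (hF : TorusPeriodic F)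
    (hint : IntegrableOn F (torus d)) (K : M.Cell) : IntegrableOn F (M.cellSet K) := by
  rw [← hF.integrableOn_box_iff M.x₀, ← iUnion_halfOpenCell, integrableOn_finite_iUnion] at hint
  exact (integrableOn_congr_set_ae (M.cellSet_ae_eq K)).2 (hint K)

theorem isCompact_cellSet (K : M.Cell) : IsCompact (M.cellSet K) := isCompact_Icc

theorem measureReal_cellSet (K : M.Cell) : volume.real (M.cellSet K) = M.cellVol := by
  rw [cellSet, measureReal_def, Real.volume_Icc_pi_toReal]
  · exact Finset.prod_congr rfl fun i _ => by ring
  · intro i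
    have := (M.edge_pos i).le
    simp only
    gcongr
    linarith

theorem norm_integral_cellSet_le [NormedSpace ℝ E] {f : (Fin d → ℝ) → E} {C : ℝ} (K : M.Cell)
    (h : ∀ x, ‖f x‖ ≤ C) : ‖∫ x in M.cellSet K, f x‖ ≤ M.cellVol * C := by
  rw [← M.measureReal_cellSet K, mul_comm]
  exact norm_setIntegral_le_of_norm_le_const (M.isCompact_cellSet K).measure_lt_top
    fun x _ => h x

theorem sum_cellVol : ∑ _K : M.Cell, M.cellVol = 2 ^ d := by
  have h := M.integral_torus (F := fun _ => (1 : ℝ)) (g := fun _ _ => 1) (fun _ _ => rfl)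
    (fun _ => rfl) fun K => integrableOn_const (M.isCompact_cellSet K).measure_lt_top.ne
  simp only [integral_const, smul_eq_mul, mul_one, measureReal_restrict_apply_univ,
    measureReal_cellSet] at h
  rw [← h, torus, measureReal_def, Real.volume_Icc_pi_toReal]
  · norm_num
  · intro i; norm_num

/-- Integration over a neighbouring element is integration of the shifted function; if the
neighbour is reached across the boundary of the period, this uses the periodicity. -/
theorem integral_cellSet_nbr [NormedSpace ℝ E] {f : (Fin d → ℝ) → E} (hf : TorusPeriodic f)
    (K : M.Cell) (i : Fin d) (s : ℤ) :
    ∫ x in M.cellSet (M.nbr K i s), f x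
      = ∫ x in M.cellSet K, f (x + Pi.single i (s * M.edge i)) := by
  have hl : ∀ j, ∃ l : ℤ, (((M.nbr K i s) j).val : ℤ)
      = (K j).val + Pi.single (M := fun _ => ℤ) i s j + (M.N j : ℕ) * l := fun j => by
    have : ((((M.nbr K i s) j).val : ℤ) : ZMod (M.N j))
        = (((K j).val + Pi.single (M := fun _ => ℤ) i s j : ℤ) : ZMod (M.N j)) := by
      by_cases hj : j = i
      · subst hj; simp [nbr]
      · simp [nbr, hj]
    rw [ZMod.intCast_eq_intCast_iff_dvd_sub] at this
    obtain ⟨l, hl⟩ := this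
    exact ⟨-l, by linarith⟩
  choose l hl using hl
  set c : Fin d → ℝ := Pi.single i (s * M.edge i) + fun j => 2 * (l j : ℝ) with hc
  have hset : (fun x => x + c) ⁻¹' M.cellSet (M.nbr K i s) = M.cellSet K := by
    have hcj : ∀ j, (((M.nbr K i s) j).val : ℝ) * M.edge j = ((K j).val : ℝ) * M.edge j + c j := by
      intro j
      have := congrArg (fun z : ℤ => (z : ℝ) * M.edge j) (hl j)
      push_cast at this
      rw [this, hc, Pi.add_apply, ← M.natCast_mul_edge j]
      by_cases hj : j = i
      · subst hj; simp; ring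
      · simp [hj]; ring
    rw [cellSet, preimage_add_const_Icc, cellSet]
    congr 1 <;> ext j <;> simp only [Pi.sub_apply, add_mul, hcj] <;> ring
  rw [← (measurePreserving_add_right volume c).setIntegral_preimage_emb
    (measurableEmbedding_addRight c), hset]
  congr 1
  ext x
  rw [hc, ← add_assoc, hf.add_int]

end Mesh

end EulerFV

/-! ### Test functions -/

namespace EulerFV

open scoped Pointwise

variable {d : ℕ} {F : Type*} [NormedAddCommGroup F] [NormedSpace ℝ F]

theorem uniqueDiffOn_slab : UniqueDiffOn ℝ (slab d) :=
  (uniqueDiffOn_Ici 0).prod uniqueDiffOn_univ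

theorem convex_slab : Convex ℝ (slab d) := (convex_Ici 0).prod convex_univ

theorem mk_mem_slab {t : ℝ} (ht : 0 ≤ t) (x : Fin d → ℝ) : (t, x) ∈ slab d := ⟨ht, mem_univ x⟩

theorem slab_mem_nhds {t : ℝ} (ht : 0 < t) (x : Fin d → ℝ) : slab d ∈ nhds (t, x) :=
  prod_mem_nhds (Ici_mem_nhds ht) Filter.univ_mem

theorem vadd_slab (a : Fin d → ℝ) : ((0, a) : ℝ × (Fin d → ℝ)) +ᵥ slab d = slab d := by
  ext z
  simp [mem_vadd_set_iff_neg_vadd_mem, slab, Prod.fst_add]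

namespace IsTestFunction

variable {T : ℝ} {φ : ℝ × (Fin d → ℝ) → F}

theorem iteratedFDerivWithin_add (h : IsTestFunction T φ) (n : ℕ) {z : ℝ × (Fin d → ℝ)}
    (hz : z ∈ slab d) (m : Fin d → ℤ) :
    iteratedFDerivWithin ℝ n φ (slab d) (z + (0, fun i => 2 * (m i : ℝ)))
      = iteratedFDerivWithin ℝ n φ (slab d) z := by
  have := iteratedFDerivWithin_comp_add_right (𝕜 := ℝ) (s := slab d) (f := φ) n
    (0, fun i => 2 * (m i : ℝ)) z
  rw [vadd_slab] at this
  rw [← this]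
  refine iteratedFDerivWithin_congr (fun y hy => ?_) hz n
  have hy0 : 0 ≤ y.1 := hy.1
  have := (h.periodic y.1 hy0).add_int m y.2
  simpa [Prod.add_def] using this

theorem fderivWithin_periodic (h : IsTestFunction T φ) {t : ℝ} (ht : 0 ≤ t) :
    TorusPeriodic fun x => fderivWithin ℝ φ (slab d) (t, x) := by
  intro x i
  have := fderivWithin_comp_add_right (𝕜 := ℝ) (s := slab d) (f := φ) (x := (t, x))
    (0, Pi.single i 2)
  rw [vadd_slab] at this
  have e : ((t, x) : ℝ × (Fin d → ℝ)) + (0, Pi.single i 2) = (t, x + Pi.single i 2) := by simp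
  rw [e] at this
  refine this.symm.trans (fderivWithin_congr (fun y hy => ?_) ?_)
  · have := h.periodic y.1 hy.1 y.2 i
    simpa [Prod.add_def] using this
  · rw [e]
    exact h.periodic t ht x i

theorem iteratedFDerivWithin_eq_zero (h : IsTestFunction T φ) :
    ∃ T', ∀ n, ∀ z ∈ slab d, T' < z.1 → iteratedFDerivWithin ℝ n φ (slab d) z = 0 := by
  obtain ⟨T', _, hT'⟩ := h.support
  refine ⟨T', fun n z hz hzT => ?_⟩
  have hzero : ∀ y ∈ slab d, T' < y.1 → φ y = 0 := fun y hy hyT => hT' y.1 hy.1 hyT.le y.2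
  have hev : φ =ᶠ[nhdsWithin z (slab d)] fun _ => 0 := by
    have : {y : ℝ × (Fin d → ℝ) | T' < y.1} ∈ nhds z :=
      (isOpen_lt continuous_const continuous_fst).mem_nhds hzT
    filter_upwards [self_mem_nhdsWithin, mem_nhdsWithin_of_mem_nhds this] with y hy hyT
    exact hzero y hy hyT
  rw [hev.iteratedFDerivWithin_eq (hzero z hz hzT), iteratedFDerivWithin_fun_zero, Pi.zero_apply]

/-- The supremum in the `C³` norm is finite: by periodicity and the compact support in time, the
derivatives are controlled by their values on a compact set. -/
theorem bddAbove (h : IsTestFunction T φ) : BddAbove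
    {r | ∃ j : ℕ, j ≤ 3 ∧ ∃ z ∈ slab d, r = ‖iteratedFDerivWithin ℝ j φ (slab d) z‖} := by
  obtain ⟨T', hT'⟩ := h.iteratedFDerivWithin_eq_zero
  have hK : IsCompact (Icc 0 T' ×ˢ torus d : Set (ℝ × (Fin d → ℝ))) :=
    isCompact_Icc.prod isCompact_Icc
  have hKs : (Icc 0 T' ×ˢ torus d : Set (ℝ × (Fin d → ℝ))) ⊆ slab d :=
    prod_mono Icc_subset_Ici_self (subset_univ _)
  have hb : ∀ j : ℕ, j ≤ 3 → ∃ C, ∀ z ∈ slab d, ‖iteratedFDerivWithin ℝ j φ (slab d) z‖ ≤ C := by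
    intro j hj
    obtain ⟨C, hC⟩ := hK.exists_bound_of_continuousOn
      ((h.contDiffOn.continuousOn_iteratedFDerivWithin (m := j) (by exact_mod_cast hj)
        uniqueDiffOn_slab).mono hKs)
    refine ⟨max C 0, fun z hz => ?_⟩
    rcases lt_or_ge T' z.1 with hzT | hzT
    · rw [hT' j z hz hzT, norm_zero]; exact le_max_right _ _
    · choose m hm _ using fun i =>
        existsUnique_add_zsmul_mem_Ico (two_pos (α := ℝ)) (z.2 i) (-1)
      rw [← h.iteratedFDerivWithin_add j hz m]
      refine (hC _ ⟨⟨?_, ?_⟩, ?_, ?_⟩).trans (le_max_left _ _)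
      · simpa using hz.1
      · simpa using hzT
      · intro i
        have := (hm i).1
        simp only [zsmul_eq_mul] at this
        simp only [Prod.snd_add, Pi.add_apply]
        linarith
      · intro i
        have := (hm i).2
        simp only [zsmul_eq_mul] at this
        simp only [Prod.snd_add, Pi.add_apply]
        linarith
  choose! C hC using hb
  refine ⟨∑ j ∈ Finset.range 4, |C j|, ?_⟩
  rintro _ ⟨j, hj, z, hz, rfl⟩
  exact (hC j hj z hz).trans ((le_abs_self _).trans
    (Finset.single_le_sum (f := fun j => |C j|) (fun j _ => abs_nonneg _)
      (Finset.mem_range.2 (by omega))))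

theorem norm_iteratedFDerivWithin_le (h : IsTestFunction T φ) {j : ℕ} (hj : j ≤ 3)
    {z : ℝ × (Fin d → ℝ)} (hz : z ∈ slab d) :
    ‖iteratedFDerivWithin ℝ j φ (slab d) z‖ ≤ c3Norm φ :=
  le_csSup h.bddAbove ⟨j, hj, z, hz, rfl⟩

theorem norm_fderivWithin_le (h : IsTestFunction T φ) {z : ℝ × (Fin d → ℝ)} (hz : z ∈ slab d) :
    ‖fderivWithin ℝ φ (slab d) z‖ ≤ c3Norm φ := by
  rw [← norm_iteratedFDerivWithin_one φ (uniqueDiffOn_slab z hz)]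
  exact h.norm_iteratedFDerivWithin_le (by norm_num) hz

theorem c3Norm_nonneg (h : IsTestFunction T φ) : 0 ≤ c3Norm φ :=
  (norm_nonneg _).trans (h.norm_fderivWithin_le (mk_mem_slab le_rfl 0))

theorem norm_sub_le (h : IsTestFunction T φ) {y z : ℝ × (Fin d → ℝ)} (hy : y ∈ slab d)
    (hz : z ∈ slab d) : ‖φ z - φ y‖ ≤ c3Norm φ * ‖z - y‖ :=
  convex_slab.norm_image_sub_le_of_norm_fderivWithin_le (𝕜 := ℝ)
    (h.contDiffOn.differentiableOn (by norm_num)) (fun _ hx => h.norm_fderivWithin_le hx) hy hz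

theorem norm_fderivWithin_sub_le (h : IsTestFunction T φ) {y z : ℝ × (Fin d → ℝ)}
    (hy : y ∈ slab d) (hz : z ∈ slab d) :
    ‖fderivWithin ℝ φ (slab d) z - fderivWithin ℝ φ (slab d) y‖ ≤ c3Norm φ * ‖z - y‖ := by
  refine convex_slab.norm_image_sub_le_of_norm_fderivWithin_le (𝕜 := ℝ) ?_ (fun x hx => ?_) hy hz
  · exact (h.contDiffOn.fderivWithin (m := 2) uniqueDiffOn_slab (by norm_num)).differentiableOn
      (by norm_num)
  · rw [← norm_iteratedFDerivWithin_one _ (uniqueDiffOn_slab x hx),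
      norm_iteratedFDerivWithin_fderivWithin uniqueDiffOn_slab hx]
    exact h.norm_iteratedFDerivWithin_le (by norm_num) hx

theorem norm_taylor_le (h : IsTestFunction T φ) {y z : ℝ × (Fin d → ℝ)} (hy : y ∈ slab d)
    (hz : z ∈ slab d) :
    ‖φ z - φ y - fderivWithin ℝ φ (slab d) y (z - y)‖ ≤ c3Norm φ * ‖z - y‖ ^ 2 := by
  have hs : segment ℝ y z ⊆ slab d := convex_slab.segment_subset hy hz
  rw [pow_two, ← mul_assoc]
  refine Convex.norm_image_sub_le_of_norm_hasFDerivWithin_le' (𝕜 := ℝ)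
    (f' := fderivWithin ℝ φ (slab d)) (fun x hx => ?_) (fun x hx => ?_)
    (convex_segment y z) (left_mem_segment ℝ y z) (right_mem_segment ℝ y z)
  · exact ((h.contDiffOn.differentiableOn (by norm_num) x (hs hx)).hasFDerivWithinAt).mono hs
  · refine (h.norm_fderivWithin_sub_le hy (hs hx)).trans ?_
    refine mul_le_mul_of_nonneg_left ?_ h.c3Norm_nonneg
    have := norm_sub_le_of_mem_segment hx
    rwa [norm_sub_rev] at this ⊢

end IsTestFunction

/-- A scalar test function `φ` with the properties the consistency estimate needs: `G` is its
derivative, extended continuously to the initial time, and `N` bounds the derivatives of the first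
two orders. -/
structure TestBounds (T N : ℝ) (φ : ℝ × (Fin d → ℝ) → ℝ)
    (G : ℝ × (Fin d → ℝ) → (ℝ × (Fin d → ℝ)) →L[ℝ] ℝ) : Prop where
  continuousOn : ContinuousOn φ (slab d)
  continuousOn_deriv : ContinuousOn G (slab d)
  periodic : ∀ t, 0 ≤ t → TorusPeriodic fun x => φ (t, x)
  periodic_deriv : ∀ t, 0 ≤ t → TorusPeriodic fun x => G (t, x)
  eq_zero : ∀ t, 0 ≤ t → T ≤ t → ∀ x, φ (t, x) = 0
  norm_deriv_le : ∀ z ∈ slab d, ‖G z‖ ≤ N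
  lipschitz : ∀ y ∈ slab d, ∀ z ∈ slab d, |φ z - φ y| ≤ N * ‖z - y‖
  taylor : ∀ y ∈ slab d, ∀ z ∈ slab d, |φ z - φ y - G y (z - y)| ≤ N * ‖z - y‖ ^ 2

/-- A continuous functional of norm at most `1`, in particular a component, turns a test function
into a scalar one. -/
theorem IsTestFunction.testBounds {T : ℝ} {φ : ℝ × (Fin d → ℝ) → F} (h : IsTestFunction T φ)
    (L : F →L[ℝ] ℝ) (hL : ∀ w, |L w| ≤ ‖w‖) :
    TestBounds T (c3Norm φ) (fun z => L (φ z))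
      (fun z => L ∘L fderivWithin ℝ φ (slab d) z) where
  continuousOn := L.continuous.comp_continuousOn h.contDiffOn.continuousOn
  continuousOn_deriv := continuousOn_const.clm_comp
    (h.contDiffOn.continuousOn_fderivWithin uniqueDiffOn_slab (by norm_num))
  periodic t ht x i := congrArg L (h.periodic t ht x i)
  periodic_deriv t ht x i := congrArg (fun A => L ∘L A) (h.fderivWithin_periodic ht x i)
  eq_zero t ht hT x := by
    obtain ⟨T', hT', h0⟩ := h.support
    rw [h0 t ht (hT'.le.trans hT), map_zero]
  norm_deriv_le z hz := by
    refine (ContinuousLinearMap.opNorm_le_bound _ (norm_nonneg _) fun w => ?_).trans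
      (h.norm_fderivWithin_le hz)
    exact (hL _).trans (ContinuousLinearMap.le_opNorm _ _)
  lipschitz y hy z hz := by
    rw [← map_sub]
    exact (hL _).trans (h.norm_sub_le hy hz)
  taylor y hy z hz := by
    rw [← map_sub, ContinuousLinearMap.comp_apply, ← map_sub]
    exact (hL _).trans (h.norm_taylor_le hy hz)

end EulerFV

/-! ### Moments of a test function over the space-time elements -/

namespace EulerFV

variable {d : ℕ}

/-- A function continuous on the slab extends to a continuous function, constant in time for
negative times. -/
theorem continuous_max_of_continuousOn_slab {f : ℝ × (Fin d → ℝ) → ℝ}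
    (hf : ContinuousOn f (slab d)) :
    Continuous fun z : ℝ × (Fin d → ℝ) => f (max z.1 0, z.2) :=
  hf.comp_continuous (by fun_prop) fun z => mk_mem_slab (le_max_right _ _) _

theorem continuous_slice {f : ℝ × (Fin d → ℝ) → ℝ} (hf : ContinuousOn f (slab d)) {t : ℝ}
    (ht : 0 ≤ t) : Continuous fun x => f (t, x) :=
  hf.comp_continuous (by fun_prop) fun z => mk_mem_slab ht _

namespace Mesh

variable (M : Mesh d)

/-- The integral of `f` over `[a, b] × K`. -/
noncomputable def stInt (a b : ℝ) (f : ℝ × (Fin d → ℝ) → ℝ) (K : M.Cell) : ℝ :=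
  ∫ t in a..b, ∫ x in M.cellSet K, f (t, x)

variable {M} {K : M.Cell} {a b : ℝ} {f g : ℝ × (Fin d → ℝ) → ℝ}

theorem integrableOn_slice (hf : ContinuousOn f (slab d)) {t : ℝ} (ht : 0 ≤ t) :
    IntegrableOn (fun x => f (t, x)) (M.cellSet K) :=
  (continuous_slice hf ht).continuousOn.integrableOn_compact (M.isCompact_cellSet K)

theorem intervalIntegrable_integral_cellSet (hf : ContinuousOn f (slab d)) (ha : 0 ≤ a)
    (hab : a ≤ b) :
    IntervalIntegrable (fun t => ∫ x in M.cellSet K, f (t, x)) volume a b := by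
  have h := continuous_parametric_integral_of_continuous (μ := volume)
    (f := fun t (x : Fin d → ℝ) => f (max t 0, x))
    (continuous_max_of_continuousOn_slab hf) (M.isCompact_cellSet K)
  refine (h.intervalIntegrable a b).congr fun t ht => ?_
  rw [uIoc_of_le hab] at ht
  simp only [max_eq_left (ha.trans ht.1.le)]

theorem stInt_add (hf : ContinuousOn f (slab d)) (hg : ContinuousOn g (slab d)) (ha : 0 ≤ a)
    (hab : a ≤ b) : M.stInt a b (fun z => f z + g z) K = M.stInt a b f K + M.stInt a b g K := by
  rw [stInt, stInt, stInt, ← intervalIntegral.integral_add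
    (intervalIntegrable_integral_cellSet hf ha hab)
    (intervalIntegrable_integral_cellSet hg ha hab)]
  refine intervalIntegral.integral_congr fun t ht => ?_
  rw [uIcc_of_le hab] at ht
  exact integral_add (integrableOn_slice hf (ha.trans ht.1))
    (integrableOn_slice hg (ha.trans ht.1))

theorem stInt_const_mul (c : ℝ) :
    M.stInt a b (fun z => c * f z) K = c * M.stInt a b f K := by
  simp only [stInt, integral_const_mul, intervalIntegral.integral_const_mul]

theorem stInt_sub (hf : ContinuousOn f (slab d)) (hg : ContinuousOn g (slab d)) (ha : 0 ≤ a)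
    (hab : a ≤ b) : M.stInt a b (fun z => f z - g z) K = M.stInt a b f K - M.stInt a b g K := by
  have := stInt_add (K := K) hf (g := fun z => -1 * g z) (continuousOn_const.mul hg) ha hab
  rw [stInt_const_mul] at this
  simpa [sub_eq_add_neg] using this

theorem stInt_sum {ι : Type*} (s : Finset ι) {f : ι → ℝ × (Fin d → ℝ) → ℝ}
    (hf : ∀ i, ContinuousOn (f i) (slab d)) (ha : 0 ≤ a) (hab : a ≤ b) :
    M.stInt a b (fun z => ∑ i ∈ s, f i z) K = ∑ i ∈ s, M.stInt a b (f i) K := by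
  classical
  induction s using Finset.induction_on with
  | empty => simp [stInt]
  | insert i s hi ih =>
    simp only [Finset.sum_insert hi]
    rw [stInt_add (hf i) (continuousOn_finsetSum s fun i _ => hf i) ha hab, ih]

theorem abs_stInt_le {C : ℝ} (ha : 0 ≤ a) (hab : a ≤ b)
    (h : ∀ t, 0 ≤ t → t ≤ b → ∀ x, |f (t, x)| ≤ C) :
    |M.stInt a b f K| ≤ M.cellVol * C * (b - a) := by
  have := intervalIntegral.norm_integral_le_of_norm_le_const (a := a) (b := b)
    (f := fun t => ∫ x in M.cellSet K, f (t, x)) (C := M.cellVol * C) fun t ht => by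
      rw [uIoc_of_le hab] at ht
      exact M.norm_integral_cellSet_le K fun x => h t (ha.trans ht.1.le) ht.2 x
  rwa [abs_of_nonneg (sub_nonneg.2 hab)] at this

theorem stInt_nbr (hper : ∀ t, 0 ≤ t → TorusPeriodic fun x => f (t, x)) (ha : 0 ≤ a)
    (hab : a ≤ b) (i : Fin d) (s : ℤ) :
    M.stInt a b f (M.nbr K i s)
      = M.stInt a b (fun z => f (z + (0, Pi.single i (s * M.edge i)))) K := by
  refine intervalIntegral.integral_congr fun t ht => ?_
  rw [uIcc_of_le hab] at ht
  simp only [M.integral_cellSet_nbr (hper t (ha.trans ht.1)), Prod.mk_add_mk, add_zero]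

theorem stInt_time_shift (c : ℝ) :
    M.stInt (a + c) (b + c) f K = M.stInt a b (fun z => f (z + (c, 0))) K := by
  rw [stInt, ← intervalIntegral.integral_comp_add_right]
  simp [stInt]

theorem add_space_mem_slab {z : ℝ × (Fin d → ℝ)} (hz : z ∈ slab d) (v : Fin d → ℝ) :
    z + (0, v) ∈ slab d := ⟨by simpa using hz.1, mem_univ _⟩

theorem add_time_mem_slab {z : ℝ × (Fin d → ℝ)} (hz : z ∈ slab d) {c : ℝ} (hc : 0 ≤ c) :
    z + (c, 0) ∈ slab d := ⟨add_nonneg hz.1 hc, mem_univ _⟩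

theorem norm_space (i : Fin d) (r : ℝ) :
    ‖((0, Pi.single i r) : ℝ × (Fin d → ℝ))‖ = |r| := by
  simp [Prod.norm_def, Pi.norm_single]

theorem norm_time (r : ℝ) : ‖((r, 0) : ℝ × (Fin d → ℝ))‖ = |r| := by
  simp [Prod.norm_def]

end Mesh

open Mesh

/-- The moments of a smooth test function satisfy the bounds required by the discrete
consistency estimate. -/
theorem TestBounds.momentBounds {T N : ℝ} {φ : ℝ × (Fin d → ℝ) → ℝ}
    {G : ℝ × (Fin d → ℝ) → (ℝ × (Fin d → ℝ)) →L[ℝ] ℝ} (h : TestBounds T N φ G) (M : Mesh d)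
    {Δt : ℝ} (hΔt : 0 < Δt) {n : ℕ} (hn : T ≤ n * Δt) :
    M.MomentBounds Δt N n (fun k K => M.stInt (k * Δt) ((k + 1 : ℕ) * Δt) φ K)
      (fun K => ∫ x in M.cellSet K, φ (0, x))
      (fun k K => M.stInt (k * Δt) ((k + 1 : ℕ) * Δt) (fun z => G z (1, 0)) K)
      (fun k i K => M.stInt (k * Δt) ((k + 1 : ℕ) * Δt) (fun z => G z (0, Pi.single i 1)) K) := by
  have hN : 0 ≤ N := (norm_nonneg _).trans (h.norm_deriv_le _ (mk_mem_slab le_rfl 0))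
  have hk0 : ∀ k : ℕ, 0 ≤ (k : ℝ) * Δt := fun k => by positivity
  have hk1 : ∀ k : ℕ, (k : ℝ) * Δt ≤ (k + 1 : ℕ) * Δt := fun k => by
    push_cast; nlinarith
  have hlen : ∀ k : ℕ, ((k + 1 : ℕ) : ℝ) * Δt - k * Δt = Δt := fun k => by push_cast; ring
  have hφ := h.continuousOn
  have hG : ∀ v, ContinuousOn (fun z => G z v) (slab d) := fun v =>
    h.continuousOn_deriv.clm_apply continuousOn_const
  have hsh : ∀ v, ContinuousOn (fun z => φ (z + (0, v))) (slab d) := fun v =>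
    hφ.comp (by fun_prop) fun z hz => add_space_mem_slab hz v
  have hts : ContinuousOn (fun z => φ (z + (Δt, 0))) (slab d) :=
    hφ.comp (by fun_prop) fun z hz => add_time_mem_slab hz hΔt.le
  have hlin : ∀ z i (r : ℝ), G z (0, Pi.single i r) = r * G z (0, Pi.single i 1) := fun z i r => by
    rw [← smul_eq_mul, ← map_smul, Prod.smul_mk, smul_zero, ← Pi.single_smul, smul_eq_mul, mul_one]
  -- first and second order expansions in a coordinate direction
  have tay : ∀ z ∈ slab d, ∀ i (r : ℝ),
      |φ (z + (0, Pi.single i r)) - φ z - r * G z (0, Pi.single i 1)| ≤ N * r ^ 2 := by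
    intro z hz i r
    have := h.taylor z hz _ (add_space_mem_slab hz (Pi.single i r))
    rwa [add_sub_cancel_left, norm_space, hlin, sq_abs] at this
  constructor
  · intro K
    have e : (∫ x in M.cellSet K, φ (0, x))
        = M.stInt (0 * Δt) (1 * Δt) (fun z => φ (0, z.2)) K / Δt := by
      simp [stInt, hΔt.ne']
    have hc : ContinuousOn (fun z : ℝ × (Fin d → ℝ) => φ (0, z.2)) (slab d) :=
      ((continuous_slice hφ le_rfl).comp continuous_snd).continuousOn
    simp only [Nat.cast_zero, zero_add, Nat.cast_one]
    rw [e, ← sub_div, ← stInt_sub hφ hc (by simp) (by simpa using hΔt.le), abs_div,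
      abs_of_pos hΔt, div_le_iff₀ hΔt]
    refine (abs_stInt_le (C := N * Δt) (by simp) (by simpa using hΔt.le) fun t ht htb x => ?_).trans
      (le_of_eq (by ring))
    refine (h.lipschitz _ (mk_mem_slab le_rfl x) _ (mk_mem_slab ht x)).trans ?_
    refine mul_le_mul_of_nonneg_left ?_ hN
    rw [Prod.mk_sub_mk, sub_self, norm_time, sub_zero, abs_of_nonneg ht]
    linarith
  · intro k K
    have e : M.stInt ((k + 1 : ℕ) * Δt) ((k + 1 + 1 : ℕ) * Δt) φ K
        = M.stInt (k * Δt) ((k + 1 : ℕ) * Δt) (fun z => φ (z + (Δt, 0))) K := by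
      rw [← stInt_time_shift]
      congr 1 <;> push_cast <;> ring
    have e2 : ∀ y : ℝ, y / Δt = Δt⁻¹ * y := fun y => by rw [div_eq_inv_mul]
    rw [e, ← stInt_sub hts hφ (hk0 k) (hk1 k), e2, ← stInt_const_mul,
      ← stInt_sub (hG _) (continuousOn_const.fun_mul (hts.fun_sub hφ)) (hk0 k) (hk1 k)]
    refine (abs_stInt_le (C := N * Δt) (hk0 k) (hk1 k) fun t ht htb x => ?_).trans
      (le_of_eq (by rw [hlen]; ring))
    have := h.taylor _ (mk_mem_slab ht x) _ (add_time_mem_slab (mk_mem_slab ht x) hΔt.le)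
    rw [add_sub_cancel_left, norm_time, sq_abs] at this
    have hl : G (t, x) (Δt, 0) = Δt * G (t, x) (1, 0) := by
      rw [← smul_eq_mul, ← map_smul, Prod.smul_mk, smul_zero, smul_eq_mul, mul_one]
    rw [hl] at this
    have e3 : G (t, x) (1, 0) - Δt⁻¹ * (φ ((t, x) + (Δt, 0)) - φ (t, x))
        = -(φ ((t, x) + (Δt, 0)) - φ (t, x) - Δt * G (t, x) (1, 0)) / Δt := by
      field_simp; ring
    rw [e3, abs_div, abs_neg, abs_of_pos hΔt, div_le_iff₀ hΔt]
    linarith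
  · intro k K i
    rw [stInt_nbr h.periodic (hk0 k) (hk1 k), ← stInt_sub (hsh _) hφ (hk0 k) (hk1 k)]
    refine (abs_stInt_le (C := N * M.edge i) (hk0 k) (hk1 k) fun t ht _ x => ?_).trans
      (le_of_eq (by rw [hlen]; ring))
    refine (h.lipschitz _ (mk_mem_slab ht x) _ (add_space_mem_slab (mk_mem_slab ht x) _)).trans
      (le_of_eq ?_)
    rw [add_sub_cancel_left, norm_space]
    simp [abs_of_pos (M.edge_pos i)]
  · intro k K i
    rw [stInt_nbr h.periodic (hk0 k) (hk1 k), stInt_nbr h.periodic (hk0 k) (hk1 k),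
      ← stInt_sub (hsh _) hφ (hk0 k) (hk1 k), ← stInt_sub hφ (hsh _) (hk0 k) (hk1 k),
      ← stInt_sub ((hsh _).fun_sub hφ) (hφ.fun_sub (hsh _)) (hk0 k) (hk1 k)]
    refine (abs_stInt_le (C := 2 * N * M.edge i ^ 2) (hk0 k) (hk1 k) fun t ht _ x => ?_).trans
      (le_of_eq (by rw [hlen]; ring))
    have t1 := abs_le.1 (tay _ (mk_mem_slab ht x) i ((1 : ℤ) * M.edge i))
    have t2 := abs_le.1 (tay _ (mk_mem_slab ht x) i ((-1 : ℤ) * M.edge i))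
    push_cast at t1 t2 ⊢
    rw [abs_le]
    constructor <;> linarith
  · intro k K i
    have e2 : ∀ y : ℝ, y / 2 = 2⁻¹ * y := fun y => by rw [div_eq_inv_mul]
    rw [stInt_nbr h.periodic (hk0 k) (hk1 k), stInt_nbr h.periodic (hk0 k) (hk1 k),
      ← stInt_sub (hsh _) (hsh _) (hk0 k) (hk1 k), e2, ← stInt_const_mul, ← stInt_const_mul,
      ← stInt_sub (continuousOn_const.fun_mul ((hsh _).fun_sub (hsh _)))
        (continuousOn_const.fun_mul (hG _))
        (hk0 k) (hk1 k)]
    refine (abs_stInt_le (C := N * M.edge i ^ 2) (hk0 k) (hk1 k) fun t ht _ x => ?_).trans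
      (le_of_eq (by rw [hlen]; ring))
    have t1 := abs_le.1 (tay _ (mk_mem_slab ht x) i ((1 : ℤ) * M.edge i))
    have t2 := abs_le.1 (tay _ (mk_mem_slab ht x) i ((-1 : ℤ) * M.edge i))
    push_cast at t1 t2 ⊢
    rw [abs_le]
    constructor <;> linarith
  · intro k i K
    refine (abs_stInt_le (C := N) (hk0 k) (hk1 k) fun t ht _ x => ?_).trans
      (le_of_eq (by rw [hlen]))
    rw [← Real.norm_eq_abs]
    refine ((G (t, x)).le_opNorm _).trans ?_
    rw [norm_space, abs_one, mul_one]
    exact h.norm_deriv_le _ (mk_mem_slab ht x)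
  · intro K
    have : M.stInt (n * Δt) ((n + 1 : ℕ) * Δt) φ K
        = M.stInt (n * Δt) ((n + 1 : ℕ) * Δt) (fun _ => 0) K := by
      refine intervalIntegral.integral_congr fun t ht => ?_
      rw [uIcc_of_le (hk1 n)] at ht
      simp only [h.eq_zero t ((hk0 n).trans ht.1) (hn.trans ht.1)]
    rw [this]
    simp [stInt]

end EulerFV

/-! ### The terms of the consistency formulation as sums over space-time elements -/

namespace EulerFV

open Mesh

variable {d : ℕ}

theorem inTime_eq {V : Type*} {Δt : ℝ} (hΔt : 0 < Δt) (v : ℕ → V) {k : ℕ} {t : ℝ}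
    (ht : t ∈ Ioo (k * Δt) ((k + 1 : ℕ) * Δt)) : inTime Δt v t = v k := by
  rw [inTime]
  congr 1
  rw [Nat.floor_eq_iff (div_nonneg (le_trans (by positivity) ht.1.le) hΔt.le),
    le_div_iff₀ hΔt, div_lt_iff₀ hΔt]
  exact ⟨ht.1.le, by exact_mod_cast ht.2⟩

theorem intervalIntegrable_sum {ι : Type*} (s : Finset ι) {f : ι → ℝ → ℝ} {a b : ℝ}
    (h : ∀ i, IntervalIntegrable (f i) volume a b) :
    IntervalIntegrable (fun t => ∑ i ∈ s, f i t) volume a b := by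
  simpa only [Finset.sum_fn] using IntervalIntegrable.sum s fun i _ => h i

/-- Splitting of a time integral into the time steps. Only the interior of the steps matters, which
excludes the initial time, where the two-sided derivatives of a test function have no meaning. -/
theorem integral_time_steps {Δt : ℝ} (hΔt : 0 < Δt) (n : ℕ) {f : ℝ → ℝ} {g : ℕ → ℝ → ℝ}
    (hg : ∀ k : ℕ, IntervalIntegrable (g k) volume (k * Δt) ((k + 1 : ℕ) * Δt))
    (hfg : ∀ k : ℕ, ∀ t ∈ Ioo (k * Δt) ((k + 1 : ℕ) * Δt), f t = g k t) :
    ∫ t in (0 : ℝ)..(n * Δt), f t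
      = ∑ k ∈ Finset.range n, ∫ t in (k * Δt)..((k + 1 : ℕ) * Δt), g k t := by
  have hk : ∀ k : ℕ, (k : ℝ) * Δt ≤ (k + 1 : ℕ) * Δt := fun k => by push_cast; nlinarith
  have heq : ∀ k : ℕ, EqOn (g k) f (uIoo (k * Δt) ((k + 1 : ℕ) * Δt)) := fun k t ht =>
    (hfg k t (by rwa [uIoo_of_le (hk k)] at ht)).symm
  have := intervalIntegral.sum_integral_adjacent_intervals (n := n) (f := f) (μ := volume)
    (a := fun k : ℕ => (k : ℝ) * Δt) fun k _ => (hg k).congr_uIoo (heq k)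
  rw [Nat.cast_zero, zero_mul] at this
  rw [← this]
  exact Finset.sum_congr rfl fun k _ => (intervalIntegral.integral_congr_uIoo (heq k)).symm

/-- Space-time integrals of functions that are continuous on every space-time element. -/
theorem Mesh.integral_time_torus (M : Mesh d) {Δt : ℝ} (hΔt : 0 < Δt) (n : ℕ)
    {f : ℝ → (Fin d → ℝ) → ℝ} {g : ℕ → M.Cell → ℝ × (Fin d → ℝ) → ℝ}
    (hg : ∀ k K, ContinuousOn (g k K) (slab d))
    (hper : ∀ k : ℕ, ∀ t ∈ Ioo (k * Δt) ((k + 1 : ℕ) * Δt), TorusPeriodic (f t))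
    (hfg : ∀ k : ℕ, ∀ t ∈ Ioo (k * Δt) ((k + 1 : ℕ) * Δt), ∀ x,
      f t x = g k (M.cellIndex x) (t, x)) :
    ∫ t in (0 : ℝ)..(n * Δt), ∫ x in torus d, f t x
      = ∑ k ∈ Finset.range n, ∑ K, M.stInt (k * Δt) ((k + 1 : ℕ) * Δt) (g k K) K := by
  have hk0 : ∀ k : ℕ, 0 ≤ (k : ℝ) * Δt := fun k => by positivity
  have hk : ∀ k : ℕ, (k : ℝ) * Δt ≤ (k + 1 : ℕ) * Δt := fun k => by push_cast; nlinarith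
  have hint : ∀ k K, IntervalIntegrable (fun t => ∫ x in M.cellSet K, g k K (t, x)) volume
      (k * Δt) ((k + 1 : ℕ) * Δt) := fun k K =>
    intervalIntegrable_integral_cellSet (hg k K) (hk0 k) (hk k)
  rw [integral_time_steps hΔt n (g := fun k t => ∑ K, ∫ x in M.cellSet K, g k K (t, x))]
  · refine Finset.sum_congr rfl fun k _ => ?_
    rw [intervalIntegral.integral_finsetSum fun K _ => hint k K]
    rfl
  · exact fun k => intervalIntegrable_sum _ (hint k)
  · intro k t ht
    exact M.integral_torus (hper k t ht) (hfg k t ht) fun K =>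
      integrableOn_slice (hg k K) ((hk0 k).trans ht.1.le)

theorem Mesh.eval_periodic (M : Mesh d) {F : Type*} (v : M.Cell → F) :
    TorusPeriodic (M.eval v) :=
  fun x i => congrArg v (M.cellIndex_periodic x i)

section TestFunction

variable {F : Type*} [NormedAddCommGroup F] [NormedSpace ℝ F] {T : ℝ}
  {φ : ℝ × (Fin d → ℝ) → F}

theorem fderiv_eq_fderivWithin_slab (φ : ℝ × (Fin d → ℝ) → F) {t : ℝ} (ht : 0 < t)
    (x : Fin d → ℝ) : fderiv ℝ φ (t, x) = fderivWithin ℝ φ (slab d) (t, x) :=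
  (fderivWithin_of_mem_nhds (slab_mem_nhds ht x)).symm

theorem IsTestFunction.dt_periodic (h : IsTestFunction T φ) {t : ℝ} (ht : 0 < t) :
    TorusPeriodic (dt φ t) := fun x i => by
  simp only [dt, fderiv_eq_fderivWithin_slab φ ht]
  exact congrArg (fun A => A (1, 0)) (h.fderivWithin_periodic ht.le x i)

theorem IsTestFunction.dx_periodic (h : IsTestFunction T φ) {t : ℝ} (ht : 0 < t) (j : Fin d) :
    TorusPeriodic (dx j φ t) := fun x i => by
  simp only [dx, fderiv_eq_fderivWithin_slab φ ht]
  exact congrArg (fun A => A (0, Pi.single j 1)) (h.fderivWithin_periodic ht.le x i)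

end TestFunction

/-- The integral over the space-time element `[k Δt, (k+1) Δt] × K` of the convective terms for the
conserved quantity `r`, the velocity `v` and the pressure `p` in the direction `j`. -/
theorem Mesh.stInt_convective (M : Mesh d)
    {G : ℝ × (Fin d → ℝ) → (ℝ × (Fin d → ℝ)) →L[ℝ] ℝ} (hG : ContinuousOn G (slab d))
    {a b : ℝ} (ha : 0 ≤ a) (hab : a ≤ b) (r p : ℝ) (v : Fin d → ℝ) (j : Fin d) (K : M.Cell) :
    M.stInt a b (fun z => r * G z (1, 0)
        + (∑ i, r * v i * G z (0, Pi.single i 1) + p * G z (0, Pi.single j 1))) K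
      = r * M.stInt a b (fun z => G z (1, 0)) K
        + (∑ i, r * v i * M.stInt a b (fun z => G z (0, Pi.single i 1)) K
          + p * M.stInt a b (fun z => G z (0, Pi.single j 1)) K) := by
  have h : ∀ v, ContinuousOn (fun z => G z v) (slab d) := fun v =>
    hG.clm_apply continuousOn_const
  have hc : ∀ (c : ℝ) v, ContinuousOn (fun z => c * G z v) (slab d) := fun c v =>
    continuousOn_const.fun_mul (h v)
  have hs : ContinuousOn (fun z => ∑ i, r * v i * G z (0, Pi.single i 1)) (slab d) :=
    continuousOn_finsetSum _ fun i _ => hc _ _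
  rw [stInt_add (hc _ _) (hs.fun_add (hc _ _)) ha hab, stInt_add hs (hc _ _) ha hab,
    stInt_sum _ (fun i => hc _ _) ha hab]
  simp only [stInt_const_mul]

theorem continuousOn_convective {G : ℝ × (Fin d → ℝ) → (ℝ × (Fin d → ℝ)) →L[ℝ] ℝ}
    (hG : ContinuousOn G (slab d)) (r p : ℝ) (v : Fin d → ℝ) (j : Fin d) :
    ContinuousOn (fun z => r * G z (1, 0)
        + (∑ i, r * v i * G z (0, Pi.single i 1) + p * G z (0, Pi.single j 1))) (slab d) := by
  have hc : ∀ (c : ℝ) v, ContinuousOn (fun z => c * G z v) (slab d) := fun c v =>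
    continuousOn_const.fun_mul (hG.clm_apply continuousOn_const)
  exact (hc _ _).fun_add ((continuousOn_finsetSum _ fun i _ => hc _ _).fun_add (hc _ _))

theorem densityForm_eq (M : Mesh d) {T T' Δt : ℝ} (hΔt : 0 < Δt) (n : ℕ)
    (hT : T' = n * Δt) (ρ : ℕ → M.Cell → ℝ) (u : ℕ → M.Cell → Fin d → ℝ)
    {φ : ℝ × (Fin d → ℝ) → ℝ} (h : IsTestFunction T φ) (j : Fin d) :
    densityForm M T' Δt ρ u φ = ∑ k ∈ Finset.range n, ∑ K,
      (ρ k K * M.stInt (k * Δt) ((k + 1 : ℕ) * Δt)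
          (fun z => (ContinuousLinearMap.id ℝ ℝ ∘L fderivWithin ℝ φ (slab d) z) (1, 0)) K
        + (∑ i, ρ k K * u k K i * M.stInt (k * Δt) ((k + 1 : ℕ) * Δt)
          (fun z => (ContinuousLinearMap.id ℝ ℝ ∘L fderivWithin ℝ φ (slab d) z)
            (0, Pi.single i 1)) K
          + 0 * M.stInt (k * Δt) ((k + 1 : ℕ) * Δt)
          (fun z => (ContinuousLinearMap.id ℝ ℝ ∘L fderivWithin ℝ φ (slab d) z)
            (0, Pi.single j 1)) K)) := by
  have hG := (h.testBounds (ContinuousLinearMap.id ℝ ℝ) fun w => le_rfl).continuousOn_deriv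
  have hk0 : ∀ k : ℕ, 0 ≤ (k : ℝ) * Δt := fun k => by positivity
  have hk : ∀ k : ℕ, (k : ℝ) * Δt ≤ (k + 1 : ℕ) * Δt := fun k => by push_cast; nlinarith
  rw [densityForm, hT, M.integral_time_torus hΔt n
    (fun k K => continuousOn_convective hG (ρ k K) 0 (u k K) j)]
  · exact Finset.sum_congr rfl fun k _ => Finset.sum_congr rfl fun K _ =>
      M.stInt_convective hG (hk0 k) (hk k) _ _ _ _ _
  · intro k t ht x i
    have ht0 : 0 < t := (hk0 k).trans_lt ht.1
    simp only [M.eval_periodic _ x i, h.dt_periodic ht0 x i, h.dx_periodic ht0 _ x i]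
  · intro k t ht x
    have ht0 : 0 < t := (hk0 k).trans_lt ht.1
    simp only [inTime_eq hΔt _ ht, dt, dx, fderiv_eq_fderivWithin_slab φ ht0, eval, zero_mul,
      add_zero]
    rfl

/-- The derivative of the `j`-th component of a vector-valued test function. -/
noncomputable def componentDeriv (φ : ℝ × (Fin d → ℝ) → Fin d → ℝ) (j : Fin d)
    (z : ℝ × (Fin d → ℝ)) : (ℝ × (Fin d → ℝ)) →L[ℝ] ℝ :=
  ContinuousLinearMap.proj (R := ℝ) (φ := fun _ : Fin d => ℝ) j ∘L fderivWithin ℝ φ (slab d) z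

/-- The components of a vector-valued test function obey its `C³` norm, since `Fin d → ℝ` carries
the supremum norm. -/
theorem IsTestFunction.component {T : ℝ} {φ : ℝ × (Fin d → ℝ) → Fin d → ℝ}
    (h : IsTestFunction T φ) (j : Fin d) :
    TestBounds T (c3Norm φ) (fun z => φ z j) (componentDeriv φ j) :=
  h.testBounds (ContinuousLinearMap.proj (R := ℝ) (φ := fun _ : Fin d => ℝ) j)
    fun w => norm_le_pi_norm w j

theorem momentumForm_eq (M : Mesh d) {a γ T T' Δt : ℝ} (hΔt : 0 < Δt) (n : ℕ)
    (hT : T' = n * Δt) (ρ : ℕ → M.Cell → ℝ) (u : ℕ → M.Cell → Fin d → ℝ)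
    {φ : ℝ × (Fin d → ℝ) → Fin d → ℝ} (h : IsTestFunction T φ) :
    momentumForm M a γ T' Δt ρ u φ = ∑ j, ∑ k ∈ Finset.range n, ∑ K,
      (ρ k K * u k K j * M.stInt (k * Δt) ((k + 1 : ℕ) * Δt)
          (fun z => componentDeriv φ j z (1, 0)) K
        + (∑ i, ρ k K * u k K j * u k K i * M.stInt (k * Δt) ((k + 1 : ℕ) * Δt)
          (fun z => componentDeriv φ j z (0, Pi.single i 1)) K
          + pressure a γ (ρ k K) * M.stInt (k * Δt) ((k + 1 : ℕ) * Δt)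
          (fun z => componentDeriv φ j z (0, Pi.single j 1)) K)) := by
  have hG := fun j => (h.component j).continuousOn_deriv
  have hk0 : ∀ k : ℕ, 0 ≤ (k : ℝ) * Δt := fun k => by positivity
  have hk : ∀ k : ℕ, (k : ℝ) * Δt ≤ (k + 1 : ℕ) * Δt := fun k => by push_cast; nlinarith
  have hc := fun (k : ℕ) (K : M.Cell) (j : Fin d) => continuousOn_convective (hG j)
    (ρ k K * u k K j) (pressure a γ (ρ k K)) (u k K) j
  rw [momentumForm, hT, M.integral_time_torus hΔt n
    (g := fun k K z => ∑ j, (ρ k K * u k K j * componentDeriv φ j z (1, 0)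
        + (∑ i, ρ k K * u k K j * u k K i * componentDeriv φ j z (0, Pi.single i 1)
          + pressure a γ (ρ k K) * componentDeriv φ j z (0, Pi.single j 1))))
    (fun k K => continuousOn_finsetSum Finset.univ fun j _ => hc k K j)]
  · conv_rhs => rw [Finset.sum_comm]
    refine Finset.sum_congr rfl fun k _ => ?_
    conv_rhs => rw [Finset.sum_comm]
    refine Finset.sum_congr rfl fun K _ => ?_
    rw [stInt_sum Finset.univ (hc k K) (hk0 k) (hk k)]
    exact Finset.sum_congr rfl fun j _ => M.stInt_convective (hG j) (hk0 k) (hk k) _ _ _ _ _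
  · intro k t ht x i
    have ht0 : 0 < t := (hk0 k).trans_lt ht.1
    simp only [M.eval_periodic _ x i, h.dt_periodic ht0 x i, h.dx_periodic ht0 _ x i]
  · intro k t ht x
    have ht0 : 0 < t := (hk0 k).trans_lt ht.1
    simp only [inTime_eq hΔt _ ht, dt, dx, fderiv_eq_fderivWithin_slab φ ht0, eval,
      Finset.sum_add_distrib, Finset.mul_sum, ← add_assoc]
    rfl

theorem integral_eval_mul (M : Mesh d) {f : (Fin d → ℝ) → ℝ} (hf : TorusPeriodic f)
    (hc : Continuous f) (v : M.Cell → ℝ) :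
    ∫ x in torus d, M.eval v x * f x = ∑ K, v K * ∫ x in M.cellSet K, f x := by
  rw [M.integral_torus (g := fun K x => v K * f x)]
  · simp only [integral_const_mul]
  · intro x i
    simp only [M.eval_periodic v x i, hf x i]
  · exact fun x => rfl
  · exact fun K => (hc.continuousOn.integrableOn_compact (M.isCompact_cellSet K)).const_mul _

theorem integral_eval_momentum (M : Mesh d) {T : ℝ} {φ : ℝ × (Fin d → ℝ) → Fin d → ℝ}
    (h : IsTestFunction T φ) (r : M.Cell → ℝ) (v : M.Cell → Fin d → ℝ) :
    ∫ x in torus d, ∑ i, M.eval r x * M.eval v x i * φ (0, x) i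
      = ∑ j, ∑ K, r K * v K j * ∫ x in M.cellSet K, φ (0, x) j := by
  have hc : ∀ j K, IntegrableOn (fun x => φ (0, x) j) (M.cellSet K) := fun j K =>
    integrableOn_slice (h.component j).continuousOn le_rfl
  rw [M.integral_torus (g := fun K x => ∑ i, r K * v K i * φ (0, x) i), Finset.sum_comm]
  · refine Finset.sum_congr rfl fun K _ => ?_
    rw [integral_finsetSum _ fun j _ => (hc j K).const_mul _]
    simp only [integral_const_mul]
  · intro x i
    have := h.periodic 0 le_rfl x i
    simp only at this
    simp only [M.eval_periodic _ x i, this]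
  · exact fun x => rfl
  · exact fun K => integrable_finsetSum _ fun j _ => (hc j K).const_mul _

/-- The numerical diffusion in terms of the time-averaged moments with which the scheme is
tested. -/
theorem diffusionTerm_eq (M : Mesh d) {β T T' Δt : ℝ} (hΔt : 0 < Δt) (n : ℕ)
    (hT : T' = n * Δt) (u : ℕ → M.Cell → Fin d → ℝ)
    {φ : ℝ × (Fin d → ℝ) → Fin d → ℝ} (h : IsTestFunction T φ) :
    diffusionTerm M β T' Δt u φ = ∑ j, -(M.h ^ β * ∑ k ∈ Finset.range n, ∑ K, ∑ i,
      M.faceArea i * (M.faceJump (fun L => u k L j) K i 1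
        * (M.stInt (k * Δt) ((k + 1 : ℕ) * Δt) (fun z => φ z j) (M.nbr K i 1) / M.cellVol
          - M.stInt (k * Δt) ((k + 1 : ℕ) * Δt) (fun z => φ z j) K / M.cellVol))) := by
  have hk0 : ∀ k : ℕ, 0 ≤ (k : ℝ) * Δt := fun k => by positivity
  have hk : ∀ k : ℕ, (k : ℝ) * Δt ≤ (k + 1 : ℕ) * Δt := fun k => by push_cast; nlinarith
  have hint : ∀ (k : ℕ) K j, IntervalIntegrable (fun t => ∫ x in M.cellSet K, φ (t, x) j) volume
      (k * Δt) ((k + 1 : ℕ) * Δt) := fun k K j =>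
    intervalIntegrable_integral_cellSet (h.component j).continuousOn (hk0 k) (hk k)
  have hint' : ∀ (k : ℕ) K j i, IntervalIntegrable (fun t => (M.faceArea i
      * M.faceJump (fun L => u k L j) K i 1 / M.cellVol)
        * ((∫ x in M.cellSet (M.nbr K i 1), φ (t, x) j) - ∫ x in M.cellSet K, φ (t, x) j)) volume
      (k * Δt) ((k + 1 : ℕ) * Δt) := fun k K j i =>
    ((hint k _ j).sub (hint k _ j)).const_mul _
  rw [diffusionTerm, hT, integral_time_steps hΔt n (g := fun k t => ∑ K, ∑ i, ∑ j, (M.faceArea i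
      * M.faceJump (fun L => u k L j) K i 1 / M.cellVol)
        * ((∫ x in M.cellSet (M.nbr K i 1), φ (t, x) j) - ∫ x in M.cellSet K, φ (t, x) j))]
  · rw [Finset.sum_neg_distrib, ← Finset.mul_sum, ← neg_mul]
    congr 1
    rw [Finset.sum_comm]
    refine Finset.sum_congr rfl fun k _ => ?_
    rw [Finset.sum_comm, intervalIntegral.integral_finsetSum]
    · refine Finset.sum_congr rfl fun K _ => ?_
      rw [Finset.sum_comm, intervalIntegral.integral_finsetSum]
      · refine Finset.sum_congr rfl fun i _ => ?_
        rw [intervalIntegral.integral_finsetSum fun j _ => hint' k K j i]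
        refine Finset.sum_congr rfl fun j _ => ?_
        rw [intervalIntegral.integral_const_mul,
          intervalIntegral.integral_sub (hint k _ j) (hint k _ j), stInt, stInt]
        ring
      · exact fun i _ => intervalIntegrable_sum _ fun j => hint' k K j i
    · exact fun K _ => intervalIntegrable_sum _ fun i => intervalIntegrable_sum _ fun j =>
        hint' k K j i
  · exact fun k => intervalIntegrable_sum _ fun K => intervalIntegrable_sum _ fun i =>
      intervalIntegrable_sum _ fun j => hint' k K j i
  · intro k t ht
    have ht0 : 0 ≤ t := (hk0 k).trans ht.1.le
    have hproj : ∀ L j, M.proj (fun x => φ (t, x)) L j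
        = M.cellVol⁻¹ * ∫ x in M.cellSet L, φ (t, x) j := fun L j => by
      rw [proj, Pi.smul_apply, smul_eq_mul, eval_integral fun i =>
        integrableOn_slice (h.component i).continuousOn ht0]
    simp only [inTime_eq hΔt _ ht, Finset.mul_sum]
    refine Finset.sum_congr rfl fun K _ => Finset.sum_congr rfl fun i _ =>
      Finset.sum_congr rfl fun j _ => ?_
    simp only [faceJump, hproj]
    ring

end EulerFV

/-! ### A priori bounds and the size of the consistency errors -/

namespace EulerFV

open Mesh

variable {d : ℕ} {M : Mesh d} {a γ κ α β Δt : ℝ} {n : ℕ}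

theorem Mesh.energy_eq (M : Mesh d) (a γ : ℝ) (ρ : M.Cell → ℝ) (u : M.Cell → Fin d → ℝ) :
    M.energy a γ ρ u = ∑ K, M.cellVol * energyDensity a γ (ρ K) (u K) := by
  rw [energy, M.integral_torus (g := fun K _ => energyDensity a γ (ρ K) (u K))]
  · simp [M.measureReal_cellSet]
  · intro x i
    simp only [M.eval_periodic _ x i]
  · exact fun x => rfl
  · exact fun K => integrableOn_const (M.isCompact_cellSet K).measure_lt_top.ne

theorem energyDensity_nonneg (ha : 0 < a) (hγ : 1 < γ) {r : ℝ} (hr : 0 ≤ r) (v : Fin d → ℝ) :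
    0 ≤ energyDensity a γ r v := by
  have := sub_pos.2 hγ
  have := Finset.sum_nonneg fun j (_ : j ∈ Finset.univ) => sq_nonneg (v j)
  unfold energyDensity
  positivity

theorem Mesh.dissipation_nonneg (hκ : 0 < κ) {ρ : M.Cell → ℝ} (u : M.Cell → Fin d → ℝ)
    (hρ : ∀ K, 0 ≤ ρ K) : 0 ≤ M.dissipation κ α β ρ u := by
  refine Finset.sum_nonneg fun K _ => Finset.sum_nonneg fun i _ => ?_
  have := (M.faceArea_pos i).le
  have := hρ K
  have := hρ (M.nbr K i 1)
  have := M.h_pos.le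
  have := Finset.sum_nonneg fun j (_ : j ∈ Finset.univ) => sq_nonneg (u (M.nbr K i 1) j - u K j)
  positivity

theorem IsNumericalSolution.density_nonneg {ρ₀ : (Fin d → ℝ) → ℝ} {u₀ : (Fin d → ℝ) → Fin d → ℝ}
    {ρ : ℕ → M.Cell → ℝ} {u : ℕ → M.Cell → Fin d → ℝ}
    (h : IsNumericalSolution M a γ κ α β Δt n ρ₀ u₀ ρ u) (hκ : 0 < κ) (hΔt : 0 < Δt)
    (h0 : ∀ K, 0 ≤ ρ 0 K) : ∀ k ≤ n, ∀ K, 0 ≤ ρ k K := by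
  intro k
  induction k with
  | zero => exact fun _ => h0
  | succ k ih =>
    intro hk
    exact M.density_step_nonneg hκ hΔt (h.density (k + 1) (Finset.mem_Icc.2 ⟨by omega, hk⟩))
      (ih (by omega))

/-- The energy at any time, together with the dissipation up to that time, is at most the initial
energy. -/
theorem IsNumericalSolution.energy_le {ρ₀ : (Fin d → ℝ) → ℝ} {u₀ : (Fin d → ℝ) → Fin d → ℝ}
    {ρ : ℕ → M.Cell → ℝ} {u : ℕ → M.Cell → Fin d → ℝ}
    (h : IsNumericalSolution M a γ κ α β Δt n ρ₀ u₀ ρ u) (ha : 0 < a) (hγ : 1 < γ) (hκ : 0 < κ)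
    (hΔt : 0 < Δt) (h0 : ∀ K, 0 ≤ ρ 0 K) : ∀ k ≤ n,
    ∑ K, M.cellVol * energyDensity a γ (ρ k K) (u k K)
        + Δt * ∑ l ∈ Finset.range k, M.dissipation κ α β (ρ (l + 1)) (u (l + 1))
      ≤ M.energy a γ (ρ 0) (u 0) := by
  have hρ := h.density_nonneg hκ hΔt h0
  intro k
  induction k with
  | zero => simp [M.energy_eq]
  | succ k ih =>
    intro hk
    have hmem : k + 1 ∈ Finset.Icc 1 n := Finset.mem_Icc.2 ⟨by omega, hk⟩
    have := M.energy_step ha hγ hκ hΔt (β := β) (u' := u k) (hρ (k + 1) hk) (hρ k (by omega))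
      (h.density (k + 1) hmem) (h.momentum (k + 1) hmem)
    rw [Finset.sum_range_succ, mul_add]
    linarith [ih (by omega)]

/-- The bounds on a discrete solution that follow from its initial energy; `S` bounds the energy and
`m` the mass. -/
structure APrioriBounds (M : Mesh d) (κ α β Δt S m : ℝ) (n : ℕ) (ρ : ℕ → M.Cell → ℝ)
    (u : ℕ → M.Cell → Fin d → ℝ) : Prop where
  nonneg : ∀ k ≤ n, ∀ K, 0 ≤ ρ k K
  mass : ∀ k ≤ n, ∑ K, M.cellVol * ρ k K ≤ m
  kinetic : ∀ k ≤ n, ∑ K, M.cellVol * (ρ k K * ∑ j, u k K j ^ 2) ≤ 2 * S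
  dissipation : Δt * ∑ k ∈ Finset.range n, M.dissipation κ α β (ρ (k + 1)) (u (k + 1)) ≤ S

section Solution

variable {ρ₀ : (Fin d → ℝ) → ℝ} {u₀ : (Fin d → ℝ) → Fin d → ℝ}
    {ρ : ℕ → M.Cell → ℝ} {u : ℕ → M.Cell → Fin d → ℝ} {S : ℝ}

theorem IsNumericalSolution.sum_energyDensity_le
    (h : IsNumericalSolution M a γ κ α β Δt n ρ₀ u₀ ρ u) (ha : 0 < a) (hγ : 1 < γ) (hκ : 0 < κ)
    (hΔt : 0 < Δt) (h0 : ∀ K, 0 ≤ ρ 0 K) (hS : M.energy a γ (ρ 0) (u 0) ≤ S) {k : ℕ}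
    (hk : k ≤ n) : ∑ K, M.cellVol * energyDensity a γ (ρ k K) (u k K) ≤ S := by
  have hρ := h.density_nonneg hκ hΔt h0
  have h1 := h.energy_le ha hγ hκ hΔt h0 k hk
  have h2 : 0 ≤ Δt * ∑ l ∈ Finset.range k, M.dissipation κ α β (ρ (l + 1)) (u (l + 1)) :=
    mul_nonneg hΔt.le (Finset.sum_nonneg fun l hl =>
      Mesh.dissipation_nonneg hκ _ (hρ _ (by have := Finset.mem_range.1 hl; omega)))
  linarith

theorem IsNumericalSolution.sum_rpow_le
    (h : IsNumericalSolution M a γ κ α β Δt n ρ₀ u₀ ρ u) (ha : 0 < a) (hγ : 1 < γ) (hκ : 0 < κ)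
    (hΔt : 0 < Δt) (h0 : ∀ K, 0 ≤ ρ 0 K) (hS : M.energy a γ (ρ 0) (u 0) ≤ S) {k : ℕ}
    (hk : k ≤ n) : ∑ K, M.cellVol * (a * ρ k K ^ γ) ≤ (γ - 1) * S := by
  have hg := sub_pos.2 hγ
  refine le_trans ?_ (mul_le_mul_of_nonneg_left
    (h.sum_energyDensity_le ha hγ hκ hΔt h0 hS hk) hg.le)
  rw [Finset.mul_sum]
  refine Finset.sum_le_sum fun K _ => ?_
  have hV := M.cellVol_pos
  have hρ := h.density_nonneg hκ hΔt h0 k hk K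
  have e : (γ - 1) * (M.cellVol * energyDensity a γ (ρ k K) (u k K))
      = M.cellVol * (a * ρ k K ^ γ)
        + (γ - 1) * M.cellVol * (1 / 2 * ρ k K * ∑ j, u k K j ^ 2) := by
    unfold energyDensity; field_simp; ring
  rw [e]
  have := Finset.sum_nonneg fun j (_ : j ∈ Finset.univ) => sq_nonneg (u k K j)
  have : 0 ≤ (γ - 1) * M.cellVol * (1 / 2 * ρ k K * ∑ j, u k K j ^ 2) := by positivity
  linarith

theorem IsNumericalSolution.aPrioriBounds
    (h : IsNumericalSolution M a γ κ α β Δt n ρ₀ u₀ ρ u) (ha : 0 < a) (hγ : 1 < γ) (hκ : 0 < κ)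
    (hΔt : 0 < Δt) (h0 : ∀ K, 0 ≤ ρ 0 K) (hS : M.energy a γ (ρ 0) (u 0) ≤ S) :
    APrioriBounds M κ α β Δt S (2 ^ d + (γ - 1) * S / a) n ρ u where
  nonneg := h.density_nonneg hκ hΔt h0
  mass k hk := by
    have hρ := h.density_nonneg hκ hΔt h0 k hk
    have h1 := h.sum_rpow_le ha hγ hκ hΔt h0 hS hk
    have h2 : ∑ K, M.cellVol * ρ k K ≤ ∑ K, (M.cellVol + M.cellVol * (a * ρ k K ^ γ) / a) := by
      refine Finset.sum_le_sum fun K _ => ?_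
      have hV := M.cellVol_pos
      have h3 : ρ k K ≤ 1 + ρ k K ^ γ := by
        rcases le_total (ρ k K) 1 with h1 | h1
        · linarith [Real.rpow_nonneg (hρ K) γ]
        · linarith [Real.self_le_rpow_of_one_le h1 hγ.le]
      have h4 : M.cellVol * (a * ρ k K ^ γ) / a = M.cellVol * ρ k K ^ γ := by field_simp
      rw [h4]
      nlinarith
    rw [Finset.sum_add_distrib, M.sum_cellVol, ← Finset.sum_div] at h2
    exact h2.trans (by gcongr)
  kinetic k hk := by
    refine le_trans ?_ (mul_le_mul_of_nonneg_left
      (h.sum_energyDensity_le ha hγ hκ hΔt h0 hS hk) zero_le_two)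
    rw [Finset.mul_sum]
    refine Finset.sum_le_sum fun K _ => ?_
    have hV := M.cellVol_pos
    have hρ := h.density_nonneg hκ hΔt h0 k hk K
    have hg := sub_pos.2 hγ
    have : 0 ≤ M.cellVol * (a / (γ - 1) * ρ k K ^ γ) := by positivity
    unfold energyDensity
    linarith
  dissipation := by
    have h1 := h.energy_le ha hγ hκ hΔt h0 n le_rfl
    have : 0 ≤ ∑ K, M.cellVol * energyDensity a γ (ρ n K) (u n K) :=
      Finset.sum_nonneg fun K _ => mul_nonneg M.cellVol_pos.le
        (energyDensity_nonneg ha hγ (h.density_nonneg hκ hΔt h0 n le_rfl K) _)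
    linarith

end Solution

theorem sum_sum_const_le {g : M.Cell → ℝ} {Q : ℝ} (h : ∑ K, g K ≤ Q) :
    ∑ K, ∑ _i : Fin d, g K ≤ d * Q := by
  simp only [Finset.sum_const, Finset.card_univ, Fintype.card_fin, nsmul_eq_mul]
  rw [← Finset.mul_sum]
  gcongr

/-- The jump terms are controlled by the numerical dissipation. -/
theorem sum_jump_sq_le (hκ : 0 < κ) (hedge : ∀ i, M.edge i ≤ M.h) {ρ : M.Cell → ℝ}
    (u : M.Cell → Fin d → ℝ) (hρ : ∀ K, 0 ≤ ρ K) :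
    ∑ K, ∑ i, M.cellVol * (ρ K * ((u (M.nbr K i 1) i - u K i) ^ 2
        + (u K i - u (M.nbr K i (-1)) i) ^ 2))
      ≤ 2 * M.h / (κ * M.h ^ α) * M.dissipation κ α β ρ u := by
  have hh := M.h_pos
  have hc : 0 < κ * M.h ^ α := mul_pos hκ (Real.rpow_pos_of_pos hh _)
  have e : ∑ K, ∑ i, M.cellVol * (ρ K * ((u (M.nbr K i 1) i - u K i) ^ 2
        + (u K i - u (M.nbr K i (-1)) i) ^ 2))
      = ∑ K, ∑ i, M.cellVol * ((ρ K + ρ (M.nbr K i 1)) * (u (M.nbr K i 1) i - u K i) ^ 2) := by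
    rw [Finset.sum_comm, Finset.sum_comm (s := Finset.univ (α := M.Cell))]
    refine Finset.sum_congr rfl fun i _ => ?_
    have := M.sum_nbr (fun K => M.cellVol * (ρ K * (u K i - u (M.nbr K i (-1)) i) ^ 2)) i 1
    simp only [nbr_one_neg] at this
    simp only [mul_add, add_mul, Finset.sum_add_distrib]
    rw [this]
  rw [e, Mesh.dissipation, Finset.mul_sum]
  refine Finset.sum_le_sum fun K _ => ?_
  rw [Finset.mul_sum]
  refine Finset.sum_le_sum fun i _ => ?_
  have hj := Finset.single_le_sum (f := fun j => (u (M.nbr K i 1) j - u K j) ^ 2)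
    (fun j _ => sq_nonneg _) (Finset.mem_univ i)
  have hσ := M.faceArea_pos i
  have h1 := hρ K
  have h2 := hρ (M.nbr K i 1)
  have h3 := hedge i
  have hb : 0 ≤ M.h ^ β := Real.rpow_nonneg hh.le _
  set J := ∑ j, (u (M.nbr K i 1) j - u K j) ^ 2
  have hJ : 0 ≤ J := (sq_nonneg _).trans hj
  calc _ ≤ M.faceArea i * M.h * ((ρ K + ρ (M.nbr K i 1)) * J) := by
        rw [← M.faceArea_mul_edge i]; gcongr
    _ = 2 * M.h / (κ * M.h ^ α) * (M.faceArea i * ((κ * M.h ^ α / 2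
          * (ρ K + ρ (M.nbr K i 1)) + 0) * J)) := by field_simp; ring
    _ ≤ _ := by gcongr

/-- The flux error of `ϱ g` in one time step. The parameter `ε` of Young's inequality balances the
jumps of the velocity, bounded by the dissipation, against the integral of `ϱ g²`. -/
theorem fluxError_le (hκ : 0 < κ) (hedge : ∀ i, M.edge i ≤ M.h) {ρ g : M.Cell → ℝ}
    {u : M.Cell → Fin d → ℝ} (hρ : ∀ K, 0 ≤ ρ K) {m Q S ε : ℝ} (hε : 0 < ε)
    (hm : ∑ K, M.cellVol * ρ K ≤ m) (hQ : ∑ K, M.cellVol * (ρ K * g K ^ 2) ≤ Q)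
    (hS : ∑ K, M.cellVol * (ρ K * ∑ j, u K j ^ 2) ≤ 2 * S) :
    M.fluxError κ α (fun K => ρ K * g K) u
      ≤ 3 * (M.h * (d * Q / 2 + S) + κ * M.h ^ α * M.h * (d * (m + Q) / 2) + ε * (d * Q)
        + M.h / (ε * (κ * M.h ^ α)) * M.dissipation κ α β ρ u) := by
  have hV := M.cellVol_pos
  have hh := M.h_pos
  set c := κ * M.h ^ α with hcdef
  have hc : 0 < c := mul_pos hκ (Real.rpow_pos_of_pos hh _)
  have hpt : ∀ K i, M.cellVol * (3 * |ρ K * g K| * (M.h * |u K i| + |u (M.nbr K i 1) i - u K i|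
      + |u K i - u (M.nbr K i (-1)) i| + c * M.h))
      ≤ (3 * M.h / 2 + 3 * c * M.h / 2 + 3 * ε) * (M.cellVol * (ρ K * g K ^ 2))
        + 3 * M.h / 2 * (M.cellVol * (ρ K * u K i ^ 2))
        + 3 * c * M.h / 2 * (M.cellVol * ρ K)
        + 3 / (2 * ε) * (M.cellVol * (ρ K * ((u (M.nbr K i 1) i - u K i) ^ 2
        + (u K i - u (M.nbr K i (-1)) i) ^ 2))) := by
    intro K i
    -- Young's inequality for each of the products
    have y1 : |g K| * |u K i| ≤ (g K ^ 2 + u K i ^ 2) / 2 := by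
      rw [← sq_abs (g K), ← sq_abs (u K i)]; nlinarith [sq_nonneg (|g K| - |u K i|)]
    have y2 : ∀ J : ℝ, |g K| * |J| ≤ ε / 2 * g K ^ 2 + 1 / (2 * ε) * J ^ 2 := fun J => by
      rw [← sq_abs (g K), ← sq_abs J]
      have : ε / 2 * |g K| ^ 2 + 1 / (2 * ε) * |J| ^ 2 - |g K| * |J|
          = (ε * |g K| - |J|) ^ 2 / (2 * ε) := by field_simp; ring
      have : 0 ≤ (ε * |g K| - |J|) ^ 2 / (2 * ε) := by positivity
      linarith
    have y3 : |g K| ≤ (1 + g K ^ 2) / 2 := by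
      rw [← sq_abs (g K)]; nlinarith [sq_nonneg (|g K| - 1)]
    have hin : |g K| * (M.h * |u K i| + |u (M.nbr K i 1) i - u K i|
        + |u K i - u (M.nbr K i (-1)) i| + c * M.h)
        ≤ M.h * ((g K ^ 2 + u K i ^ 2) / 2)
          + (ε / 2 * g K ^ 2 + 1 / (2 * ε) * (u (M.nbr K i 1) i - u K i) ^ 2)
          + (ε / 2 * g K ^ 2 + 1 / (2 * ε) * (u K i - u (M.nbr K i (-1)) i) ^ 2)
          + c * M.h * ((1 + g K ^ 2) / 2) := by
      have := mul_le_mul_of_nonneg_left y1 hh.le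
      have := mul_le_mul_of_nonneg_left y3 (mul_pos hc hh).le
      linarith [y2 (u (M.nbr K i 1) i - u K i), y2 (u K i - u (M.nbr K i (-1)) i)]
    have := mul_le_mul_of_nonneg_left hin (mul_nonneg (mul_nonneg zero_le_three hV.le) (hρ K))
    rw [abs_mul, abs_of_nonneg (hρ K)]
    calc _ = 3 * M.cellVol * ρ K * (|g K| * (M.h * |u K i| + |u (M.nbr K i 1) i - u K i|
        + |u K i - u (M.nbr K i (-1)) i| + c * M.h)) := by ring
      _ ≤ _ := this
      _ = _ := by field_simp; ring
  have hsum : M.fluxError κ α (fun K => ρ K * g K) u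
      ≤ (3 * M.h / 2 + 3 * c * M.h / 2 + 3 * ε) * ∑ K, ∑ _i : Fin d, M.cellVol * (ρ K * g K ^ 2)
        + 3 * M.h / 2 * ∑ K, ∑ i, M.cellVol * (ρ K * u K i ^ 2)
        + 3 * c * M.h / 2 * ∑ K, ∑ _i : Fin d, M.cellVol * ρ K
        + 3 / (2 * ε) * ∑ K, ∑ i, M.cellVol * (ρ K * ((u (M.nbr K i 1) i - u K i) ^ 2
        + (u K i - u (M.nbr K i (-1)) i) ^ 2)) := by
    refine (Finset.sum_le_sum fun K _ => Finset.sum_le_sum fun i _ => hpt K i).trans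
      (le_of_eq ?_)
    simp only [Finset.sum_add_distrib, Finset.mul_sum]
  have s1 := sum_sum_const_le hQ
  have s2 := sum_sum_const_le hm
  have s3 : ∑ K, ∑ i, M.cellVol * (ρ K * u K i ^ 2) ≤ 2 * S := by
    simpa only [Finset.mul_sum] using hS
  have s4 := sum_jump_sq_le (α := α) (β := β) hκ hedge u hρ
  have hd0 : (0 : ℝ) ≤ d := Nat.cast_nonneg d
  calc _ ≤ _ := hsum
    _ ≤ (3 * M.h / 2 + 3 * c * M.h / 2 + 3 * ε) * (d * Q) + 3 * M.h / 2 * (2 * S)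
        + 3 * c * M.h / 2 * (d * m)
        + 3 / (2 * ε) * (2 * M.h / c * M.dissipation κ α β ρ u) := by gcongr
    _ = _ := by field_simp; ring

end EulerFV

/-! ### The consistency formulation -/

namespace EulerFV

open Mesh

variable {d : ℕ} {M : Mesh d} {κ α β Δt T S m c X : ℝ} {n : ℕ}
  {ρ : ℕ → M.Cell → ℝ} {u : ℕ → M.Cell → Fin d → ℝ}

/-- The constant in the consistency estimate for a quantity `ϱ g`; `Q` bounds `∫ ϱ g²`, `P` bounds
the integral of the pressure and `U` that of the initial velocity. -/
noncomputable def errorConst (d : ℕ) (c κ T m Q S P U : ℝ) : ℝ :=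
  c * ((m + Q) / 2 + T * ((m + Q) / 2) + (d * Q / 2 + S) + P + 2 * (d * U))
    + 3 * (T * (d * Q / 2 + S) + T * κ * (d * (m + Q) / 2) + T * (d * Q) + S / κ) + T * P

/-- The consistency estimate for a quantity `ϱ g` solving the scheme, in terms of the powers of the
mesh size that are at most `X`. -/
theorem APrioriBounds.abs_consistency_le (hA : APrioriBounds M κ α β Δt S m (n + 1) ρ u)
    (hedge : ∀ i, M.edge i ≤ M.h) (hκ : 0 < κ) (hΔt : 0 < Δt) (hΔtc : Δt ≤ c * M.h)
    (hT : T = (n + 1 : ℕ) * Δt)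
    (hX1 : M.h ≤ X) (hX2 : M.h ^ α * M.h ≤ X) (hX3 : M.h ^ ((1 - α) / 2) ≤ X)
    (hX4 : M.h ^ (β + 1) ≤ X)
    {N : ℝ} (hN : 0 ≤ N) {A : ℕ → M.Cell → ℝ} {B : M.Cell → ℝ}
    {It : ℕ → M.Cell → ℝ} {Ix : ℕ → Fin d → M.Cell → ℝ}
    (H : M.MomentBounds Δt N (n + 1) A B It Ix)
    {g p w : ℕ → M.Cell → ℝ} {Q P U : ℝ} (j : Fin d)
    (hQ : ∀ k ≤ n + 1, ∑ K, M.cellVol * (ρ k K * g k K ^ 2) ≤ Q)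
    (hP : ∀ k ≤ n + 1, ∑ K, M.cellVol * |p k K| ≤ P)
    (hU : ∑ K, M.cellVol * |w 0 K| ≤ U)
    (hr : ∀ k < n, ∀ K, (ρ (k + 1) K * g (k + 1) K - ρ k K * g k K) / Δt
      + M.faceSum (fun i s =>
        M.flux κ α (fun L => ρ (k + 1) L * g (k + 1) L) (u (k + 1)) K i s
          + M.faceAvg (p (k + 1)) K i s * (if i = j then (s : ℝ) else 0)
          - M.h ^ β * M.faceJump (w (k + 1)) K i s) = 0) :
    |∑ K, ρ 0 K * g 0 K * B K
        + ∑ k ∈ Finset.range (n + 1), ∑ K, (ρ k K * g k K * It k K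
          + (∑ i, ρ k K * g k K * u k K i * Ix k i K + p k K * Ix k j K))
        - M.h ^ β * ∑ k ∈ Finset.range (n + 1), ∑ K, ∑ i,
          M.faceArea i * (M.faceJump (w k) K i 1
            * (A k (M.nbr K i 1) / M.cellVol - A k K / M.cellVol))|
      ≤ N * (errorConst d c κ T m Q S P U * X) := by
  have hV := M.cellVol_pos
  have hh := M.h_pos
  have hb : 0 ≤ M.h ^ β := Real.rpow_nonneg hh.le _
  have hc : 0 < c := pos_of_mul_pos_left (hΔt.trans_le hΔtc) hh.le
  have hd0 : (0 : ℝ) ≤ d := Nat.cast_nonneg d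
  have hX0 : 0 < X := hh.trans_le hX1
  have hn0 : 0 ≤ n + 1 := Nat.zero_le _
  have hρ0 := hA.nonneg 0 hn0
  have hm0 : 0 ≤ m := (Finset.sum_nonneg fun K _ => mul_nonneg hV.le (hρ0 K)).trans
    (hA.mass 0 hn0)
  have hQ0 : 0 ≤ Q := (Finset.sum_nonneg fun K _ =>
    mul_nonneg hV.le (mul_nonneg (hρ0 K) (sq_nonneg _))).trans (hQ 0 hn0)
  have hP0 : 0 ≤ P := (Finset.sum_nonneg fun K _ =>
    mul_nonneg hV.le (abs_nonneg _)).trans (hP 0 hn0)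
  have hU0 : 0 ≤ U := (Finset.sum_nonneg fun K _ =>
    mul_nonneg hV.le (abs_nonneg _)).trans hU
  have hS0 : 0 ≤ S := by
    have : 0 ≤ 2 * S := (Finset.sum_nonneg fun K _ => mul_nonneg hV.le (mul_nonneg (hρ0 K)
      (Finset.sum_nonneg fun j _ => sq_nonneg _))).trans (hA.kinetic 0 hn0)
    linarith
  have hnT : (n : ℝ) * Δt ≤ T := by rw [hT]; push_cast; nlinarith
  have hT0 : 0 ≤ T := le_trans (by positivity) hnT
  have hΔtX : Δt ≤ c * X := hΔtc.trans (by gcongr)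
  refine (H.consistency hedge hκ hb hN hΔt (fun k K => ρ k K * g k K) p w u j hr).trans ?_
  rw [mul_assoc]
  refine mul_le_mul_of_nonneg_left ?_ hN
  -- the transported quantity itself
  have hr1 : ∀ k ≤ n + 1, ∑ K, M.cellVol * |ρ k K * g k K| ≤ (m + Q) / 2 := by
    intro k hk
    have : ∑ K, M.cellVol * |ρ k K * g k K|
        ≤ (∑ K, M.cellVol * ρ k K + ∑ K, M.cellVol * (ρ k K * g k K ^ 2)) / 2 := by
      rw [← Finset.sum_add_distrib, Finset.sum_div]
      refine Finset.sum_le_sum fun K _ => ?_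
      have hρ := hA.nonneg k hk K
      rw [abs_mul, abs_of_nonneg hρ, ← sq_abs (g k K)]
      nlinarith [mul_nonneg (mul_nonneg hV.le hρ) (sq_nonneg (|g k K| - 1))]
    linarith [hA.mass k hk, hQ k hk]
  have t2 : Δt * ∑ k ∈ Finset.range (n + 1), ∑ K, M.cellVol * |ρ k K * g k K|
      ≤ T * ((m + Q) / 2) := by
    have := Finset.sum_le_card_nsmul (Finset.range (n + 1))
      (fun k => ∑ K, M.cellVol * |ρ k K * g k K|) ((m + Q) / 2) fun k hk =>
        hr1 k (Finset.mem_range.1 hk).le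
    rw [Finset.card_range, nsmul_eq_mul] at this
    rw [hT, mul_comm _ Δt, mul_assoc]
    gcongr
  -- the first time slab
  have t3 : ∑ K, M.cellVol * (∑ i, |ρ 0 K * g 0 K * u 0 K i| + |p 0 K|)
      ≤ d * Q / 2 + S + P := by
    have e : ∑ K, M.cellVol * (∑ i, |ρ 0 K * g 0 K * u 0 K i|)
        ≤ (∑ K, ∑ _i : Fin d, M.cellVol * (ρ 0 K * g 0 K ^ 2)
          + ∑ K, M.cellVol * (ρ 0 K * ∑ i, u 0 K i ^ 2)) / 2 := by
      rw [← Finset.sum_add_distrib, Finset.sum_div]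
      refine Finset.sum_le_sum fun K _ => ?_
      rw [Finset.mul_sum, Finset.mul_sum, Finset.mul_sum, ← Finset.sum_add_distrib,
        Finset.sum_div]
      refine Finset.sum_le_sum fun i _ => ?_
      rw [abs_mul, abs_mul, abs_of_nonneg (hρ0 K), ← sq_abs (g 0 K), ← sq_abs (u 0 K i)]
      nlinarith [mul_nonneg (mul_nonneg hV.le (hρ0 K)) (sq_nonneg (|g 0 K| - |u 0 K i|))]
    simp only [mul_add, Finset.sum_add_distrib]
    linarith [sum_sum_const_le (hQ 0 hn0), hA.kinetic 0 hn0, hP 0 hn0]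
  have t4 : ∑ K, ∑ i, M.cellVol * |M.faceJump (w 0) K i 1| ≤ 2 * (d * U) := by
    have e : ∑ K, ∑ i, M.cellVol * |M.faceJump (w 0) K i 1|
        ≤ ∑ K, ∑ i, M.cellVol * |w 0 (M.nbr K i 1)|
          + ∑ K, ∑ _i : Fin d, M.cellVol * |w 0 K| := by
      simp only [← Finset.sum_add_distrib, ← mul_add]
      gcongr with K _ i _
      exact abs_sub _ _
    have e2 : ∑ K, ∑ i, M.cellVol * |w 0 (M.nbr K i 1)|
        = ∑ K, ∑ _i : Fin d, M.cellVol * |w 0 K| := by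
      rw [Finset.sum_comm, Finset.sum_comm (s := Finset.univ (α := M.Cell))]
      exact Finset.sum_congr rfl fun i _ => M.sum_nbr (fun K => M.cellVol * |w 0 K|) i 1
    linarith [sum_sum_const_le hU]
  -- the later time slabs
  set ε := M.h ^ ((1 - α) / 2) with hε
  have hε0 : 0 < ε := Real.rpow_pos_of_pos hh _
  have hεh : M.h / (ε * (κ * M.h ^ α)) = ε / κ := by
    have hpow : ε * ε * M.h ^ α = M.h := by
      rw [hε, ← Real.rpow_add hh, ← Real.rpow_add hh]
      norm_num
    have hα : M.h ^ α ≠ 0 := (Real.rpow_pos_of_pos hh _).ne'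
    field_simp
    nlinarith
  have t5 : Δt * ∑ k ∈ Finset.range n,
      (M.fluxError κ α (fun K => ρ (k + 1) K * g (k + 1) K) (u (k + 1))
        + M.h * ∑ K, M.cellVol * |p (k + 1) K|)
      ≤ (3 * (T * (d * Q / 2 + S) + T * κ * (d * (m + Q) / 2) + T * (d * Q) + S / κ)
        + T * P) * X := by
    let E := 3 * (M.h * (d * Q / 2 + S) + κ * M.h ^ α * M.h * (d * (m + Q) / 2) + ε * (d * Q))
      + M.h * P
    have e1 : ∑ k ∈ Finset.range n,
        (M.fluxError κ α (fun K => ρ (k + 1) K * g (k + 1) K) (u (k + 1))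
          + M.h * ∑ K, M.cellVol * |p (k + 1) K|)
        ≤ ∑ k ∈ Finset.range n,
          (E + 3 * (ε / κ) * M.dissipation κ α β (ρ (k + 1)) (u (k + 1))) := by
      refine Finset.sum_le_sum fun k hk => ?_
      have hk1 : k + 1 ≤ n + 1 := by have := Finset.mem_range.1 hk; omega
      have f1 := fluxError_le (α := α) (β := β) hκ hedge (hA.nonneg _ hk1) hε0 (hA.mass _ hk1)
        (hQ _ hk1) (hA.kinetic _ hk1)
      have f2 := mul_le_mul_of_nonneg_left (hP _ hk1) hh.le
      rw [hεh] at f1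
      simp only [E]
      linarith
    have e2 : Δt * ∑ k ∈ Finset.range n, M.dissipation κ α β (ρ (k + 1)) (u (k + 1)) ≤ S := by
      refine le_trans ?_ hA.dissipation
      rw [Finset.sum_range_succ]
      exact mul_le_mul_of_nonneg_left
        (le_add_of_nonneg_right (dissipation_nonneg hκ _ (hA.nonneg _ le_rfl))) hΔt.le
    have hE : E ≤ (3 * ((d * Q / 2 + S) + κ * (d * (m + Q) / 2) + d * Q) + P) * X := by
      have := mul_le_mul_of_nonneg_right hX1 (show 0 ≤ d * Q / 2 + S by positivity)
      have := mul_le_mul_of_nonneg_right hX2 (show 0 ≤ κ * (d * (m + Q) / 2) by positivity)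
      have := mul_le_mul_of_nonneg_right hX3 (show 0 ≤ d * Q by positivity)
      have := mul_le_mul_of_nonneg_right hX1 hP0
      simp only [E]
      linarith
    have hE0 : 0 ≤ (3 * ((d * Q / 2 + S) + κ * (d * (m + Q) / 2) + d * Q) + P) * X := by
      positivity
    have e3 : ∑ k ∈ Finset.range n,
          (E + 3 * (ε / κ) * M.dissipation κ α β (ρ (k + 1)) (u (k + 1)))
        = n * E + 3 * (ε / κ) * ∑ k ∈ Finset.range n,
          M.dissipation κ α β (ρ (k + 1)) (u (k + 1)) := by
      rw [Finset.sum_add_distrib, Finset.sum_const, Finset.card_range, nsmul_eq_mul,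
        ← Finset.mul_sum]
    rw [e3] at e1
    have e4 := mul_le_mul_of_nonneg_left e1 hΔt.le
    have e5 : (n : ℝ) * Δt * E
        ≤ T * ((3 * ((d * Q / 2 + S) + κ * (d * (m + Q) / 2) + d * Q) + P) * X) :=
      (mul_le_mul_of_nonneg_left hE (by positivity)).trans
        (mul_le_mul_of_nonneg_right hnT hE0)
    have e6 : 3 * (ε / κ) * (Δt * ∑ k ∈ Finset.range n,
        M.dissipation κ α β (ρ (k + 1)) (u (k + 1))) ≤ 3 * (X / κ) * S := by
      have : ε / κ ≤ X / κ := by gcongr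
      exact (mul_le_mul_of_nonneg_left e2 (by positivity)).trans (by gcongr)
    calc _ ≤ _ := e4
      _ = (n : ℝ) * Δt * E + 3 * (ε / κ) * (Δt * ∑ k ∈ Finset.range n,
        M.dissipation κ α β (ρ (k + 1)) (u (k + 1))) := by ring
      _ ≤ _ := add_le_add e5 e6
      _ = _ := by ring
  have hbΔt : Δt * M.h ^ β ≤ c * X := by
    calc _ ≤ c * M.h * M.h ^ β := by gcongr
      _ = c * M.h ^ (β + 1) := by rw [Real.rpow_add_one hh.ne']; ring
      _ ≤ _ := by gcongr
  have k1 := mul_le_mul (hr1 0 hn0) hΔtX hΔt.le (by positivity)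
  have k2 := mul_le_mul t2 hΔtX hΔt.le (by positivity)
  have k3 := mul_le_mul t3 hΔtX hΔt.le (by positivity)
  have k4 := mul_le_mul t4 hbΔt (by positivity) (by positivity)
  unfold errorConst
  linarith

/-- The numerical diffusion tends to zero: away from the first time slab it is controlled by the
dissipation, on the first one by the integral of the initial velocity. -/
theorem APrioriBounds.abs_diffusion_le (hA : APrioriBounds M κ α β Δt S m (n + 1) ρ u)
    (hedge : ∀ i, M.edge i ≤ M.h) (hκ : 0 < κ) (hΔt : 0 < Δt) (hΔtc : Δt ≤ c * M.h)
    (hT : T = (n + 1 : ℕ) * Δt)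
    (hX4 : M.h ^ (β + 1) ≤ X) (hX5 : M.h ^ ((β + 1) / 2) ≤ X)
    {N : ℝ} (hN : 0 ≤ N) {A : Fin d → ℕ → M.Cell → ℝ} {B : Fin d → M.Cell → ℝ}
    {It : Fin d → ℕ → M.Cell → ℝ} {Ix : Fin d → ℕ → Fin d → M.Cell → ℝ}
    (H : ∀ j, M.MomentBounds Δt N (n + 1) (A j) (B j) (It j) (Ix j))
    {U : ℝ} (hU : ∀ j, ∑ K, M.cellVol * |u 0 K j| ≤ U) :
    |∑ j, -(M.h ^ β * ∑ k ∈ Finset.range (n + 1), ∑ K, ∑ i,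
      M.faceArea i * (M.faceJump (fun L => u k L j) K i 1
        * (A j k (M.nbr K i 1) / M.cellVol - A j k K / M.cellVol)))|
      ≤ N * ((2 * c * d * (d * U) + T * (d * (d * 2 ^ d)) + S) * X) := by
  have hV := M.cellVol_pos
  have hh := M.h_pos
  have hb : 0 < M.h ^ β := Real.rpow_pos_of_pos hh _
  have hc : 0 < c := pos_of_mul_pos_left (hΔt.trans_le hΔtc) hh.le
  have hd0 : (0 : ℝ) ≤ d := Nat.cast_nonneg d
  have hX0 : 0 < X := (Real.rpow_pos_of_pos hh _).trans_le hX4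
  have hnT : (n : ℝ) * Δt ≤ T := by rw [hT]; push_cast; nlinarith
  have hT0 : 0 ≤ T := le_trans (by positivity) hnT
  let D : ℕ → ℝ := fun k => ∑ j, ∑ K, ∑ i, M.cellVol * |u k (M.nbr K i 1) j - u k K j|
  have h1 : |∑ j, -(M.h ^ β * ∑ k ∈ Finset.range (n + 1), ∑ K, ∑ i,
      M.faceArea i * (M.faceJump (fun L => u k L j) K i 1
        * (A j k (M.nbr K i 1) / M.cellVol - A j k K / M.cellVol)))|
      ≤ M.h ^ β * (N * Δt) * ∑ k ∈ Finset.range (n + 1), D k := by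
    have e : M.h ^ β * (N * Δt) * ∑ k ∈ Finset.range (n + 1), D k
        = ∑ j, M.h ^ β * ∑ k ∈ Finset.range (n + 1), ∑ K, ∑ i,
          N * Δt * (M.cellVol * |u k (M.nbr K i 1) j - u k K j|) := by
      simp only [D]
      rw [Finset.sum_comm]
      simp only [Finset.mul_sum, mul_assoc]
    rw [e]
    refine (Finset.abs_sum_le_sum_abs _ _).trans (Finset.sum_le_sum fun j _ => ?_)
    rw [abs_neg, abs_mul, abs_of_pos hb]
    refine mul_le_mul_of_nonneg_left ((Finset.abs_sum_le_sum_abs _ _).trans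
      (Finset.sum_le_sum fun k _ => (Finset.abs_sum_le_sum_abs _ _).trans
      (Finset.sum_le_sum fun K _ => (Finset.abs_sum_le_sum_abs _ _).trans
      (Finset.sum_le_sum fun i _ => ?_)))) hb.le
    rw [abs_mul, abs_mul, abs_of_pos (M.faceArea_pos i), ← sub_div, abs_div, abs_of_pos hV]
    have h2 : |A j k (M.nbr K i 1) - A j k K| / M.cellVol ≤ N * Δt * M.edge i := by
      rw [div_le_iff₀ hV]; exact ((H j).jump k K i).trans (le_of_eq (by ring))
    have := (M.faceArea_pos i).le
    calc _ ≤ M.faceArea i * (|u k (M.nbr K i 1) j - u k K j| * (N * Δt * M.edge i)) := by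
          simp only [faceJump]; gcongr
      _ = _ := by rw [← M.faceArea_mul_edge i]; ring
  have hD0 : D 0 ≤ d * (2 * (d * U)) := by
    have : ∀ j, ∑ K, ∑ i, M.cellVol * |u 0 (M.nbr K i 1) j - u 0 K j| ≤ 2 * (d * U) := by
      intro j
      have e : ∑ K, ∑ i, M.cellVol * |u 0 (M.nbr K i 1) j - u 0 K j|
          ≤ ∑ K, ∑ i, M.cellVol * |u 0 (M.nbr K i 1) j|
            + ∑ K, ∑ _i : Fin d, M.cellVol * |u 0 K j| := by
        simp only [← Finset.sum_add_distrib, ← mul_add]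
        gcongr with K _ i _
        exact abs_sub _ _
      have e2 : ∑ K, ∑ i, M.cellVol * |u 0 (M.nbr K i 1) j|
          = ∑ K, ∑ _i : Fin d, M.cellVol * |u 0 K j| := by
        rw [Finset.sum_comm, Finset.sum_comm (s := Finset.univ (α := M.Cell))]
        exact Finset.sum_congr rfl fun i _ => M.sum_nbr (fun K => M.cellVol * |u 0 K j|) i 1
      linarith [sum_sum_const_le (hU j)]
    have := Finset.sum_le_card_nsmul Finset.univ _ _ fun j (_ : j ∈ Finset.univ) => this j
    simpa [D] using this
  -- the weight in Young's inequality that balances the two resulting powers of the mesh size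
  set μ := M.h ^ ((1 - β) / 2) with hμ
  have hμ0 : 0 < μ := Real.rpow_pos_of_pos hh _
  have hμ1 : M.h ^ β * μ = M.h ^ ((β + 1) / 2) := by
    rw [hμ, ← Real.rpow_add hh]; congr 1; ring
  have hμ2 : M.h / μ = M.h ^ ((β + 1) / 2) := by
    rw [div_eq_iff hμ0.ne', hμ, ← Real.rpow_add hh]; ring_nf; rw [Real.rpow_one]
  have hDk : ∀ k < n, M.h ^ β * D (k + 1) ≤ M.h ^ β * μ * (d * (d * 2 ^ d))
      + M.h / μ * M.dissipation κ α β (ρ (k + 1)) (u (k + 1)) := by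
    intro k hk
    have hρ := hA.nonneg (k + 1) (by omega)
    have hpt : ∀ j K i, M.cellVol * |u (k + 1) (M.nbr K i 1) j - u (k + 1) K j|
        ≤ μ * M.cellVol + M.h / μ * (M.faceArea i
          * (u (k + 1) (M.nbr K i 1) j - u (k + 1) K j) ^ 2) := by
      intro j K i
      set J := u (k + 1) (M.nbr K i 1) j - u (k + 1) K j
      have y : |J| ≤ μ + J ^ 2 / μ := by
        rw [← sq_abs J, ← sub_le_iff_le_add', le_div_iff₀ hμ0]
        nlinarith [sq_nonneg (|J| - μ), abs_nonneg J]
      have hσ := (M.faceArea_pos i).le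
      calc _ ≤ M.cellVol * (μ + J ^ 2 / μ) := by gcongr
        _ = μ * M.cellVol + M.edge i / μ * (M.faceArea i * J ^ 2) := by
          rw [← M.faceArea_mul_edge i]; ring
        _ ≤ _ := by have := hedge i; gcongr
    have e1 : D (k + 1) ≤ μ * ∑ _j : Fin d, ∑ _K : M.Cell, ∑ _i : Fin d, M.cellVol
        + M.h / μ * ∑ j, ∑ K, ∑ i, M.faceArea i
          * (u (k + 1) (M.nbr K i 1) j - u (k + 1) K j) ^ 2 := by
      simp only [Finset.mul_sum, ← Finset.sum_add_distrib]
      exact Finset.sum_le_sum fun j _ => Finset.sum_le_sum fun K _ => Finset.sum_le_sum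
        fun i _ => hpt j K i
    have e2 : ∑ _j : Fin d, ∑ _K : M.Cell, ∑ _i : Fin d, M.cellVol = d * (d * 2 ^ d) := by
      have : ∑ _K : M.Cell, ∑ _i : Fin d, M.cellVol = d * 2 ^ d := by
        rw [Finset.sum_comm, M.sum_cellVol]; simp
      rw [this]; simp
    have e3 : M.h ^ β * ∑ j, ∑ K, ∑ i, M.faceArea i
          * (u (k + 1) (M.nbr K i 1) j - u (k + 1) K j) ^ 2
        ≤ M.dissipation κ α β (ρ (k + 1)) (u (k + 1)) := by
      rw [Finset.sum_comm, Mesh.dissipation, Finset.mul_sum]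
      refine Finset.sum_le_sum fun K _ => ?_
      rw [Finset.sum_comm, Finset.mul_sum]
      refine Finset.sum_le_sum fun i _ => ?_
      rw [← Finset.mul_sum, mul_left_comm]
      have hσ := (M.faceArea_pos i).le
      have := hρ K
      have := hρ (M.nbr K i 1)
      have hα : 0 < M.h ^ α := Real.rpow_pos_of_pos hh _
      have hJ := Finset.sum_nonneg fun j (_ : j ∈ Finset.univ) =>
        sq_nonneg (u (k + 1) (M.nbr K i 1) j - u (k + 1) K j)
      gcongr
      exact le_add_of_nonneg_left (by positivity)
    rw [e2] at e1
    have e4 := mul_le_mul_of_nonneg_left e1 hb.le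
    have e5 := mul_le_mul_of_nonneg_left e3 (div_pos hh hμ0).le
    linarith
  have hsum : Δt * (M.h ^ β * ∑ k ∈ Finset.range n, D (k + 1))
      ≤ (T * (d * (d * 2 ^ d)) + S) * X := by
    have e1 : M.h ^ β * ∑ k ∈ Finset.range n, D (k + 1)
        ≤ ∑ k ∈ Finset.range n, (M.h ^ β * μ * (d * (d * 2 ^ d))
          + M.h / μ * M.dissipation κ α β (ρ (k + 1)) (u (k + 1))) := by
      rw [Finset.mul_sum]
      exact Finset.sum_le_sum fun k hk => hDk k (Finset.mem_range.1 hk)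
    have e2 : Δt * ∑ k ∈ Finset.range n, M.dissipation κ α β (ρ (k + 1)) (u (k + 1)) ≤ S := by
      refine le_trans ?_ hA.dissipation
      rw [Finset.sum_range_succ]
      exact mul_le_mul_of_nonneg_left
        (le_add_of_nonneg_right (dissipation_nonneg hκ _ (hA.nonneg _ le_rfl))) hΔt.le
    have hS0 : 0 ≤ S := (mul_nonneg hΔt.le (Finset.sum_nonneg fun k hk => dissipation_nonneg hκ _
      (hA.nonneg _ (by have := Finset.mem_range.1 hk; omega)))).trans e2
    rw [Finset.sum_add_distrib, Finset.sum_const, Finset.card_range, nsmul_eq_mul,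
      ← Finset.mul_sum, hμ1, hμ2] at e1
    have hY : 0 ≤ M.h ^ ((β + 1) / 2) := Real.rpow_nonneg hh.le _
    calc _ ≤ Δt * _ := mul_le_mul_of_nonneg_left e1 hΔt.le
      _ = (n : ℝ) * Δt * (d * (d * 2 ^ d)) * M.h ^ ((β + 1) / 2)
          + (Δt * ∑ k ∈ Finset.range n, M.dissipation κ α β (ρ (k + 1)) (u (k + 1)))
            * M.h ^ ((β + 1) / 2) := by ring
      _ ≤ T * (d * (d * 2 ^ d)) * X + S * X := by gcongr
      _ = _ := by ring
  have hU0 : ∀ _ : Fin d, 0 ≤ U := fun j => (Finset.sum_nonneg fun K _ =>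
    mul_nonneg hV.le (abs_nonneg _)).trans (hU j)
  have hdU : 0 ≤ d * (2 * (d * U)) := by
    rcases Nat.eq_zero_or_pos d with rfl | hd
    · simp
    · have := hU0 ⟨0, hd⟩; positivity
  have hfirst : M.h ^ β * Δt * D 0 ≤ c * X * (d * (2 * (d * U))) := by
    have : M.h ^ β * Δt ≤ c * X := by
      calc _ ≤ M.h ^ β * (c * M.h) := by gcongr
        _ = c * M.h ^ (β + 1) := by rw [Real.rpow_add_one hh.ne']; ring
        _ ≤ _ := by gcongr
    exact (mul_le_mul_of_nonneg_left hD0 (by positivity)).trans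
      (mul_le_mul_of_nonneg_right this hdU)
  refine h1.trans ?_
  rw [Finset.sum_range_succ']
  have := mul_le_mul_of_nonneg_left (add_le_add hsum hfirst) hN
  linarith

end EulerFV

namespace EulerFV

open Mesh

variable {d : ℕ}

theorem Mesh.proj_nonneg (M : Mesh d) {f : (Fin d → ℝ) → ℝ} (hf : ∀ᵐ x : Fin d → ℝ, 0 < f x)
    (K : M.Cell) : 0 ≤ M.proj f K :=
  smul_nonneg (inv_nonneg.2 M.cellVol_pos.le) <| setIntegral_nonneg_of_ae
    (hf.mono fun _ hx => hx.le)

/-- The projection onto the mesh does not increase the `L¹` norm. -/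
theorem Mesh.sum_abs_proj_le (M : Mesh d) {f : (Fin d → ℝ) → Fin d → ℝ} (hf : TorusPeriodic f)
    (hint : IntegrableOn f (torus d)) (j : Fin d) :
    ∑ K, M.cellVol * |M.proj f K j| ≤ ∫ x in torus d, ‖f x‖ := by
  have hper : TorusPeriodic fun x => ‖f x‖ := fun x i => congrArg norm (hf x i)
  rw [M.integral_torus hper (g := fun _ x => ‖f x‖) (fun _ => rfl)
    fun K => M.integrableOn_cellSet hper hint.norm K]
  refine Finset.sum_le_sum fun K _ => ?_
  have hV := M.cellVol_pos
  refine (mul_le_mul_of_nonneg_left (norm_le_pi_norm (M.proj f K) j) hV.le).trans ?_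
  rw [proj, norm_smul, norm_inv, Real.norm_of_nonneg hV.le, mul_inv_cancel_left₀ hV.ne']
  exact norm_integral_le_integral_norm _

/-- The consistency formulation involves the error density only through its space-time integral, so
the total error may be spread evenly over the space-time cylinder. -/
theorem exists_integral_eq (d : ℕ) {T : ℝ} (hT : 0 < T) (r : ℝ) :
    ∃ e : ℝ → (Fin d → ℝ) → ℝ,
      IntegrableOn (fun z : ℝ × (Fin d → ℝ) => e z.1 z.2) (Ioo 0 T ×ˢ torus d) ∧
      ∫ t in (0 : ℝ)..T, ∫ x in torus d, e t x = r := by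
  have hvol : volume.real (torus d) = 2 ^ d := by
    rw [torus, measureReal_def, Real.volume_Icc_pi_toReal]
    · norm_num
    · intro i; norm_num
  refine ⟨fun _ _ => r / (T * 2 ^ d), integrableOn_const ?_, ?_⟩
  · rw [Measure.volume_eq_prod, Measure.prod_prod]
    exact (ENNReal.mul_lt_top measure_Ioo_lt_top isCompact_Icc.measure_lt_top).ne
  · simp only [setIntegral_const, intervalIntegral.integral_const, hvol, smul_eq_mul, sub_zero]
    field_simp

theorem rpow_le_sq_mul_rpow {h H s δ : ℝ} (hh : 0 < h) (hH : h ≤ H) (h1 : 1 ≤ H) (hδs : δ ≤ s)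
    (hs : s ≤ δ + 2) : h ^ s ≤ H ^ 2 * h ^ δ := by
  have e : h ^ s = h ^ (s - δ) * h ^ δ := by rw [← Real.rpow_add hh, sub_add_cancel]
  rw [e]
  refine mul_le_mul_of_nonneg_right ?_ (Real.rpow_nonneg hh.le _)
  calc h ^ (s - δ) ≤ H ^ (s - δ) := Real.rpow_le_rpow hh.le hH (by linarith)
    _ ≤ H ^ (2 : ℝ) := Real.rpow_le_rpow_of_exponent_le h1 (by linarith)
    _ = H ^ 2 := by norm_cast

end EulerFV

open EulerFV Mesh in
theorem proposition5p1 (d : ℕ) (hd : 1 ≤ d ∧ d ≤ 3) (γ α β : ℝ)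
    (hγ : 1 < γ ∧ γ < 2) (hα : 0 < α ∧ α < 1)
    (hβ : -1 < β ∧ β < (1 - 2 / γ) - α / γ) :
    ∃ δ : ℝ, 0 < δ ∧
    ∀ (a T lam c κ : ℝ), 0 < a → 0 < T → 0 < lam → lam < 1 → 0 < c → 0 < κ →
    ∀ (ρ₀ : (Fin d → ℝ) → ℝ) (u₀ : (Fin d → ℝ) → Fin d → ℝ),
      EulerFV.TorusPeriodic ρ₀ → EulerFV.TorusPeriodic u₀ →
      IntegrableOn ρ₀ (EulerFV.torus d) → IntegrableOn u₀ (EulerFV.torus d) →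
      (∀ᵐ x : Fin d → ℝ, 0 < ρ₀ x) →
    ∀ E₀ : ℝ, ∃ C : ℝ, 0 < C ∧
    ∀ (M : EulerFV.Mesh d) (n : ℕ) (Δt : ℝ),
      M.Regular lam → 0 < n → Δt = T / n → M.h / c ≤ Δt → Δt ≤ c * M.h →
    ∀ (ρ : ℕ → M.Cell → ℝ) (u : ℕ → M.Cell → Fin d → ℝ),
      EulerFV.IsNumericalSolution M a γ κ α β Δt n ρ₀ u₀ ρ u →
      M.energy a γ (ρ 0) (u 0) ≤ E₀ →
      (∀ φ : ℝ × (Fin d → ℝ) → ℝ, EulerFV.IsTestFunction T φ →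
        ∃ e₁ : ℝ → (Fin d → ℝ) → ℝ,
          IntegrableOn (fun z : ℝ × (Fin d → ℝ) => e₁ z.1 z.2) (Ioo 0 T ×ˢ EulerFV.torus d) ∧
          -(∫ x in EulerFV.torus d, M.eval (ρ 0) x * φ (0, x))
            = EulerFV.densityForm M T Δt ρ u φ
              + ∫ t in (0 : ℝ)..T, ∫ x in EulerFV.torus d, e₁ t x ∧
          |∫ t in (0 : ℝ)..T, ∫ x in EulerFV.torus d, e₁ t x|
            ≤ C * M.h ^ δ * EulerFV.c3Norm φ) ∧
      (∀ φ : ℝ × (Fin d → ℝ) → Fin d → ℝ, EulerFV.IsTestFunction T φ →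
        (∃ e₂ : ℝ → (Fin d → ℝ) → ℝ,
          IntegrableOn (fun z : ℝ × (Fin d → ℝ) => e₂ z.1 z.2) (Ioo 0 T ×ˢ EulerFV.torus d) ∧
          -(∫ x in EulerFV.torus d, ∑ i, M.eval (ρ 0) x * M.eval (u 0) x i * φ (0, x) i)
            = EulerFV.momentumForm M a γ T Δt ρ u φ
              + EulerFV.diffusionTerm M β T Δt u φ
              + ∫ t in (0 : ℝ)..T, ∫ x in EulerFV.torus d, e₂ t x ∧
          |∫ t in (0 : ℝ)..T, ∫ x in EulerFV.torus d, e₂ t x|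
            ≤ C * M.h ^ δ * EulerFV.c3Norm φ) ∧
        |EulerFV.diffusionTerm M β T Δt u φ|
          ≤ C * M.h ^ ((β + 1) / 2) * EulerFV.c3Norm φ) := by
  obtain ⟨hd1, -⟩ := hd
  obtain ⟨hγ1, -⟩ := hγ
  obtain ⟨hα0, hα1⟩ := hα
  obtain ⟨hβ0, hβ1⟩ := hβ
  have hγ0 : 0 < γ := by linarith
  have hβ2 : β < 1 := by
    have := div_pos two_pos hγ0
    have := div_pos hα0 hγ0
    linarith
  refine ⟨min ((1 - α) / 2) (β + 1), lt_min (by linarith) (by linarith), ?_⟩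
  set δ := min ((1 - α) / 2) (β + 1) with hδ
  have hδ1 : δ ≤ (1 - α) / 2 := min_le_left _ _
  have hδ2 : δ ≤ β + 1 := min_le_right _ _
  have hδ0 : 0 < δ := lt_min (by linarith) (by linarith)
  intro a T lam c κ ha hT hlam hlam1 hc hκ ρ₀ u₀ _ hu₀ _ hu₀int hρ₀pos E₀
  -- `S` bounds the energy, `m` the mass, `H` the mesh size (an element has edges of length at
  -- most `2`), and `U` the integral of the projected initial velocity
  set S := |E₀|
  set m := 2 ^ d + (γ - 1) * S / a with hm
  set H := 2 / lam with hH
  set U := ∫ x in torus d, ‖u₀ x‖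
  set C₁ := errorConst d c κ T m m S 0 0 * H ^ 2 with hC₁
  set C₂ := d * (errorConst d c κ T m (2 * S) S ((γ - 1) * S) U * H ^ 2) with hC₂
  set C₃ := (2 * c * d * (d * U) + T * (d * (d * 2 ^ d)) + S) * H ^ 2 with hC₃
  refine ⟨|C₁| + |C₂| + |C₃| + 1, by positivity, ?_⟩
  intro M n Δt hreg hn hΔtn _ hΔtc ρ u hsol hE
  obtain ⟨n, rfl⟩ : ∃ n', n = n' + 1 := ⟨n - 1, by omega⟩
  have hn0 : (0 : ℝ) < ((n + 1 : ℕ) : ℝ) := by positivity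
  have hΔt : 0 < Δt := hΔtn ▸ div_pos hT hn0
  have hTn : T = (n + 1 : ℕ) * Δt := by rw [hΔtn]; field_simp
  have hh := M.h_pos
  have hedge : ∀ i, M.edge i ≤ M.h := fun i => (hreg i).2
  have hhH : M.h ≤ H := by
    have := (hreg ⟨0, hd1⟩).1.trans (M.edge_le_two _)
    rw [hH, le_div_iff₀ hlam]; linarith
  have hH1 : 1 ≤ H := by rw [hH, le_div_iff₀ hlam]; linarith
  have hρ0 : ∀ K, 0 ≤ ρ 0 K := fun K => by
    rw [hsol.init_density]; exact M.proj_nonneg hρ₀pos K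
  have hA := hsol.aPrioriBounds ha hγ1 hκ hΔt hρ0 (hE.trans (le_abs_self E₀))
  have hU : ∀ j, ∑ K, M.cellVol * |u 0 K j| ≤ U := fun j => by
    rw [hsol.init_velocity]; exact M.sum_abs_proj_le hu₀ hu₀int j
  have hX1 : M.h ≤ H ^ 2 * M.h ^ δ := by
    have := rpow_le_sq_mul_rpow hh hhH hH1 (s := 1) (δ := δ) (by linarith) (by linarith)
    rwa [Real.rpow_one] at this
  have hX2 : M.h ^ α * M.h ≤ H ^ 2 * M.h ^ δ := by
    rw [← Real.rpow_add_one hh.ne']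
    exact rpow_le_sq_mul_rpow hh hhH hH1 (by linarith) (by linarith)
  have hX3 : M.h ^ ((1 - α) / 2) ≤ H ^ 2 * M.h ^ δ :=
    rpow_le_sq_mul_rpow hh hhH hH1 hδ1 (by linarith)
  have hX4 : M.h ^ (β + 1) ≤ H ^ 2 * M.h ^ δ :=
    rpow_le_sq_mul_rpow hh hhH hH1 hδ2 (by linarith)
  have hhδ : 0 ≤ M.h ^ δ := Real.rpow_nonneg hh.le _
  refine ⟨fun φ hφ => ?_, fun φ hφ => ⟨?_, ?_⟩⟩
  · have hN := hφ.c3Norm_nonneg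
    obtain ⟨e, he, hint⟩ := exists_integral_eq d hT
      (-(∫ x in torus d, M.eval (ρ 0) x * φ (0, x)) - densityForm M T Δt ρ u φ)
    refine ⟨e, he, by rw [hint]; ring, ?_⟩
    rw [hint]
    have hφb := hφ.testBounds (ContinuousLinearMap.id ℝ ℝ) fun w => le_rfl
    have key := hA.abs_consistency_le hedge hκ hΔt hΔtc hTn hX1 hX2 hX3 hX4 hN
      (hφb.momentBounds M hΔt hTn.le) (g := fun _ _ => 1) (p := fun _ _ => 0) (w := fun _ _ => 0)
      (Q := m) (P := 0) (U := 0) ⟨0, hd1⟩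
      (fun k hk => by simpa using hA.mass k hk) (fun k _ => by simp) (by simp)
      (fun k hk K => by
        have := hsol.density (k + 1) (Finset.mem_Icc.2 ⟨by omega, by omega⟩) K
        simpa [faceAvg, faceJump] using this)
    rw [densityForm_eq M hΔt (n + 1) hTn ρ u hφ ⟨0, hd1⟩,
      integral_eval_mul M (hφ.periodic 0 le_rfl) (continuous_slice hφb.continuousOn le_rfl)]
    simp only [faceJump, sub_self, zero_mul, mul_zero, Finset.sum_const_zero, sub_zero, mul_one,
      ContinuousLinearMap.id_apply] at key ⊢
    rw [← abs_neg, neg_sub, sub_neg_eq_add, add_comm]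
    calc _ ≤ _ := key
      _ = C₁ * M.h ^ δ * c3Norm φ := by rw [hC₁]; ring
      _ ≤ _ := by
        gcongr
        linarith [le_abs_self C₁, abs_nonneg C₂, abs_nonneg C₃]
  · have hN := hφ.c3Norm_nonneg
    obtain ⟨e, he, hint⟩ := exists_integral_eq d hT
      (-(∫ x in torus d, ∑ i, M.eval (ρ 0) x * M.eval (u 0) x i * φ (0, x) i)
        - momentumForm M a γ T Δt ρ u φ - diffusionTerm M β T Δt u φ)
    refine ⟨e, he, by rw [hint]; ring, ?_⟩
    rw [hint]
    have key := fun j => hA.abs_consistency_le hedge hκ hΔt hΔtc hTn hX1 hX2 hX3 hX4 hN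
      ((hφ.component j).momentBounds M hΔt hTn.le) (g := fun k K => u k K j)
      (p := fun k K => pressure a γ (ρ k K)) (w := fun k K => u k K j)
      (Q := 2 * S) (P := (γ - 1) * S) (U := U) j
      (fun k hk => by
        refine le_trans (Finset.sum_le_sum fun K _ => ?_) (hA.kinetic k hk)
        have := Finset.single_le_sum (f := fun j => u k K j ^ 2) (fun j _ => sq_nonneg _)
          (Finset.mem_univ j)
        have := hA.nonneg k hk K
        have := M.cellVol_pos
        gcongr)
      (fun k hk => by
        refine le_of_eq_of_le (Finset.sum_congr rfl fun K _ => ?_)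
          (hsol.sum_rpow_le ha hγ1 hκ hΔt hρ0 (hE.trans (le_abs_self E₀)) hk)
        rw [pressure, abs_of_nonneg]
        exact mul_nonneg ha.le (Real.rpow_nonneg (hA.nonneg k hk K) _))
      (hU j)
      (fun k hk K => hsol.momentum (k + 1) (Finset.mem_Icc.2 ⟨by omega, by omega⟩) K j)
    have hsum := (Finset.abs_sum_le_sum_abs _ _).trans
      (Finset.sum_le_card_nsmul Finset.univ _ _ fun j (_ : j ∈ Finset.univ) => key j)
    rw [Finset.card_univ, Fintype.card_fin, nsmul_eq_mul, Finset.sum_sub_distrib,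
      Finset.sum_add_distrib] at hsum
    rw [momentumForm_eq M hΔt (n + 1) hTn ρ u hφ, diffusionTerm_eq M hΔt (n + 1) hTn u hφ,
      integral_eval_momentum M hφ, Finset.sum_neg_distrib, ← abs_neg]
    refine le_of_eq_of_le (congrArg abs ?_) (hsum.trans ?_)
    · ring
    · calc _ = C₂ * M.h ^ δ * c3Norm φ := by rw [hC₂]; ring
        _ ≤ _ := by
          gcongr
          linarith [le_abs_self C₂, abs_nonneg C₁, abs_nonneg C₃]
  · have hN := hφ.c3Norm_nonneg
    rw [diffusionTerm_eq M hΔt (n + 1) hTn u hφ]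
    have hY : ∀ s, (β + 1) / 2 ≤ s → s ≤ β + 1 → M.h ^ s ≤ H ^ 2 * M.h ^ ((β + 1) / 2) :=
      fun s h1 h2 => rpow_le_sq_mul_rpow hh hhH hH1 h1 (by linarith)
    have hh0 : 0 ≤ M.h ^ ((β + 1) / 2) := Real.rpow_nonneg hh.le _
    calc _ ≤ _ := hA.abs_diffusion_le hedge hκ hΔt hΔtc hTn (hY _ (by linarith) le_rfl)
          (hY _ le_rfl (by linarith)) hN
          (fun j => (hφ.component j).momentBounds M hΔt hTn.le) hU
      _ = C₃ * M.h ^ ((β + 1) / 2) * c3Norm φ := by rw [hC₃]; ring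
      _ ≤ _ := by
        gcongr
        linarith [le_abs_self C₃, abs_nonneg C₁, abs_nonneg C₂]
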